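/- **Theorem 1.1 (Learning an unknown quantum channel).** For a probability distribution $D$ on the Bloch sphere (the pure single-qubit states $\rho=\frac12(I+xX+yY+zZ)$ with $x^2+y^2+z^2=1$), the Pauli second moment matrix $S\in\mathbb R^{3\times 3}$ has entries $S_{P,Q}=\mathbb E_{\rho\sim D}[\operatorname{tr}(P\rho)\operatorname{tr}(Q\rho)]$, $P,Q\in\{X,Y,Z\}$. *Access model.* The learner receives $(n,\varepsilon,\delta,\eta)$. It can (a) draw independent training examples $\rho=\rho_1\otimes\cdots\otimes\rho_n\sim D^{\otimes n}$, each given by its classical description, the $3n$ real numbers $\operatorname{tr}(P\rho_i)$; and (b) prepare a product state $\sigma$ with a description of its choice, send it through $\mathcal E$, and perform the two-outcome measurement $\{\frac{I+O}2,\frac{I-O}2\}$ on $\mathcal E[\sigma]$. It has no other access to $D$, $\mathcal E$ and $O$. Computations are those of a unit-cost random access machine with a memory of natural numbers (addition, truncated subtraction, comparison) and a memory of real numbers (field operations, comparison, rational constants, conversion of natural numbers to reals, no rounding), and with indirect addressing; drawing an example or using the channel costs $3n+1$ steps plus the evaluation of the addresses. Sample complexity is the number of examples drawn plus the number of channel uses.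 *Statement.* There are a constant $C>0$, a learning program and a prediction program (which draws no examples and does not use the channel), such that the following holds for all $n\ge 1$, all $\varepsilon,\delta,\eta\in(0,1)$, all probability distributions $D$ on the Bloch sphere with $\|S\|_{\mathrm{op}}\le 1-\eta$, all $n$-qubit channels (completely positive trace-preserving maps) $\mathcal E$, and all Hermitian $n$-qubit observables $O$ with $\|O\|_{\mathrm{op}}\le 1$. Put $$T=\min\!\Big(\frac{2^{Cn}}{\varepsilon^2},\ (n+1)^{C\log(2/\varepsilon)/\log(1/(1-\eta))}\Big)\cdot\log(2/\delta).$$ For $n\ge 2$ and $\varepsilon,\delta\le\frac12$, this is $\min\big(2^{O(n)}/\varepsilon^2,\ n^{O(\log(1/\varepsilon)/\log(1/(1-\eta)))}\big)\cdot\log(1/\delta)$. The learning program always halts within $T$ steps, with sample complexity at most $T$. Its output, the final memory content, represents a real-valued map $f'$ on $n$-qubit product states: given the classical description of any $\rho$ as input, the prediction program computes the number $f'(\rho)$ from it within $T$ steps. With probability at least $1-\delta$ over the training examples and the measurement outcomes, $$\mathbb E_{\rho\sim D^{\otimes n}}\big[(\operatorname{tr}(O\,\mathcal E[\rho])-f'(\rho))^2\big]\le\varepsilon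 .$$ -/

import Mathlib

open MeasureTheory
open scoped ComplexOrder Matrix

namespace QLearn

noncomputable section

/-! ### Qubits, product states, observables, channels -/

/-- The Pauli matrices `X`, `Y`, `Z`, indexed by `0`, `1`, `2`. -/
def pauli : Fin 3 → Matrix (Fin 2) (Fin 2) ℂ :=
  ![!![0, 1; 1, 0], !![0, -Complex.I; Complex.I, 0], !![1, 0; 0, -1]]

/-- The single-qubit operator `(I + v₀ X + v₁ Y + v₂ Z) / 2`; it is a state iff `‖v‖₂ ≤ 1`. -/
def qubitState (v : Fin 3 → ℝ) : Matrix (Fin 2) (Fin 2) ℂ :=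
  (1 / 2 : ℂ) • (1 + ∑ p, (v p : ℂ) • pauli p)

/-- The expectation value `tr(P ρ)` of a Pauli matrix. -/
def pauliExp (p : Fin 3) (ρ : Matrix (Fin 2) (Fin 2) ℂ) : ℝ :=
  (pauli p * ρ).trace.re

/-- The Bloch sphere: Bloch vectors of unit Euclidean norm, i.e. pure single-qubit states. -/
abbrev BlochSphere : Type :=
  Metric.sphere (0 : EuclideanSpace ℝ (Fin 3)) 1

/-- The single-qubit state with a given Bloch vector. -/
def BlochSphere.state (x : BlochSphere) : Matrix (Fin 2) (Fin 2) ℂ :=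
  qubitState fun p => x.1 p

/-- The Pauli second moment matrix `S_{P,Q} = E_{ρ ∼ D}[tr(P ρ) tr(Q ρ)]`. -/
def secondMoment (D : Measure BlochSphere) : Matrix (Fin 3) (Fin 3) ℝ :=
  Matrix.of fun p q => ∫ x, pauliExp p x.state * pauliExp q x.state ∂D

/-- The operator norm of a square matrix with respect to the Euclidean norm. -/
def opNorm {𝕜 ι : Type} [RCLike 𝕜] [Fintype ι] [DecidableEq ι] (A : Matrix ι ι 𝕜) : ℝ :=
  ‖Matrix.toEuclideanCLM (n := ι) (𝕜 := 𝕜) A‖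

/-- The computational basis labels of an `n`-qubit system. -/
abbrev Idx (n : ℕ) : Type := Fin n → Fin 2

/-- Operators on the `n`-qubit space `(ℂ²)^{⊗ n}`. -/
abbrev Op (n : ℕ) : Type := Matrix (Idx n) (Idx n) ℂ

/-- The tensor product `A₀ ⊗ ⋯ ⊗ A_{n-1}` of single-qubit operators. -/
def tensorOp {n : ℕ} (A : Fin n → Matrix (Fin 2) (Fin 2) ℂ) : Op n :=
  Matrix.of fun i j => ∏ k, A k (i k) (j k)

/-- The product state `ρ₀ ⊗ ⋯ ⊗ ρ_{n-1}` of pure qubits. -/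
def productState {n : ℕ} (x : Fin n → BlochSphere) : Op n :=
  tensorOp fun k => (x k).state

/-- `D^{⊗ n}`, as a law on `n`-tuples of Bloch vectors. -/
def productLaw (n : ℕ) (D : Measure BlochSphere) : Measure (Fin n → BlochSphere) :=
  Measure.pi fun _ => D

/-- An `n`-qubit quantum channel: a completely positive trace-preserving linear map. -/
structure Channel (n : ℕ) where
  map : Op n →ₗ[ℂ] Op n
  /-- For every `k`, the map `id_k ⊗ map` (which acts on each of the `k × k` blocks) preserves
  positive semidefiniteness. -/
  completelyPositive : ∀ (k : ℕ) (M : Matrix (Fin k × Idx n) (Fin k × Idx n) ℂ), M.PosSemidef →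
    (Matrix.of fun a b : Fin k × Idx n =>
      map (M.submatrix (Prod.mk a.1) (Prod.mk b.1)) a.2 b.2).PosSemidef
  tracePreserving : ∀ A : Op n, (map A).trace = A.trace

/-- A bounded observable: Hermitian of operator norm at most `1`. -/
def IsBoundedObservable {n : ℕ} (O : Op n) : Prop :=
  O.IsHermitian ∧ opNorm O ≤ 1

/-- The expectation `tr(O E[ρ])` of the observable after the channel. -/
def expectation {n : ℕ} (E : Channel n) (O : Op n) (ρ : Op n) : ℝ :=
  (O * E.map ρ).trace.re

/-- The probability of the first outcome when `E[ρ]` is measured with the two-outcome measurement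
`{(I + O)/2, (I - O)/2}`. -/
def plusProb {n : ℕ} (E : Channel n) (O : Op n) (ρ : Op n) : ℝ :=
  (((1 / 2 : ℂ) • (1 + O)) * E.map ρ).trace.re

/-- The classical description of a product state: the `3 n` numbers `tr(P ρ_i)`, with
`tr(P ρ_i)` at position `3 i + P`. -/
def description {n : ℕ} (x : Fin n → BlochSphere) (j : ℕ) : ℝ :=
  if h : j / 3 < n then pauliExp ⟨j % 3, Nat.mod_lt j (by norm_num)⟩ (x ⟨j / 3, h⟩).state else 0

/-! ### Machine model

A random access machine with unit cost: a memory of natural numbers and a memory of real numbers,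
both with indirect addressing. The operations on natural numbers are addition, truncated
subtraction and comparison, those on real numbers are the field operations and comparison (there is
no rounding). Programs are `while`-programs. The only access to the unknown distribution is an
instruction that delivers a training example, and the only access to the channel and to the
observable is an instruction that prepares a product state, sends it through the channel and
measures the output. -/

/-- Natural-number expressions; `get a` is the content of the cell of address `a`. -/
inductive NExp : Type
  | lit (k : ℕ)
  | get (a : NExp)
  | add (a b : NExp)
  | sub (a b : NExp)

/-- Real expressions: rational constants, memory cells, cells of the read-only input, conversion of
a natural number, field operations. -/
inductive RExp : Type
  | lit (q : ℚ)
  | get (a : NExp)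
  | input (a : NExp)
  | ofNat (a : NExp)
  | add (a b : RExp)
  | sub (a b : RExp)
  | mul (a b : RExp)
  | div (a b : RExp)

/-- Tests. -/
inductive BExp : Type
  | natLt (a b : NExp)
  | realLt (a b : RExp)
  | not (b : BExp)
  | and (b c : BExp)

/-- Programs. -/
inductive Prog : Type
  | skip
  /-- `setNat a e` writes the value of `e` into the natural-number cell of address `a`. -/
  | setNat (a e : NExp)
  /-- `setReal a e` writes the value of `e` into the real cell of address `a`. -/
  | setReal (a : NExp) (e : RExp)
  | seq (c d : Prog)
  | ite (b : BExp) (c d : Prog)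
  | loop (b : BExp) (c : Prog)
  /-- `draw a` obtains a fresh training example and writes its classical description into the
  `3 n` real cells from address `a` on. -/
  | draw (a : NExp)
  /-- `query a b` prepares the product state whose description stands in the `3 n` real cells from
  address `a` on, sends it through the channel, measures, and writes the outcome `1` or `-1` into
  the real cell of address `b`. -/
  | query (a b : NExp)

/-- The program neither draws training examples nor uses the channel. -/
def Prog.OracleFree : Prog → Prop
  | .skip => True
  | .setNat _ _ => True
  | .setReal _ _ => True
  | .seq c d => c.OracleFree ∧ d.OracleFree
  | .ite _ c d => c.OracleFree ∧ d.OracleFree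
  | .loop _ c => c.OracleFree
  | .draw _ => False
  | .query _ _ => False

/-- A machine state: the two memories, and the numbers of training examples drawn and of channel
uses made so far. -/
structure State : Type where
  nat : ℕ → ℕ
  real : ℕ → ℝ
  drawn : ℕ
  queried : ℕ

def NExp.eval (s : State) : NExp → ℕ
  | .lit k => k
  | .get a => s.nat (a.eval s)
  | .add a b => a.eval s + b.eval s
  | .sub a b => a.eval s - b.eval s

/-- Division by zero gives zero. -/
def RExp.eval (inp : ℕ → ℝ) (s : State) : RExp → ℝ
  | .lit q => (q : ℝ)
  | .get a => s.real (a.eval s)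
  | .input a => inp (a.eval s)
  | .ofNat a => (a.eval s : ℝ)
  | .add a b => a.eval inp s + b.eval inp s
  | .sub a b => a.eval inp s - b.eval inp s
  | .mul a b => a.eval inp s * b.eval inp s
  | .div a b => a.eval inp s / b.eval inp s

def BExp.Holds (inp : ℕ → ℝ) (s : State) : BExp → Prop
  | .natLt a b => a.eval s < b.eval s
  | .realLt a b => a.eval inp s < b.eval inp s
  | .not b => ¬ b.Holds inp s
  | .and b c => b.Holds inp s ∧ c.Holds inp s

/-- The cost of evaluating an expression: its number of nodes. -/
def NExp.cost : NExp → ℕ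
  | .lit _ => 1
  | .get a => a.cost + 1
  | .add a b => a.cost + b.cost + 1
  | .sub a b => a.cost + b.cost + 1

/-- The cost of evaluating an expression: its number of nodes. -/
def RExp.cost : RExp → ℕ
  | .lit _ => 1
  | .get a => a.cost + 1
  | .input a => a.cost + 1
  | .ofNat a => a.cost + 1
  | .add a b => a.cost + b.cost + 1
  | .sub a b => a.cost + b.cost + 1
  | .mul a b => a.cost + b.cost + 1
  | .div a b => a.cost + b.cost + 1

/-- The cost of evaluating an expression: its number of nodes. -/
def BExp.cost : BExp → ℕ
  | .natLt a b => a.cost + b.cost + 1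
  | .realLt a b => a.cost + b.cost + 1
  | .not b => b.cost + 1
  | .and b c => b.cost + c.cost + 1

/-- All the randomness of a learning run: the sequence of training examples, and one number of
`[0, 1]` for each channel use, from which the outcome of the measurement is determined. -/
abbrev Randomness (n : ℕ) : Type :=
  (ℕ → Fin n → BlochSphere) × (ℕ → unitInterval)

/-- The training examples are i.i.d. from `D^{⊗ n}`; independently of them, the numbers that decide
the measurement outcomes are i.i.d. uniform on `[0, 1]`. -/
def randomnessLaw (n : ℕ) (D : Measure BlochSphere) [IsProbabilityMeasure D] :
    Measure (Randomness n) :=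
  (Measure.infinitePi fun _ : ℕ => Measure.pi fun _ : Fin n => D).prod
    (Measure.infinitePi fun _ : ℕ => (volume : Measure unitInterval))

/-- What the machine interacts with. -/
structure World (n : ℕ) where
  channel : Channel n
  obs : Op n
  random : Randomness n

/-- The outcome of the `k`-th use of the channel, on input `ρ`: it is `1` with probability
`tr((I + O)/2 · E[ρ])` and `-1` otherwise. -/
def World.outcome {n : ℕ} (w : World n) (k : ℕ) (ρ : Op n) : ℝ :=
  open Classical in
  if (w.random.2 k : ℝ) < plusProb w.channel w.obs ρ then 1 else -1

/-- The real memory after the classical description of `x` has been written from `base` on. -/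
def writeExample {n : ℕ} (x : Fin n → BlochSphere) (base : ℕ) (r : ℕ → ℝ) (j : ℕ) : ℝ :=
  if base ≤ j ∧ j < base + 3 * n then description x (j - base) else r j

/-- The `i`-th of the Bloch vectors that stand in real memory from `base` on. -/
def readBloch (r : ℕ → ℝ) (base i : ℕ) (p : Fin 3) : ℝ :=
  r (base + 3 * i + p)

/-- `Exec w inp c s t s₁`: with read-only input `inp`, the program `c` started in the state `s`
halts after `t` steps in the state `s₁`. Drawing an example and using the channel cost
`3 n + 1` steps on top of the addresses. A channel use is possible only if the `n` vectors
in memory are Bloch vectors of states. -/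
inductive Exec {n : ℕ} (w : World n) (inp : ℕ → ℝ) : Prog → State → ℕ → State → Prop
  | skip (s : State) : Exec w inp .skip s 1 s
  | setNat (a e : NExp) (s : State) :
      Exec w inp (.setNat a e) s (a.cost + e.cost + 1)
        { s with nat := Function.update s.nat (a.eval s) (e.eval s) }
  | setReal (a : NExp) (e : RExp) (s : State) :
      Exec w inp (.setReal a e) s (a.cost + e.cost + 1)
        { s with real := Function.update s.real (a.eval s) (e.eval inp s) }
  | seq {c d : Prog} {s s₁ s₂ : State} {t₁ t₂ : ℕ} :
      Exec w inp c s t₁ s₁ → Exec w inp d s₁ t₂ s₂ → Exec w inp (.seq c d) s (t₁ + t₂) s₂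
  | iteTrue {b : BExp} {c d : Prog} {s s₁ : State} {t : ℕ} :
      b.Holds inp s → Exec w inp c s t s₁ → Exec w inp (.ite b c d) s (b.cost + 1 + t) s₁
  | iteFalse {b : BExp} {c d : Prog} {s s₁ : State} {t : ℕ} :
      ¬ b.Holds inp s → Exec w inp d s t s₁ → Exec w inp (.ite b c d) s (b.cost + 1 + t) s₁
  | loopDone {b : BExp} {c : Prog} {s : State} :
      ¬ b.Holds inp s → Exec w inp (.loop b c) s (b.cost + 1) s
  | loopStep {b : BExp} {c : Prog} {s s₁ s₂ : State} {t₁ t₂ : ℕ} :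
      b.Holds inp s → Exec w inp c s t₁ s₁ → Exec w inp (.loop b c) s₁ t₂ s₂ →
      Exec w inp (.loop b c) s (b.cost + 1 + t₁ + t₂) s₂
  | draw (a : NExp) (s : State) :
      Exec w inp (.draw a) s (a.cost + 3 * n + 1)
        { s with
          real := writeExample (w.random.1 s.drawn) (a.eval s) s.real
          drawn := s.drawn + 1 }
  | query (a b : NExp) (s : State) :
      (∀ i : Fin n, ∑ p, readBloch s.real (a.eval s) i p ^ 2 ≤ 1) →
      Exec w inp (.query a b) s (a.cost + b.cost + 3 * n + 1)
        { s with
          real := Function.update s.real (b.eval s)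
            (w.outcome s.queried
              (tensorOp fun i : Fin n => qubitState (readBloch s.real (a.eval s) i)))
          queried := s.queried + 1 }

/-- A program has at most one run from a given state. -/
theorem Exec.deterministic {n : ℕ} {w : World n} {inp : ℕ → ℝ} {c : Prog} {s s₁ s₂ : State}
    {t₁ t₂ : ℕ} (h₁ : Exec w inp c s t₁ s₁) (h₂ : Exec w inp c s t₂ s₂) :
    t₁ = t₂ ∧ s₁ = s₂ := by
  induction h₁ generalizing t₂ s₂ with
  | skip s => cases h₂; exact ⟨rfl, rfl⟩
  | setNat a e s => cases h₂; exact ⟨rfl, rfl⟩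
  | setReal a e s => cases h₂; exact ⟨rfl, rfl⟩
  | seq _ _ ih₁ ih₂ =>
    cases h₂ with
    | seq g₁ g₂ =>
      obtain ⟨rfl, rfl⟩ := ih₁ g₁
      obtain ⟨rfl, rfl⟩ := ih₂ g₂
      exact ⟨rfl, rfl⟩
  | iteTrue hb _ ih =>
    cases h₂ with
    | iteTrue _ g => obtain ⟨rfl, rfl⟩ := ih g; exact ⟨rfl, rfl⟩
    | iteFalse hb2 _ => exact absurd hb hb2
  | iteFalse hb _ ih =>
    cases h₂ with
    | iteTrue hb2 _ => exact absurd hb2 hb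
    | iteFalse _ g => obtain ⟨rfl, rfl⟩ := ih g; exact ⟨rfl, rfl⟩
  | loopDone hb =>
    cases h₂ with
    | loopDone _ => exact ⟨rfl, rfl⟩
    | loopStep hb2 _ _ => exact absurd hb2 hb
  | loopStep hb _ _ ih₁ ih₂ =>
    cases h₂ with
    | loopDone hb2 => exact absurd hb hb2
    | loopStep _ g₁ g₂ =>
      obtain ⟨rfl, rfl⟩ := ih₁ g₁
      obtain ⟨rfl, rfl⟩ := ih₂ g₂
      exact ⟨rfl, rfl⟩
  | draw a s => cases h₂; exact ⟨rfl, rfl⟩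
  | query a b s _ => cases h₂; exact ⟨rfl, rfl⟩

/-- The state in which learning starts: the number of qubits in the first natural-number cell, and
everything else zero. -/
def initState (n : ℕ) : State where
  nat := fun j => if j = 0 then n else 0
  real := fun _ => 0
  drawn := 0
  queried := 0

/-- The read-only input of the learner: the parameters `ε`, `δ`, `η`. -/
def paramInput (ε δ η : ℝ) (j : ℕ) : ℝ :=
  if j = 0 then ε else if j = 1 then δ else if j = 2 then η else 0

/-- In the world `w` and with parameters `ε`, `δ`, `η`, the program `learn` halts within `T` steps,
having used at most `T` training examples and channel uses in total, and leaves a memory from which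
`predict`, given the classical description of any product state as its input, computes the value
of `f` on this state, left in the first real cell, within `T` steps. -/
def Outputs {n : ℕ} (learn predict : Prog) (w : World n) (ε δ η T : ℝ)
    (f : (Fin n → BlochSphere) → ℝ) : Prop :=
  ∃ (t : ℕ) (s : State), Exec w (paramInput ε δ η) learn (initState n) t s ∧
    (t : ℝ) ≤ T ∧ ((s.drawn + s.queried : ℕ) : ℝ) ≤ T ∧
    ∀ x : Fin n → BlochSphere, ∃ (t₁ : ℕ) (s₁ : State),
      Exec w (description x) predict s t₁ s₁ ∧ (t₁ : ℝ) ≤ T ∧ s₁.real 0 = f x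

/-- `f` predicts `tr(O E[ρ])` with mean squared error at most `ε` over `ρ ∼ D^{⊗ n}`. -/
def HasTestLoss {n : ℕ} (D : Measure BlochSphere) (E : Channel n) (O : Op n)
    (f : (Fin n → BlochSphere) → ℝ) (ε : ℝ) : Prop :=
  Integrable (fun x => (expectation E O (productState x) - f x) ^ 2) (productLaw n D) ∧
    ∫ x, (expectation E O (productState x) - f x) ^ 2 ∂(productLaw n D) ≤ ε

/-- The complexity `min(2^{C n} / ε², (n+1)^{C log(2/ε) / log(1/(1-η))}) · log(2/δ)`. -/
def complexityBound (C : ℝ) (n : ℕ) (ε δ η : ℝ) : ℝ :=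
  min ((2 : ℝ) ^ (C * n) / ε ^ 2)
    (((n : ℝ) + 1) ^ (C * (Real.log (2 / ε) / Real.log (1 / (1 - η))))) * Real.log (2 / δ)

end

end QLearn

open QLearn

/-!
The function to be learned is `h(x) = tr(O E[ρ_x])`. It depends affinely on the Bloch vector of each
qubit, `h(x) = ∑_P c_P ∏ₖ (1, xₖ)_{Pₖ}` (`expectation_productOp`), and `|h| ≤ 1` on product states.
Around the mean Bloch vector `μ` it has the orthogonal decomposition `h = ∑_A h_A` into components
that are centred at the sites of `A`. The proof rests on the estimate
`∑_A (1 + η/8)^|A| E[h_A²] ≤ 1` (`sum_weighted_component_le`): it makes the truncation of `h` to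
`|A| ≤ k` accurate in mean square for `k` of order `log(1/ε)/η`.

The estimate comes from quantum mechanics. For the Heisenberg picture observable `O' = E^*(O)`
with `‖O'‖ ≤ 1` and any product state `ρ` one has `tr(O' √ρ O' √ρ) ≤ 1`
(`IsContractive.tensorForm_kmsForm_le`), and the left side is the quadratic form in `c` of a tensor
product of `4 × 4` matrices, one for each site. Averaging over `ρ` whose Bloch vectors are midpoints
of two independent samples of `D`, one obtains the tensor power of one matrix, `meanForm D`. The
square root in the form makes this matrix exceed the second moment matrix of `(1, x)`: since
`‖S‖ ≤ 1 - η` keeps `D` from concentrating on two antipodal points, it dominates the form of the mean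
plus `1 + η/8` times the covariance (`meanForm_gap`, from the pointwise `midpoint_inequality`). Expanding
the tensor power of this sum gives the weights `(1 + η/8)^|A|`.

The truncated function is determined by the values of `h` at few states: a *pattern* marks at most
`k` sites with one of the six unit vectors `±e_p`, its probe state carries these vectors at the marked
sites and the mean at the others, and an explicit interpolation formula recovers the truncated `h`
(`sum_coeff_mul_multi`). The formula is an identity for every centre, so the learner may use an
empirical mean `ν` to prepare the probe states and to evaluate the formula; both are Lipschitz in `ν`
(`interpolation_error`). The values are estimated by repeated measurements, with Hoeffding's
inequality and a union bound (`estimates_concentration`).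

The number `M` of patterns is at most `7^n` and at most `(6n+1)^k`, and the machine builds their
table site by site, each pattern extending an earlier one, its parent, by one mark; the coefficients
in the formula are computed along the parents as well. The running time is polynomial in `M` and
`1/ε` and linear in `log(2/δ)`, which is within the claimed bound because `S` has trace one, so that
`η ≤ 2/3` (`complexity_le`).
-/

namespace QLearn

/-! ### Tensor products of single-site matrices -/

/-- The entrywise product over sites `∏ₖ Mₖ(Pₖ, Qₖ)`, i.e. the tensor product of square matrices
of one size. -/
def tensorMat {n : ℕ} {ι R : Type} [CommRing R] (M : Fin n → Matrix ι ι R) :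
    Matrix (Fin n → ι) (Fin n → ι) R :=
  Matrix.of fun P Q => ∏ k, M k (P k) (Q k)

/-- A tensor product of positive semidefinite matrices is positive semidefinite: it is a Hadamard
product of submatrices. -/
theorem tensorMat_posSemidef {n : ℕ} {ι 𝕜 : Type} [Fintype ι] [RCLike 𝕜]
    {M : Fin n → Matrix ι ι 𝕜} (h : ∀ k, (M k).PosSemidef) : (tensorMat M).PosSemidef := by
  classical
  have key : ∀ s : Finset (Fin n), (Matrix.of fun P Q : Fin n → ι =>
      ∏ k ∈ s, M k (P k) (Q k)).PosSemidef := by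
    intro s
    induction s using Finset.induction_on with
    | empty =>
      have := Matrix.posSemidef_vecMulVec_self_star (R := 𝕜) (fun _ : Fin n → ι => (1 : 𝕜))
      convert this using 1
      ext P Q
      simp [Matrix.vecMulVec_apply]
    | insert a s ha ih =>
      have := ((h a).submatrix (fun P : Fin n → ι => P a)).hadamard ih
      convert this using 1
      ext P Q
      simp [Finset.prod_insert ha, Matrix.hadamard]
  exact key Finset.univ

theorem tensorOp_posSemidef {n : ℕ} {A : Fin n → Matrix (Fin 2) (Fin 2) ℂ}
    (h : ∀ k, (A k).PosSemidef) : (tensorOp A).PosSemidef :=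
  tensorMat_posSemidef h

theorem tensorOp_mul {n : ℕ} (A B : Fin n → Matrix (Fin 2) (Fin 2) ℂ) :
    tensorOp A * tensorOp B = tensorOp fun k => A k * B k := by
  ext i j
  simp only [tensorOp, Matrix.mul_apply, Matrix.of_apply, ← Finset.prod_mul_distrib]
  rw [Finset.prod_univ_sum]
  simp [Fintype.piFinset_univ]

theorem tensorOp_trace {n : ℕ} (A : Fin n → Matrix (Fin 2) (Fin 2) ℂ) :
    (tensorOp A).trace = ∏ k, (A k).trace := by
  simp only [tensorOp, Matrix.trace, Matrix.diag, Matrix.of_apply]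
  rw [Finset.prod_univ_sum]
  simp [Fintype.piFinset_univ]

theorem tensorOp_conjTranspose {n : ℕ} (A : Fin n → Matrix (Fin 2) (Fin 2) ℂ) :
    (tensorOp A)ᴴ = tensorOp fun k => (A k)ᴴ := by
  ext i j
  simp [tensorOp, Matrix.conjTranspose_apply]

theorem tensorOp_one {n : ℕ} : tensorOp (fun _ : Fin n => 1) = 1 := by
  ext i j
  simp only [tensorOp, Matrix.of_apply, Matrix.one_apply]
  by_cases h : i = j
  · simp [h]
  · obtain ⟨k, hk⟩ := Function.ne_iff.mp h
    rw [if_neg h]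
    exact Finset.prod_eq_zero (Finset.mem_univ k) (if_neg hk)

theorem tensorOp_sum {n : ℕ} {ι : Type} [Fintype ι] (f : Fin n → ι → ℂ)
    (B : ι → Matrix (Fin 2) (Fin 2) ℂ) :
    tensorOp (fun k => ∑ a, f k a • B a) =
      ∑ P : Fin n → ι, (∏ k, f k (P k)) • tensorOp fun k => B (P k) := by
  classical
  ext i j
  simp only [tensorOp, Matrix.of_apply, Matrix.sum_apply, Matrix.smul_apply, smul_eq_mul,
    ← Finset.prod_mul_distrib]
  rw [Finset.prod_univ_sum]
  simp [Fintype.piFinset_univ]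

/-! ### Pauli strings -/

/-- The matrices `I, X, Y, Z`, with `none` for the identity. -/
noncomputable def sigma : Option (Fin 3) → Matrix (Fin 2) (Fin 2) ℂ
  | none => 1
  | some p => pauli p

/-- The vector `(1, v₀, v₁, v₂)` of expectations of `I, X, Y, Z`. -/
def extend (v : Fin 3 → ℝ) : Option (Fin 3) → ℝ
  | none => 1
  | some p => v p

theorem qubitState_eq (v : Fin 3 → ℝ) :
    qubitState v = ∑ a, ((1 / 2 : ℂ) * (extend v a : ℂ)) • sigma a := by
  simp [qubitState, Fintype.sum_option, extend, sigma, mul_smul, Finset.smul_sum]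

theorem sigma_isHermitian (a : Option (Fin 3)) : (sigma a).IsHermitian := by
  rcases a with _ | p
  · exact Matrix.isHermitian_one
  · ext i j
    fin_cases p <;> fin_cases i <;> fin_cases j <;> simp [sigma, pauli]

theorem sigma_mul_self (a : Option (Fin 3)) : sigma a * sigma a = 1 := by
  rcases a with _ | p
  · simp [sigma]
  · ext i j
    fin_cases p <;> fin_cases i <;> fin_cases j <;> simp [sigma, pauli, Matrix.mul_apply]

/-- Completeness of the Pauli matrices. -/
theorem sum_sigma_mul_sigma (i j a b : Fin 2) :
    ∑ P, (1 / 2 : ℂ) * (sigma P i j * sigma P a b) = if i = b ∧ j = a then 1 else 0 := by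
  rw [Fintype.sum_option, Fin.sum_univ_three]
  fin_cases i <;> fin_cases j <;> fin_cases a <;> fin_cases b <;>
    simp [sigma, pauli] <;> norm_num

/-- Every operator is the combination of Pauli strings with its Pauli coefficients. -/
theorem eq_sum_pauliStrings {n : ℕ} (A : Op n) :
    A = ∑ P : Fin n → Option (Fin 3),
      ((1 / 2 : ℂ) ^ n * ((tensorOp fun k => sigma (P k)) * A).trace) •
        tensorOp fun k => sigma (P k) := by
  classical
  ext a b
  have h : ∀ i j : Idx n, ∑ P : Fin n → Option (Fin 3),
      ∏ k, ((1 / 2 : ℂ) * (sigma (P k) (i k) (j k) * sigma (P k) (a k) (b k))) =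
        if i = b ∧ j = a then 1 else 0 := by
    intro i j
    have := Finset.prod_univ_sum (fun _ : Fin n => (Finset.univ : Finset (Option (Fin 3))))
      (fun k P => (1 / 2 : ℂ) * (sigma P (i k) (j k) * sigma P (a k) (b k)))
    rw [Fintype.piFinset_univ] at this
    rw [← this]
    simp only [sum_sigma_mul_sigma]
    by_cases hij : i = b ∧ j = a
    · simp [hij.1, hij.2]
    · rw [if_neg hij]
      have : ∃ k, ¬ (i k = b k ∧ j k = a k) := by
        by_contra hcon
        push Not at hcon
        exact hij ⟨funext fun k => (hcon k).1, funext fun k => (hcon k).2⟩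
      obtain ⟨k, hk⟩ := this
      exact Finset.prod_eq_zero (Finset.mem_univ k) (if_neg hk)
  have h2 : ∀ P : Fin n → Option (Fin 3),
      (((1 / 2 : ℂ) ^ n * ((tensorOp fun k => sigma (P k)) * A).trace) •
        tensorOp fun k => sigma (P k)) a b =
      ∑ i, ∑ j, (∏ k, ((1 / 2 : ℂ) * (sigma (P k) (i k) (j k) * sigma (P k) (a k) (b k)))) *
        A j i := by
    intro P
    simp only [Matrix.smul_apply, smul_eq_mul, Matrix.trace, Matrix.diag, Matrix.mul_apply,
      tensorOp, Matrix.of_apply, Finset.mul_sum, Finset.sum_mul, Finset.prod_mul_distrib,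
      Finset.prod_const, Finset.card_univ, Fintype.card_fin]
    refine Finset.sum_congr rfl fun i _ => Finset.sum_congr rfl fun j _ => ?_
    ring
  rw [Matrix.sum_apply, Finset.sum_congr rfl fun P _ => h2 P, Finset.sum_comm]
  have h3 : ∀ i : Idx n, ∑ P : Fin n → Option (Fin 3), ∑ j,
      (∏ k, ((1 / 2 : ℂ) * (sigma (P k) (i k) (j k) * sigma (P k) (a k) (b k)))) * A j i =
      if i = b then A a b else 0 := by
    intro i
    rw [Finset.sum_comm]
    simp only [← Finset.sum_mul, h]
    by_cases hi : i = b
    · subst hi; simp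
    · simp [hi]
  rw [Finset.sum_congr rfl fun i _ => h3 i]
  simp

/-! ### Square roots of qubit states -/

/-- A Hermitian square root of `qubitState v` (for `|v| ≤ 1`). -/
noncomputable def sqrtState (v : Fin 3 → ℝ) : Matrix (Fin 2) (Fin 2) ℂ :=
  ((√(1 + √(1 - ∑ p, v p ^ 2)) / 2 : ℝ) : ℂ) • 1 +
    ((1 / (2 * √(1 + √(1 - ∑ p, v p ^ 2))) : ℝ) : ℂ) • ∑ p, (v p : ℂ) • pauli p

/-- The symmetric form `tr(σ_a √ρ σ_b √ρ)` of the qubit state `ρ` with Bloch vector `v`, in the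
basis `I, X, Y, Z`. -/
noncomputable def kmsForm (v : Fin 3 → ℝ) : Matrix (Option (Fin 3)) (Option (Fin 3)) ℝ :=
  Matrix.of fun a b => match a, b with
    | none, b => extend v b
    | some p, none => v p
    | some p, some q => (if p = q then √(1 - ∑ p, v p ^ 2) else 0) +
        v p * v q / (1 + √(1 - ∑ p, v p ^ 2))

theorem sqrtState_isHermitian (v : Fin 3 → ℝ) : (sqrtState v).IsHermitian := by
  have h : ∀ p, (pauli p).IsHermitian := fun p => sigma_isHermitian (some p)
  simp [sqrtState, Matrix.IsHermitian, Matrix.conjTranspose_sum, (h _).eq]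

/-- With `s = √(1 - |v|²)` the root is `α + β v·σ`, where `α² = (1 + s)/4` and `4 α β = 1`. -/
theorem sqrtState_coeffs {v : Fin 3 → ℝ} (hv : ∑ p, v p ^ 2 ≤ 1) :
    ∃ α β s : ℝ, 0 ≤ s ∧ s ^ 2 = 1 - ∑ p, v p ^ 2 ∧ α ^ 2 = (1 + s) / 4 ∧ 4 * α * β = 1 ∧
      β ^ 2 * (4 * (1 + s)) = 1 ∧ s = √(1 - ∑ p, v p ^ 2) ∧
      sqrtState v = (α : ℂ) • 1 + (β : ℂ) • ∑ p, (v p : ℂ) • pauli p := by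
  set s := √(1 - ∑ p, v p ^ 2) with hs
  have hs0 : 0 ≤ s := Real.sqrt_nonneg _
  have h1 : √(1 + s) ^ 2 = 1 + s := Real.sq_sqrt (by linarith)
  have h2 : 0 < √(1 + s) := Real.sqrt_pos.mpr (by linarith)
  refine ⟨√(1 + s) / 2, 1 / (2 * √(1 + s)), s, hs0, Real.sq_sqrt (by linarith), ?_, ?_, ?_, rfl,
    rfl⟩
  · rw [div_pow, h1]; norm_num
  · field_simp; norm_num
  · rw [div_pow, mul_pow, h1]; field_simp; norm_num

theorem sqrtState_mul_self {v : Fin 3 → ℝ} (hv : ∑ p, v p ^ 2 ≤ 1) :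
    sqrtState v * sqrtState v = qubitState v := by
  obtain ⟨α, β, s, hs0, hs, hα, hαβ, hβ, -, hL⟩ := sqrtState_coeffs hv
  have hs1 : 1 + s ≠ 0 := by positivity
  have h1 : α ^ 2 + β ^ 2 * (∑ p, v p ^ 2) = 1 / 2 := by
    have : ∑ p, v p ^ 2 = (1 - s) * (1 + s) := by linarith
    rw [this, hα]; linear_combination (1 - s) / 4 * hβ
  have h1c : (α : ℂ) ^ 2 + (β : ℂ) ^ 2 * ((v 0 : ℂ) ^ 2 + (v 1 : ℂ) ^ 2 + (v 2 : ℂ) ^ 2) =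
      1 / 2 := by
    rw [Fin.sum_univ_three] at h1
    have h := congrArg Complex.ofReal h1
    push_cast at h
    exact h
  have h2c : 4 * (α : ℂ) * β = 1 := by exact_mod_cast congrArg (fun x : ℝ => (x : ℂ)) hαβ
  have hI := Complex.I_sq
  rw [hL, qubitState]
  ext i j
  fin_cases i <;> fin_cases j <;>
    simp [Matrix.mul_apply, Fin.sum_univ_three, pauli, Fin.sum_univ_two]
  · linear_combination h1c + (v 2 : ℂ) / 2 * h2c - (β : ℂ) ^ 2 * (v 1 : ℂ) ^ 2 * hI
  · linear_combination ((v 0 : ℂ) - v 1 * Complex.I) / 2 * h2c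
  · linear_combination ((v 0 : ℂ) + v 1 * Complex.I) / 2 * h2c
  · linear_combination h1c - (v 2 : ℂ) / 2 * h2c - (β : ℂ) ^ 2 * (v 1 : ℂ) ^ 2 * hI

theorem qubitState_posSemidef {v : Fin 3 → ℝ} (hv : ∑ p, v p ^ 2 ≤ 1) :
    (qubitState v).PosSemidef := by
  have h := Matrix.posSemidef_conjTranspose_mul_self (sqrtState v)
  rwa [(sqrtState_isHermitian v).eq, sqrtState_mul_self hv] at h

theorem qubitState_trace (v : Fin 3 → ℝ) : (qubitState v).trace = 1 := by
  simp [qubitState, Matrix.trace, Fin.sum_univ_three, pauli]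
  ring

/-- `kmsForm` is indeed the matrix of the form that its docstring describes. -/
theorem trace_sigma_sqrtState {v : Fin 3 → ℝ} (hv : ∑ p, v p ^ 2 ≤ 1) (a b : Option (Fin 3)) :
    (sigma a * sqrtState v * sigma b * sqrtState v).trace = (kmsForm v a b : ℂ) := by
  obtain ⟨α, β, s, hs0, hs, hα, hαβ, hβ, hsdef, hL⟩ := sqrtState_coeffs hv
  have hs1 : 1 + s ≠ 0 := by positivity
  have hs1c : (1 : ℂ) + s ≠ 0 := by exact_mod_cast hs1
  have h1 : α ^ 2 + β ^ 2 * (∑ p, v p ^ 2) = 1 / 2 := by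
    have : ∑ p, v p ^ 2 = (1 - s) * (1 + s) := by linarith
    rw [this, hα]; linear_combination (1 - s) / 4 * hβ
  have h3 : α ^ 2 - β ^ 2 * (∑ p, v p ^ 2) = s / 2 := by
    have : ∑ p, v p ^ 2 = (1 - s) * (1 + s) := by linarith
    rw [this, hα]; linear_combination -(1 - s) / 4 * hβ
  have h1c : (α : ℂ) ^ 2 + (β : ℂ) ^ 2 * ((v 0 : ℂ) ^ 2 + (v 1 : ℂ) ^ 2 + (v 2 : ℂ) ^ 2) =
      1 / 2 := by
    rw [Fin.sum_univ_three] at h1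
    have h := congrArg Complex.ofReal h1
    push_cast at h
    exact h
  have h3c : (α : ℂ) ^ 2 - (β : ℂ) ^ 2 * ((v 0 : ℂ) ^ 2 + (v 1 : ℂ) ^ 2 + (v 2 : ℂ) ^ 2) =
      (s : ℂ) / 2 := by
    rw [Fin.sum_univ_three] at h3; exact_mod_cast congrArg (fun x : ℝ => (x : ℂ)) h3
  have h2c : 4 * (α : ℂ) * β = 1 := by exact_mod_cast congrArg (fun x : ℝ => (x : ℂ)) hαβ
  have hdiv : ∀ x : ℝ, x / (1 + s) = 4 * β ^ 2 * x := fun x => by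
    rw [div_eq_iff hs1]; linear_combination -x * hβ
  have hI := Complex.I_sq
  rw [hL]
  have hk : kmsForm v = Matrix.of fun a b => match a, b with
      | none, b => extend v b
      | some p, none => v p
      | some p, some q => (if p = q then s else 0) + 4 * β ^ 2 * (v p * v q) := by
    ext a b
    rcases a with _ | p <;> rcases b with _ | q <;> simp [kmsForm, ← hsdef, hdiv]
  have hm : (α : ℂ) • (1 : Matrix (Fin 2) (Fin 2) ℂ) + (β : ℂ) • ∑ p, (v p : ℂ) • pauli p =
      !![(α : ℂ) + β * v 2, β * (v 0 - v 1 * Complex.I);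
        β * (v 0 + v 1 * Complex.I), α - β * v 2] := by
    ext i j
    fin_cases i <;> fin_cases j <;> simp [Fin.sum_univ_three, pauli] <;> grind
  rw [hk, hm]
  clear hm hk hdiv hL hsdef hβ hα hs hv hs1 hs1c h1 h3 hαβ hs0
  have hone : (1 : Matrix (Fin 2) (Fin 2) ℂ) = !![1, 0; 0, 1] := Matrix.one_fin_two
  rcases a with _ | p <;> rcases b with _ | q
  · simp only [sigma, hone, Matrix.mul_fin_two, Matrix.trace_fin_two_of, Matrix.of_apply, extend]
    push_cast
    grind
  · fin_cases q <;> simp [sigma, hone, pauli, extend, Matrix.trace_fin_two] <;> grind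
  · fin_cases p <;> simp [sigma, hone, pauli, extend, Matrix.trace_fin_two] <;> grind
  · fin_cases p <;> fin_cases q <;> simp [sigma, pauli, Matrix.trace_fin_two] <;> grind

/-! ### Contractive functionals and their Pauli coefficients -/

/-- A linear functional `ℓ` with `±ℓ ≤ tr` on positive semidefinite operators; these are the
functionals `A ↦ tr(O' A)` with `O'` Hermitian and `‖O'‖ ≤ 1`. -/
def IsContractive {n : ℕ} (l : Op n →ₗ[ℂ] ℂ) : Prop :=
  ∀ A : Op n, A.PosSemidef → 0 ≤ A.trace + l A ∧ 0 ≤ A.trace - l A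

/-- The coefficients of `ℓ` on Pauli strings, normalized so that `ℓ = tr(O' ·)` for
`O' = ∑ c_P P`. -/
noncomputable def pauliCoeff {n : ℕ} (l : Op n →ₗ[ℂ] ℂ) (P : Fin n → Option (Fin 3)) : ℝ :=
  (1 / 2) ^ n * (l (tensorOp fun k => sigma (P k))).re

/-- The function `∑_P c_P ∏ₖ (1, vₖ)_{Pₖ}`, affine in each of the vectors `vₖ`. -/
noncomputable def multi {n : ℕ} (c : (Fin n → Option (Fin 3)) → ℝ) (v : Fin n → Fin 3 → ℝ) : ℝ :=
  ∑ P, c P * ∏ k, extend (v k) (P k)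

/-- The quadratic form of a tensor product of matrices. -/
noncomputable def tensorForm {n : ℕ} (M : Fin n → Matrix (Option (Fin 3)) (Option (Fin 3)) ℝ)
    (c : (Fin n → Option (Fin 3)) → ℝ) : ℝ :=
  ∑ P, ∑ Q, c P * c Q * ∏ k, M k (P k) (Q k)

theorem IsContractive.im_eq_zero {n : ℕ} {l : Op n →ₗ[ℂ] ℂ} (hl : IsContractive l) {A : Op n}
    (hA : A.PosSemidef) : (l A).im = 0 := by
  have h1 := (Complex.le_def.mp (hl A hA).1).2
  have h2 := (Complex.le_def.mp (hl A hA).2).2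
  simp at h1 h2
  linarith

theorem IsContractive.abs_re_le {n : ℕ} {l : Op n →ₗ[ℂ] ℂ} (hl : IsContractive l) {A : Op n}
    (hA : A.PosSemidef) : |(l A).re| ≤ A.trace.re := by
  have h1 := (Complex.le_def.mp (hl A hA).1).1
  have h2 := (Complex.le_def.mp (hl A hA).2).1
  simp at h1 h2
  rw [abs_le]
  constructor <;> linarith

theorem IsContractive.map_pauliString {n : ℕ} {l : Op n →ₗ[ℂ] ℂ} (hl : IsContractive l)
    (P : Fin n → Option (Fin 3)) :
    (1 / 2 : ℂ) ^ n * l (tensorOp fun k => sigma (P k)) = pauliCoeff l P := by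
  set A : Op n := tensorOp fun k => sigma (P k) with hA
  have hH : Aᴴ = A := by
    rw [hA, tensorOp_conjTranspose]; simp only [(sigma_isHermitian _).eq]
  have hsq : A * A = 1 := by
    rw [hA, tensorOp_mul]; simp only [sigma_mul_self, tensorOp_one]
  have hpsd := Matrix.posSemidef_conjTranspose_mul_self (1 + A)
  have hB : (1 + A)ᴴ * (1 + A) = (2 : ℂ) • (1 + A) := by
    rw [Matrix.conjTranspose_add, Matrix.conjTranspose_one, hH, add_mul, mul_add, mul_add, hsq]
    simp only [one_mul, mul_one]
    module
  rw [hB] at hpsd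
  have h1 := hl.im_eq_zero hpsd
  have h2 := hl.im_eq_zero (Matrix.PosSemidef.one (n := Idx n) (R := ℂ))
  have h3 : (l A).im = 0 := by
    simp [map_smul, map_add, Complex.mul_im, h2] at h1
    exact h1
  have h4 : l A = ((l A).re : ℂ) := by
    apply Complex.ext <;> simp [h3]
  rw [pauliCoeff, ← hA, h4]
  push_cast
  simp

/-- On product states a contractive functional is the multi-affine function of its Pauli
coefficients. -/
theorem IsContractive.map_productOp {n : ℕ} {l : Op n →ₗ[ℂ] ℂ} (hl : IsContractive l)
    (v : Fin n → Fin 3 → ℝ) :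
    l (tensorOp fun k => qubitState (v k)) = (multi (pauliCoeff l) v : ℂ) := by
  simp only [qubitState_eq]
  rw [tensorOp_sum (fun k a => (1 / 2 : ℂ) * (extend (v k) a : ℂ)), map_sum, multi]
  push_cast
  refine Finset.sum_congr rfl fun P _ => ?_
  rw [map_smul, ← hl.map_pauliString, Finset.prod_mul_distrib]
  simp
  ring

theorem IsContractive.abs_multi_le {n : ℕ} {l : Op n →ₗ[ℂ] ℂ} (hl : IsContractive l)
    {v : Fin n → Fin 3 → ℝ} (hv : ∀ k, ∑ p, v k p ^ 2 ≤ 1) :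
    |multi (pauliCoeff l) v| ≤ 1 := by
  have h := hl.abs_re_le (tensorOp_posSemidef fun k => qubitState_posSemidef (hv k))
  rw [hl.map_productOp, tensorOp_trace] at h
  simpa [qubitState_trace] using h

/-- For `O' = ∑ c_P P` with `‖O'‖ ≤ 1` and a product state `ρ`, one has `tr(O' √ρ O' √ρ) ≤ 1`. This
follows from `tr((1 + O') √ρ (1 - O') √ρ) ≥ 0`, where the mixed terms cancel. -/
theorem IsContractive.tensorForm_kmsForm_le {n : ℕ} {l : Op n →ₗ[ℂ] ℂ} (hl : IsContractive l)
    {v : Fin n → Fin 3 → ℝ} (hv : ∀ k, ∑ p, v k p ^ 2 ≤ 1) :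
    tensorForm (fun k => kmsForm (v k)) (pauliCoeff l) ≤ 1 := by
  set c := pauliCoeff l with hc
  set S : (Fin n → Option (Fin 3)) → Op n := fun P => tensorOp fun k => sigma (P k) with hS
  set O' : Op n := ∑ P, (c P : ℂ) • S P with hO'
  have hSH : ∀ P, (S P)ᴴ = S P := fun P => by
    rw [hS]; simp only [tensorOp_conjTranspose, (sigma_isHermitian _).eq]
  have hH : O'ᴴ = O' := by
    rw [hO', Matrix.conjTranspose_sum]
    refine Finset.sum_congr rfl fun P _ => ?_
    rw [Matrix.conjTranspose_smul, hSH]; simp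
  have hrep : ∀ A : Op n, (O' * A).trace = l A := by
    intro A
    conv_rhs => rw [eq_sum_pauliStrings A]
    rw [map_sum, hO', Finset.sum_mul, Matrix.trace_sum]
    refine Finset.sum_congr rfl fun P _ => ?_
    rw [map_smul, smul_mul_assoc, Matrix.trace_smul, smul_eq_mul, smul_eq_mul, hc,
      ← hl.map_pauliString]
    ring
  -- `1 - O'` is tested on rank-one operators, where contractivity of `ℓ` applies
  have hpsd : (1 - O').PosSemidef := by
    refine Matrix.PosSemidef.of_dotProduct_mulVec_nonneg ?_ fun x => ?_
    · rw [Matrix.IsHermitian, Matrix.conjTranspose_sub, hH, Matrix.conjTranspose_one]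
    · have hx := (hl _ (Matrix.posSemidef_vecMulVec_self_star x)).2
      rw [← hrep] at hx
      have h1 : ∀ B : Op n, (B * Matrix.vecMulVec x (star x)).trace = star x ⬝ᵥ B *ᵥ x := by
        intro B
        rw [Matrix.mul_vecMulVec, Matrix.trace_vecMulVec, dotProduct_comm]
      have h2 := h1 (1 - O')
      rw [sub_mul, one_mul, Matrix.trace_sub] at h2
      rwa [← h2]
  set L : Op n := tensorOp fun k => sqrtState (v k) with hL
  have hLH : Lᴴ = L := by
    rw [hL, tensorOp_conjTranspose]; simp only [(sqrtState_isHermitian _).eq]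
  have hLL : (L * L).trace = 1 := by
    rw [hL, tensorOp_mul, tensorOp_trace]
    exact Finset.prod_eq_one fun k _ => by rw [sqrtState_mul_self (hv k), qubitState_trace]
  -- contractivity once more, on the positive operator `√ρ (1 - O') √ρ`
  have hB := hpsd.mul_mul_conjTranspose_same L
  rw [hLH] at hB
  have h0 := (hl _ hB).1
  rw [← hrep] at h0
  have hform : (O' * L * O' * L).trace = (tensorForm (fun k => kmsForm (v k)) c : ℂ) := by
    rw [tensorForm, hO']
    simp only [Finset.sum_mul, Finset.mul_sum, Matrix.trace_sum, smul_mul_assoc, mul_smul_comm,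
      Matrix.trace_smul, smul_eq_mul]
    push_cast
    rw [Finset.sum_comm]
    refine Finset.sum_congr rfl fun P _ => Finset.sum_congr rfl fun Q _ => ?_
    rw [hS, hL]
    simp only [tensorOp_mul, tensorOp_trace]
    rw [Finset.prod_congr rfl fun k _ => trace_sigma_sqrtState (hv k) (P k) (Q k)]
    ring
  have hcalc : (L * (1 - O') * L).trace + (O' * (L * (1 - O') * L)).trace =
      1 - (tensorForm (fun k => kmsForm (v k)) c : ℂ) := by
    rw [← hform, ← hLL]
    have h1 : (L * O' * L).trace = (O' * L * L).trace := by
      rw [mul_assoc L O' L, Matrix.trace_mul_comm, mul_assoc]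
    simp only [mul_sub, sub_mul, mul_one, Matrix.trace_sub, ← mul_assoc, h1]
    ring
  rw [hcalc] at h0
  have := (Complex.le_def.mp h0).1
  simp at this
  exact this

/-! ### The functional of a channel and an observable -/

/-- The functional `A ↦ tr(O E[A])`. -/
noncomputable def channelFunctional {n : ℕ} (E : Channel n) (O : Op n) : Op n →ₗ[ℂ] ℂ :=
  (Matrix.traceLinearMap (Idx n) ℂ ℂ ∘ₗ LinearMap.mulLeft ℂ O) ∘ₗ E.map

theorem Channel.posSemidef {n : ℕ} (E : Channel n) {A : Op n} (hA : A.PosSemidef) :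
    (E.map A).PosSemidef := by
  have h := E.completelyPositive 1 (A.submatrix Prod.snd Prod.snd) (hA.submatrix _)
  have h2 := h.submatrix (fun i : Idx n => ((0 : Fin 1), i))
  exact h2

theorem trace_mul_nonneg {ι : Type} [Fintype ι] [DecidableEq ι] {A B : Matrix ι ι ℂ}
    (hA : A.PosSemidef) (hB : B.PosSemidef) : 0 ≤ (A * B).trace := by
  open scoped MatrixOrder in
  obtain ⟨a, rfl⟩ := CStarAlgebra.nonneg_iff_eq_star_mul_self.mp hA.nonneg
  have := (hB.mul_mul_conjTranspose_same a).trace_nonneg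
  rwa [Matrix.trace_mul_comm, ← mul_assoc] at this

theorem posSemidef_one_add_of_opNorm_le {n : ℕ} {O : Op n} (hO : O.IsHermitian)
    (h : opNorm O ≤ 1) : (1 + O).PosSemidef := by
  refine Matrix.PosSemidef.of_dotProduct_mulVec_nonneg
    (Matrix.isHermitian_one.add hO) fun x => ?_
  have him : (star x ⬝ᵥ (1 + O) *ᵥ x).im = 0 :=
    (Matrix.isHermitian_one.add hO).im_star_dotProduct_mulVec_self x
  set y : EuclideanSpace ℂ (Idx n) := WithLp.toLp 2 x with hy
  have h1 : ‖inner ℂ y (Matrix.toEuclideanCLM (n := Idx n) (𝕜 := ℂ) O y)‖ ≤ ‖y‖ ^ 2 := by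
    refine (norm_inner_le_norm _ _).trans ?_
    rw [sq]
    refine mul_le_mul_of_nonneg_left ?_ (norm_nonneg _)
    exact ((ContinuousLinearMap.le_opNorm _ _).trans
      (mul_le_of_le_one_left (norm_nonneg _) h))
  have h2 : inner ℂ y (Matrix.toEuclideanCLM (n := Idx n) (𝕜 := ℂ) O y) = star x ⬝ᵥ O *ᵥ x := by
    rw [EuclideanSpace.inner_eq_star_dotProduct, dotProduct_comm]; rfl
  have h3 : ((‖y‖ ^ 2 : ℝ) : ℂ) = star x ⬝ᵥ x := by
    have := inner_self_eq_norm_sq_to_K (𝕜 := ℂ) y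
    rw [EuclideanSpace.inner_eq_star_dotProduct, dotProduct_comm] at this
    push_cast
    exact this.symm
  refine Complex.le_def.mpr ⟨?_, by rw [him]; rfl⟩
  rw [Matrix.add_mulVec, Matrix.one_mulVec, dotProduct_add, ← h2, ← h3, Complex.add_re,
    Complex.ofReal_re, Complex.zero_re]
  have := (abs_le.mp ((Complex.abs_re_le_norm _).trans h1)).1
  linarith

theorem isContractive_channelFunctional {n : ℕ} (E : Channel n) {O : Op n}
    (hO : IsBoundedObservable O) : IsContractive (channelFunctional E O) := by
  intro A hA
  have hE := E.posSemidef hA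
  have h1 := posSemidef_one_add_of_opNorm_le hO.1 hO.2
  have h2 : (1 + -O).PosSemidef := posSemidef_one_add_of_opNorm_le hO.1.neg (by
    have := hO.2
    rw [opNorm] at this ⊢
    rwa [map_neg, norm_neg])
  have h3 := trace_mul_nonneg h1 hE
  have h4 := trace_mul_nonneg h2 hE
  rw [add_mul, one_mul, Matrix.trace_add, E.tracePreserving] at h3 h4
  refine ⟨h3, ?_⟩
  rwa [neg_mul, Matrix.trace_neg, ← sub_eq_add_neg] at h4

theorem expectation_productOp {n : ℕ} (E : Channel n) {O : Op n} (hO : IsBoundedObservable O)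
    (v : Fin n → Fin 3 → ℝ) :
    expectation E O (tensorOp fun k => qubitState (v k)) =
      multi (pauliCoeff (channelFunctional E O)) v := by
  have h := (isContractive_channelFunctional E hO).map_productOp v
  have h2 := congrArg Complex.re h
  rw [Complex.ofReal_re] at h2
  exact h2

theorem plusProb_productOp {n : ℕ} (E : Channel n) {O : Op n} (hO : IsBoundedObservable O)
    (v : Fin n → Fin 3 → ℝ) :
    plusProb E O (tensorOp fun k => qubitState (v k)) =
      (1 + multi (pauliCoeff (channelFunctional E O)) v) / 2 := by
  rw [← expectation_productOp E hO, plusProb, expectation, smul_mul_assoc, Matrix.trace_smul,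
    add_mul, one_mul, Matrix.trace_add, E.tracePreserving, tensorOp_trace]
  simp [qubitState_trace]
  ring

/-! ### Moments of a distribution on the Bloch sphere -/

/-- The coordinates of a Bloch vector. -/
def bloch (x : BlochSphere) (p : Fin 3) : ℝ := x.1 p

theorem sum_bloch_sq (x : BlochSphere) : ∑ p, bloch x p ^ 2 = 1 := by
  have h := mem_sphere_zero_iff_norm.mp x.2
  have h2 := EuclideanSpace.norm_sq_eq x.1
  rw [h] at h2
  simpa [bloch] using h2.symm

theorem continuous_bloch (p : Fin 3) : Continuous fun x : BlochSphere => bloch x p := by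
  unfold bloch
  fun_prop

theorem measurable_bloch (p : Fin 3) : Measurable fun x : BlochSphere => bloch x p :=
  (continuous_bloch p).measurable

theorem abs_bloch_le (x : BlochSphere) (p : Fin 3) : |bloch x p| ≤ 1 := by
  have h := sum_bloch_sq x
  have h2 : bloch x p ^ 2 ≤ ∑ q, bloch x q ^ 2 :=
    Finset.single_le_sum (f := fun q => bloch x q ^ 2) (fun _ _ => sq_nonneg _)
      (Finset.mem_univ p)
  rw [h] at h2
  exact (sq_le_one_iff_abs_le_one _).mp h2

theorem BlochSphere.state_eq (x : BlochSphere) : x.state = qubitState (bloch x) := rfl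

theorem pauliExp_state (p : Fin 3) (x : BlochSphere) : pauliExp p x.state = bloch x p := by
  rw [BlochSphere.state_eq]
  have hm : qubitState (bloch x) = !![((1 + bloch x 2) / 2 : ℂ),
      (bloch x 0 - bloch x 1 * Complex.I) / 2;
      (bloch x 0 + bloch x 1 * Complex.I) / 2, (1 - bloch x 2) / 2] := by
    ext i j
    fin_cases i <;> fin_cases j <;> simp [qubitState, Fin.sum_univ_three, pauli] <;> ring
  rw [pauliExp, hm]
  fin_cases p <;> simp [pauli, Matrix.trace_fin_two] <;> ring

theorem integrable_of_continuous {X : Type*} [TopologicalSpace X] [CompactSpace X]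
    [MeasurableSpace X] [OpensMeasurableSpace X] {ν : Measure X} [IsFiniteMeasure ν]
    {f : X → ℝ} (hf : Continuous f) : Integrable f ν :=
  hf.integrable_of_hasCompactSupport (HasCompactSupport.of_compactSpace f)

/-- The mean Bloch vector. -/
noncomputable def meanBloch (D : Measure BlochSphere) (p : Fin 3) : ℝ := ∫ x, bloch x p ∂D

/-- Nonnegativity of the Gram determinant of `a, u, v`, with `u` and `v` orthogonal. -/
theorem gram_det_nonneg (a u v : Fin 3 → ℝ) (h : ∑ p, u p * v p = 0) :
    (∑ p, a p * u p) ^ 2 * (∑ p, v p ^ 2) + (∑ p, a p * v p) ^ 2 * (∑ p, u p ^ 2) ≤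
      (∑ p, a p ^ 2) * (∑ p, u p ^ 2) * ∑ p, v p ^ 2 := by
  simp only [Fin.sum_univ_three] at *
  have key := sq_nonneg (a 0 * (u 1 * v 2 - u 2 * v 1) - a 1 * (u 0 * v 2 - u 2 * v 0) +
    a 2 * (u 0 * v 1 - u 1 * v 0))
  have hid : (a 0 ^ 2 + a 1 ^ 2 + a 2 ^ 2) * (u 0 ^ 2 + u 1 ^ 2 + u 2 ^ 2) *
      (v 0 ^ 2 + v 1 ^ 2 + v 2 ^ 2) -
      (a 0 * u 0 + a 1 * u 1 + a 2 * u 2) ^ 2 * (v 0 ^ 2 + v 1 ^ 2 + v 2 ^ 2) -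
      (a 0 * v 0 + a 1 * v 1 + a 2 * v 2) ^ 2 * (u 0 ^ 2 + u 1 ^ 2 + u 2 ^ 2) =
      (a 0 * (u 1 * v 2 - u 2 * v 1) - a 1 * (u 0 * v 2 - u 2 * v 0) +
        a 2 * (u 0 * v 1 - u 1 * v 0)) ^ 2 +
      ((a 0 ^ 2 + a 1 ^ 2 + a 2 ^ 2) * (u 0 * v 0 + u 1 * v 1 + u 2 * v 2) -
        2 * (a 0 * u 0 + a 1 * u 1 + a 2 * u 2) * (a 0 * v 0 + a 1 * v 1 + a 2 * v 2)) *
        (u 0 * v 0 + u 1 * v 1 + u 2 * v 2) := by ring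
  rw [h] at hid
  linarith

theorem cauchy_three (a u : Fin 3 → ℝ) :
    (∑ p, a p * u p) ^ 2 ≤ (∑ p, a p ^ 2) * ∑ p, u p ^ 2 :=
  Finset.sum_mul_sq_le_sq_mul_sq _ _ _

/-- The one-variable core of `midpoint_inequality`, with `N = |a|²`, `X = (a·u)²` and
`W = (a·v)²/(1 + s)`; the last hypothesis is the Gram inequality divided by `1 + s`. -/
theorem radial_inequality {s N X W : ℝ} (hs0 : 0 ≤ s) (hs1 : s ≤ 1) (hX : 0 ≤ X)
    (hXN : X ≤ s ^ 2 * N)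
    (h : (1 - s) * X + s ^ 2 * W ≤ s ^ 2 * (1 - s) * N) :
    (1 + s) * W + X + s ^ 2 / 2 * (N - X) ≤ s * N + W := by
  rcases hs0.eq_or_lt with rfl | hs
  · simp at *; linarith
  · have h1 : 0 ≤ s * (s * N - s * W - X - s ^ 2 / 2 * (N - X)) := by
      have e1 : 0 ≤ X * ((1 - s) ^ 2 * (1 + s / 2)) := by positivity
      have e2 : 0 ≤ s / 2 * (s ^ 2 * N - X) := by
        apply mul_nonneg <;> linarith
      nlinarith
    have := nonneg_of_mul_nonneg_right h1 hs
    linarith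

/-- The pointwise inequality behind the spectral gap. With `u = (x - y)/2`, `v = (x + y)/2` and
`s = |u| = √(1 - |v|²)`, the form `s |a|² + (a·v)²/(1 + s)` exceeds
`(a·u)² + (a·v)² = ((a·x)² + (a·y)²)/2`, by an amount proportional to `s²`. -/
theorem midpoint_inequality (a x y : Fin 3 → ℝ) (hx : ∑ p, x p ^ 2 = 1)
    (hy : ∑ p, y p ^ 2 = 1) {s : ℝ} (hs : s = √(1 - ∑ p, ((x p + y p) / 2) ^ 2)) :
    ((∑ p, a p * x p) ^ 2 + (∑ p, a p * y p) ^ 2) / 2 +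
      (1 - ∑ p, x p * y p) / 8 * (((∑ p, a p ^ 2) - (∑ p, a p * x p) ^ 2) +
        ((∑ p, a p ^ 2) - (∑ p, a p * y p) ^ 2)) ≤
      s * (∑ p, a p ^ 2) + (∑ p, a p * ((x p + y p) / 2)) ^ 2 / (1 + s) := by
  have hxy := cauchy_three x y
  rw [hx, hy, mul_one] at hxy
  have hxy1 : -1 ≤ ∑ p, x p * y p ∧ ∑ p, x p * y p ≤ 1 :=
    abs_le.mp ((sq_le_one_iff_abs_le_one _).mp hxy)
  have hv : ∑ p, ((x p + y p) / 2) ^ 2 = (1 + ∑ p, x p * y p) / 2 := by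
    simp only [Fin.sum_univ_three] at hx hy ⊢; linarith
  have hu : ∑ p, ((x p - y p) / 2) ^ 2 = (1 - ∑ p, x p * y p) / 2 := by
    simp only [Fin.sum_univ_three] at hx hy ⊢; linarith
  have huv : ∑ p, ((x p - y p) / 2) * ((x p + y p) / 2) = 0 := by
    simp only [Fin.sum_univ_three] at hx hy ⊢; linarith
  have hs0 : 0 ≤ s := hs ▸ Real.sqrt_nonneg _
  have hs2 : s ^ 2 = (1 - ∑ p, x p * y p) / 2 := by
    rw [hs, Real.sq_sqrt (by rw [hv]; linarith), hv]; ring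
  have hs1 : s ≤ 1 := by nlinarith
  have hG := gram_det_nonneg a _ _ huv
  have hC := cauchy_three a fun p => (x p - y p) / 2
  rw [hu, ← hs2] at hC
  rw [hu, hv, ← hs2, show (1 + ∑ p, x p * y p) / 2 = (1 - s) * (1 + s) by linarith] at hG
  have hp : 0 < 1 + s := by linarith
  set N := ∑ p, a p ^ 2
  set X := (∑ p, a p * ((x p - y p) / 2)) ^ 2 with hX
  set Y := (∑ p, a p * ((x p + y p) / 2)) ^ 2 with hY
  have hW : (1 + s) * (Y / (1 + s)) = Y := by field_simp
  have hr := radial_inequality (W := Y / (1 + s)) hs0 hs1 (sq_nonneg _)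
    (by linarith : X ≤ s ^ 2 * N) (by
      have : (1 + s) * ((1 - s) * X + s ^ 2 * (Y / (1 + s))) ≤
          (1 + s) * (s ^ 2 * (1 - s) * N) := by
        rw [mul_add, show (1 + s) * (s ^ 2 * (Y / (1 + s))) = s ^ 2 * Y by
          rw [← hW]; field_simp]
        linarith
      exact le_of_mul_le_mul_left this hp)
  rw [hW] at hr
  have hXY : X + Y = ((∑ p, a p * x p) ^ 2 + (∑ p, a p * y p) ^ 2) / 2 := by
    rw [hX, hY]; simp only [Fin.sum_univ_three]; ring
  have hXle : X ≤ ((∑ p, a p * x p) ^ 2 + (∑ p, a p * y p) ^ 2) / 2 := by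
    rw [← hXY]; linarith [sq_nonneg (∑ p, a p * ((x p + y p) / 2))]
  have h8 : s ^ 2 / 2 * ((N - (∑ p, a p * x p) ^ 2 + (N - (∑ p, a p * y p) ^ 2)) / 2) ≤
      s ^ 2 / 2 * (N - X) :=
    mul_le_mul_of_nonneg_left (by linarith) (by positivity)
  have h9 : (1 - ∑ p, x p * y p) / 8 = s ^ 2 / 4 := by rw [hs2]; ring
  rw [h9]
  linarith

/-- The Euclidean operator norm bounds the second moment of every linear functional. -/
theorem secondMoment_le (D : Measure BlochSphere) [IsProbabilityMeasure D] (a : Fin 3 → ℝ) :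
    ∫ x, (∑ p, a p * bloch x p) ^ 2 ∂D ≤ opNorm (secondMoment D) * ∑ p, a p ^ 2 := by
  set y : EuclideanSpace ℝ (Fin 3) := WithLp.toLp 2 a with hy
  have h1 : inner ℝ y (Matrix.toEuclideanCLM (n := Fin 3) (𝕜 := ℝ) (secondMoment D) y) =
      ∫ x, (∑ p, a p * bloch x p) ^ 2 ∂D := by
    rw [Matrix.inner_toEuclideanCLM]
    have hint : ∀ p q, Integrable (fun x => a p * a q * (bloch x p * bloch x q)) D := fun p q =>
      integrable_of_continuous (by have := continuous_bloch; fun_prop)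
    have : ∀ x, (∑ p, a p * bloch x p) ^ 2 = ∑ p, ∑ q, a p * a q * (bloch x p * bloch x q) := by
      intro x
      rw [sq, Finset.sum_mul_sum]
      exact Finset.sum_congr rfl fun p _ => Finset.sum_congr rfl fun q _ => by ring
    simp only [this]
    rw [integral_finsetSum _ fun p _ => integrable_finsetSum _ fun q _ => hint p q]
    simp only [dotProduct, Matrix.mulVec, Finset.mul_sum]
    refine Finset.sum_congr rfl fun p _ => ?_
    rw [integral_finsetSum _ fun q _ => hint p q]
    refine Finset.sum_congr rfl fun q _ => ?_
    rw [integral_const_mul]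
    simp only [secondMoment, Matrix.of_apply, pauliExp_state, hy]
    ring
  rw [← h1]
  refine (real_inner_le_norm _ _).trans ?_
  have h2 : ‖y‖ ^ 2 = ∑ p, a p ^ 2 := by
    rw [EuclideanSpace.norm_sq_eq]; simp [hy]
  rw [← h2, opNorm]
  have := (Matrix.toEuclideanCLM (n := Fin 3) (𝕜 := ℝ) (secondMoment D)).le_opNorm y
  nlinarith [norm_nonneg y]

/-- The second moment matrix has trace one, so its norm is at least `1/3`. -/
theorem one_le_three_mul_opNorm (D : Measure BlochSphere) [IsProbabilityMeasure D] :
    1 ≤ 3 * opNorm (secondMoment D) := by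
  have h : ∀ p : Fin 3, ∫ x, bloch x p ^ 2 ∂D ≤ opNorm (secondMoment D) := fun p => by
    simpa [Pi.single_apply] using secondMoment_le D (Pi.single p 1)
  have hsum : ∑ p : Fin 3, ∫ x, bloch x p ^ 2 ∂D = 1 := by
    rw [← integral_finsetSum _ fun p _ =>
      integrable_of_continuous (by have := continuous_bloch; fun_prop)]
    simp [sum_bloch_sq]
  rw [Fin.sum_univ_three] at hsum
  linarith [h 0, h 1, h 2]

/-! ### The averaged symmetric form and its spectral gap -/

/-- The midpoint of two Bloch vectors. -/
noncomputable def midpointBloch (z : BlochSphere × BlochSphere) (p : Fin 3) : ℝ :=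
  (bloch z.1 p + bloch z.2 p) / 2

theorem sum_midpointBloch_sq_le (z : BlochSphere × BlochSphere) :
    ∑ p, midpointBloch z p ^ 2 ≤ 1 := by
  have h : ∑ p, midpointBloch z p ^ 2 ≤
      ∑ p, (bloch z.1 p ^ 2 / 2 + bloch z.2 p ^ 2 / 2) :=
    Finset.sum_le_sum fun p _ => by
      unfold midpointBloch; nlinarith [sq_nonneg (bloch z.1 p - bloch z.2 p)]
  rw [Finset.sum_add_distrib, ← Finset.sum_div, ← Finset.sum_div, sum_bloch_sq,
    sum_bloch_sq] at h
  linarith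

theorem continuous_midpointBloch (p : Fin 3) : Continuous fun z => midpointBloch z p := by
  unfold midpointBloch
  have := continuous_bloch
  fun_prop

theorem continuous_kmsForm_midpoint (a b : Option (Fin 3)) :
    Continuous fun z => kmsForm (midpointBloch z) a b := by
  have h := continuous_midpointBloch
  have h2 : ∀ z, 1 + √(1 - ∑ p, midpointBloch z p ^ 2) ≠ 0 := fun z => by positivity
  rcases a with _ | p <;> rcases b with _ | q
  · simpa [kmsForm, extend] using continuous_const
  · simpa [kmsForm, extend] using h q
  · simpa [kmsForm, extend] using h p
  · have h3 : Continuous fun z : BlochSphere × BlochSphere =>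
        √(1 - ∑ p, midpointBloch z p ^ 2) := by fun_prop
    simp only [kmsForm, Matrix.of_apply]
    refine Continuous.add ?_ (((h p).mul (h q)).div (by fun_prop) h2)
    by_cases hpq : p = q
    · simpa [hpq] using h3
    · simpa [hpq] using continuous_const

/-- The average of the symmetric forms over midpoints of pairs of independent Bloch vectors. -/
noncomputable def meanForm (D : Measure BlochSphere) :
    Matrix (Option (Fin 3)) (Option (Fin 3)) ℝ :=
  Matrix.of fun a b => ∫ z, kmsForm (midpointBloch z) a b ∂(D.prod D)

/-- The covariance of `(1, x)`. -/
noncomputable def covForm (D : Measure BlochSphere) :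
    Matrix (Option (Fin 3)) (Option (Fin 3)) ℝ :=
  Matrix.of fun a b => ∫ x, (extend (bloch x) a - extend (meanBloch D) a) *
    (extend (bloch x) b - extend (meanBloch D) b) ∂D

/-- The rank-one form of the mean of `(1, x)`. -/
noncomputable def meanSqForm (D : Measure BlochSphere) :
    Matrix (Option (Fin 3)) (Option (Fin 3)) ℝ :=
  Matrix.of fun a b => extend (meanBloch D) a * extend (meanBloch D) b

theorem continuous_extend_bloch (a : Option (Fin 3)) :
    Continuous fun x => extend (bloch x) a := by
  rcases a with _ | p
  · exact continuous_const
  · exact continuous_bloch p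

section
variable (D : Measure BlochSphere) [IsProbabilityMeasure D]

theorem integral_linear (a : Fin 3 → ℝ) :
    ∫ x, ∑ p, a p * bloch x p ∂D = ∑ p, a p * meanBloch D p := by
  rw [integral_finsetSum _ fun p _ =>
    integrable_of_continuous (by have := continuous_bloch; fun_prop)]
  simp only [integral_const_mul, meanBloch]

theorem variance_eq (a : Fin 3 → ℝ) :
    ∫ x, (∑ p, a p * (bloch x p - meanBloch D p)) ^ 2 ∂D =
      ∫ x, (∑ p, a p * bloch x p) ^ 2 ∂D - (∑ p, a p * meanBloch D p) ^ 2 := by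
  have hc := continuous_bloch
  have h1 : ∀ x, (∑ p, a p * (bloch x p - meanBloch D p)) ^ 2 =
      (∑ p, a p * bloch x p) ^ 2 - 2 * (∑ p, a p * meanBloch D p) * (∑ p, a p * bloch x p) +
        (∑ p, a p * meanBloch D p) ^ 2 := by
    intro x
    simp only [mul_sub, Finset.sum_sub_distrib]
    ring
  simp only [h1]
  rw [integral_add (integrable_of_continuous (by fun_prop))
    (integrable_of_continuous (by fun_prop)), integral_sub (integrable_of_continuous (by fun_prop))
    (integrable_of_continuous (by fun_prop)), integral_const_mul, integral_linear]
  simp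
  ring

theorem integral_sq_sub_meanBloch :
    ∫ x, ∑ p, (bloch x p - meanBloch D p) ^ 2 ∂D = 1 - ∑ p, meanBloch D p ^ 2 := by
  have hc := continuous_bloch
  have h1 : ∀ x, ∑ p, (bloch x p - meanBloch D p) ^ 2 =
      1 - 2 * (∑ p, meanBloch D p * bloch x p) + ∑ p, meanBloch D p ^ 2 := by
    intro x
    rw [← sum_bloch_sq x, Finset.mul_sum, ← Finset.sum_sub_distrib, ← Finset.sum_add_distrib]
    exact Finset.sum_congr rfl fun p _ => by ring
  simp only [h1]
  rw [integral_add (integrable_of_continuous (by fun_prop))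
    (integrable_of_continuous (by fun_prop)), integral_sub (integrable_of_continuous (by fun_prop))
    (integrable_of_continuous (by fun_prop)), integral_const_mul, integral_linear]
  simp [← sq]
  ring

/-- Averaging the gap of `midpoint_inequality` over pairs of independent Bloch vectors. -/
theorem integral_pair_gap_le {η : ℝ} (hη : opNorm (secondMoment D) ≤ 1 - η)
    (a : Fin 3 → ℝ) :
    η / 4 * (1 - √(∑ p, meanBloch D p ^ 2)) * (∑ p, a p ^ 2) ≤
      ∫ z : BlochSphere × BlochSphere, (1 - ∑ p, bloch z.1 p * bloch z.2 p) / 8 *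
        (((∑ p, a p ^ 2) - (∑ p, a p * bloch z.1 p) ^ 2) +
          ((∑ p, a p ^ 2) - (∑ p, a p * bloch z.2 p) ^ 2)) ∂(D.prod D) := by
  have hc := continuous_bloch
  set N := ∑ p, a p ^ 2 with hN
  set m := √(∑ p, meanBloch D p ^ 2) with hm
  have hN0 : 0 ≤ N := Finset.sum_nonneg fun p _ => sq_nonneg _
  -- one half of the symmetric integrand
  set k : BlochSphere × BlochSphere → ℝ := fun z =>
    (1 - ∑ p, bloch z.1 p * bloch z.2 p) / 8 * (N - (∑ p, a p * bloch z.1 p) ^ 2) with hk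
  have hkc : Continuous k := by rw [hk]; fun_prop
  have hsplit : ∀ z : BlochSphere × BlochSphere, (1 - ∑ p, bloch z.1 p * bloch z.2 p) / 8 *
        ((N - (∑ p, a p * bloch z.1 p) ^ 2) + (N - (∑ p, a p * bloch z.2 p) ^ 2)) =
      k z + k z.swap := by
    intro z
    simp only [hk, Prod.fst_swap, Prod.snd_swap, mul_comm (bloch z.2 _)]
    ring
  simp only [hsplit]
  rw [integral_add (f := k) (g := fun z => k z.swap) (integrable_of_continuous hkc)
    (integrable_of_continuous (hkc.comp continuous_swap)), integral_prod_swap k, ← two_mul,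
    integral_prod _ (integrable_of_continuous hkc)]
  have hinner : ∀ x, ∫ y, k (x, y) ∂D =
      (1 - ∑ p, bloch x p * meanBloch D p) / 8 * (N - (∑ p, a p * bloch x p) ^ 2) := by
    intro x
    simp only [hk]
    rw [integral_mul_const, integral_div, integral_sub (integrable_const _)
      (integrable_of_continuous (by fun_prop)), integral_linear]
    simp
  simp only [hinner]
  -- `x·μ ≤ m` for all unit vectors `x`, by Cauchy–Schwarz
  have hpt : ∀ x, (1 - m) / 8 * (N - (∑ p, a p * bloch x p) ^ 2) ≤
      (1 - ∑ p, bloch x p * meanBloch D p) / 8 * (N - (∑ p, a p * bloch x p) ^ 2) := by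
    intro x
    have h1 := cauchy_three a (bloch x)
    rw [sum_bloch_sq, mul_one] at h1
    have h2 : ∑ p, bloch x p * meanBloch D p ≤ m := by
      have h := cauchy_three (bloch x) (meanBloch D)
      rw [sum_bloch_sq, one_mul] at h
      exact Real.le_sqrt_of_sq_le h
    exact mul_le_mul_of_nonneg_right (by linarith) (by linarith)
  have hint : ∫ x, (1 - m) / 8 * (N - (∑ p, a p * bloch x p) ^ 2) ∂D ≤
      ∫ x, (1 - ∑ p, bloch x p * meanBloch D p) / 8 * (N - (∑ p, a p * bloch x p) ^ 2) ∂D :=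
    integral_mono (integrable_of_continuous (by fun_prop))
      (integrable_of_continuous (by fun_prop)) hpt
  rw [integral_const_mul, integral_sub (integrable_const _)
    (integrable_of_continuous (by fun_prop))] at hint
  simp only [integral_const, probReal_univ, smul_eq_mul, one_mul] at hint
  have hm1 : m ≤ 1 := by
    rw [hm]
    apply Real.sqrt_le_one.mpr
    have h1 := integral_sq_sub_meanBloch D
    have h2 : 0 ≤ ∫ x, ∑ p, (bloch x p - meanBloch D p) ^ 2 ∂D :=
      integral_nonneg fun x => Finset.sum_nonneg fun p _ => sq_nonneg _
    linarith
  have hS := (secondMoment_le D a).trans (mul_le_mul_of_nonneg_right hη hN0)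
  have h5 : (1 - m) / 8 * (η * N) ≤
      (1 - m) / 8 * (N - ∫ x, (∑ p, a p * bloch x p) ^ 2 ∂D) :=
    mul_le_mul_of_nonneg_left (by linarith) (by linarith)
  linarith

/-- Bounded by the total variance `1 - m² ≤ 2 (1 - m)`, where `m` is the length of the mean. -/
theorem variance_le (a : Fin 3 → ℝ) :
    ∫ x, (∑ p, a p * (bloch x p - meanBloch D p)) ^ 2 ∂D ≤
      2 * (1 - √(∑ p, meanBloch D p ^ 2)) * ∑ p, a p ^ 2 := by
  have hc := continuous_bloch
  set m := √(∑ p, meanBloch D p ^ 2) with hm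
  have hm2 : m ^ 2 = ∑ p, meanBloch D p ^ 2 :=
    Real.sq_sqrt (Finset.sum_nonneg fun p _ => sq_nonneg _)
  have h1 : ∫ x, (∑ p, a p * (bloch x p - meanBloch D p)) ^ 2 ∂D ≤
      ∫ x, (∑ p, a p ^ 2) * ∑ p, (bloch x p - meanBloch D p) ^ 2 ∂D :=
    integral_mono (integrable_of_continuous (by fun_prop))
      (integrable_of_continuous (by fun_prop)) fun x => cauchy_three _ _
  rw [integral_const_mul, integral_sq_sub_meanBloch, ← hm2] at h1
  have hN : 0 ≤ ∑ p, a p ^ 2 := Finset.sum_nonneg fun p _ => sq_nonneg _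
  nlinarith [sq_nonneg (1 - m)]

/-- The quadratic form of `meanForm` at a vector without identity component. -/
theorem meanForm_quadratic (a : Fin 3 → ℝ) :
    ∑ p, ∑ q, a p * a q * meanForm D (some p) (some q) =
      ∫ z, (√(1 - ∑ p, midpointBloch z p ^ 2) * (∑ p, a p ^ 2) +
        (∑ p, a p * midpointBloch z p) ^ 2 / (1 + √(1 - ∑ p, midpointBloch z p ^ 2)))
          ∂(D.prod D) := by
  have hi : ∀ p q, Integrable (fun z => a p * a q * kmsForm (midpointBloch z) (some p) (some q))
      (D.prod D) := fun p q =>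
    (integrable_of_continuous (continuous_kmsForm_midpoint _ _)).const_mul _
  simp only [meanForm, Matrix.of_apply, ← integral_const_mul]
  rw [← Finset.sum_congr rfl fun p _ => integral_finsetSum _ fun q _ => hi p q,
    ← integral_finsetSum _ fun p _ => integrable_finsetSum _ fun q _ => hi p q]
  refine integral_congr_ae (Filter.Eventually.of_forall fun z => ?_)
  simp only [kmsForm, Matrix.of_apply, Fin.sum_univ_three]
  simp
  ring

theorem integral_pair_second (a : Fin 3 → ℝ) :
    ∫ z : BlochSphere × BlochSphere,
      ((∑ p, a p * bloch z.1 p) ^ 2 + (∑ p, a p * bloch z.2 p) ^ 2) / 2 ∂(D.prod D) =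
      ∫ x, (∑ p, a p * bloch x p) ^ 2 ∂D := by
  have hc := continuous_bloch
  rw [integral_div, integral_add (integrable_of_continuous (by fun_prop))
    (integrable_of_continuous (by fun_prop)),
    integral_fun_fst (fun x => (∑ p, a p * bloch x p) ^ 2),
    integral_fun_snd (fun x => (∑ p, a p * bloch x p) ^ 2)]
  simp

/-- The spectral gap: the averaged symmetric form dominates the mean form plus `1 + η/8` times the
covariance form. -/
theorem meanForm_gap {η : ℝ} (hη0 : 0 ≤ η) (hη : opNorm (secondMoment D) ≤ 1 - η) :
    (meanForm D - ((1 + η / 8) • covForm D + meanSqForm D)).PosSemidef := by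
  have hc := continuous_bloch
  have hF0 : ∀ b, meanForm D none b = extend (meanBloch D) b := by
    intro b
    rcases b with _ | q
    · simp [meanForm, kmsForm, extend]
    · simp only [meanForm, kmsForm, Matrix.of_apply, extend, midpointBloch]
      rw [integral_div, integral_add (integrable_of_continuous (by fun_prop))
        (integrable_of_continuous (by fun_prop)), integral_fun_fst (fun x => bloch x q),
        integral_fun_snd (fun x => bloch x q)]
      simp [meanBloch]
  have hsymm : ∀ a b, meanForm D a b = meanForm D b a := by
    intro a b
    simp only [meanForm, Matrix.of_apply]
    refine integral_congr_ae (Filter.Eventually.of_forall fun z => ?_)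
    rcases a with _ | p <;> rcases b with _ | q <;> simp [kmsForm, extend]
    rw [mul_comm]
    simp only [eq_comm]
  have hcsymm : ∀ a b, covForm D a b = covForm D b a := by
    intro a b
    simp only [covForm, Matrix.of_apply, mul_comm]
  have hc0 : ∀ b, covForm D none b = 0 := by
    intro b; simp [covForm, extend]
  have hent : ∀ a b, (meanForm D - ((1 + η / 8) • covForm D + meanSqForm D)) a b =
      meanForm D a b - ((1 + η / 8) * covForm D a b +
        extend (meanBloch D) a * extend (meanBloch D) b) := fun a b => by
    simp [meanSqForm]
  refine Matrix.PosSemidef.of_dotProduct_mulVec_nonneg ?_ fun w => ?_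
  · ext a b
    simp only [Matrix.conjTranspose_apply, hent, star_trivial]
    rw [hsymm, hcsymm]
    ring
  -- the difference vanishes in the row and the column of the identity
  · have hrow : ∀ b, (meanForm D - ((1 + η / 8) • covForm D + meanSqForm D)) none b = 0 := by
      intro b
      rw [hent, hF0, hc0]; simp [extend]
    have hcol : ∀ b, (meanForm D - ((1 + η / 8) • covForm D + meanSqForm D)) b none = 0 := by
      intro b
      rw [hent, hsymm, hF0, hcsymm, hc0]; simp [extend]
    set a : Fin 3 → ℝ := fun p => w (some p) with ha
    have hquad : star w ⬝ᵥ (meanForm D - ((1 + η / 8) • covForm D + meanSqForm D)) *ᵥ w =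
        ∑ p, ∑ q, a p * a q * meanForm D (some p) (some q) -
          ((1 + η / 8) * (∑ p, ∑ q, a p * a q * covForm D (some p) (some q)) +
            (∑ p, a p * meanBloch D p) ^ 2) := by
      simp only [dotProduct, Matrix.mulVec, Fintype.sum_option, hrow, hcol, star_trivial,
        zero_mul, mul_zero, Finset.sum_const_zero, zero_add]
      simp only [hent, extend, Fin.sum_univ_three, ha]
      ring
    have hcov : ∑ p, ∑ q, a p * a q * covForm D (some p) (some q) =
        ∫ x, (∑ p, a p * (bloch x p - meanBloch D p)) ^ 2 ∂D := by
      have hi : ∀ p q, Integrable (fun x => a p * a q *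
          ((bloch x p - meanBloch D p) * (bloch x q - meanBloch D q))) D := fun p q =>
        integrable_of_continuous (by fun_prop)
      simp only [covForm, Matrix.of_apply, extend, ← integral_const_mul]
      rw [← Finset.sum_congr rfl fun p _ => integral_finsetSum _ fun q _ => hi p q,
        ← integral_finsetSum _ fun p _ => integrable_finsetSum _ fun q _ => hi p q]
      refine integral_congr_ae (Filter.Eventually.of_forall fun x => ?_)
      simp only [Fin.sum_univ_three]
      ring
    have hpt : ∫ z : BlochSphere × BlochSphere,
        (((∑ p, a p * bloch z.1 p) ^ 2 + (∑ p, a p * bloch z.2 p) ^ 2) / 2 +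
          (1 - ∑ p, bloch z.1 p * bloch z.2 p) / 8 *
          (((∑ p, a p ^ 2) - (∑ p, a p * bloch z.1 p) ^ 2) +
            ((∑ p, a p ^ 2) - (∑ p, a p * bloch z.2 p) ^ 2))) ∂(D.prod D) ≤
        ∫ z, (√(1 - ∑ p, midpointBloch z p ^ 2) * (∑ p, a p ^ 2) +
          (∑ p, a p * midpointBloch z p) ^ 2 / (1 + √(1 - ∑ p, midpointBloch z p ^ 2)))
            ∂(D.prod D) := by
      have hmc := continuous_midpointBloch
      refine integral_mono (integrable_of_continuous (by fun_prop))
        (integrable_of_continuous ?_) fun z =>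
          midpoint_inequality a _ _ (sum_bloch_sq z.1) (sum_bloch_sq z.2) rfl
      refine Continuous.add (by fun_prop) (Continuous.div (by fun_prop) (by fun_prop) fun z => ?_)
      positivity
    rw [integral_add (integrable_of_continuous (by fun_prop))
      (integrable_of_continuous (by fun_prop)), integral_pair_second] at hpt
    have hgap := integral_pair_gap_le D hη a
    have hvar := variance_le D a
    have hveq := variance_eq D a
    -- the gap `η (1 - m) |a|² / 4` is at least `η/8` times the variance along `a`
    rw [hquad, hcov, meanForm_quadratic]
    nlinarith

end

/-! ### The Efron–Stein decomposition and its tail -/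

theorem tensorForm_eq {n : ℕ} (M : Fin n → Matrix (Option (Fin 3)) (Option (Fin 3)) ℝ)
    (c : (Fin n → Option (Fin 3)) → ℝ) : tensorForm M c = star c ⬝ᵥ tensorMat M *ᵥ c := by
  simp only [tensorForm, dotProduct, Matrix.mulVec, tensorMat, Matrix.of_apply, star_trivial,
    Finset.mul_sum]
  exact Finset.sum_congr rfl fun P _ => Finset.sum_congr rfl fun Q _ => by ring

theorem tensorForm_nonneg {n : ℕ} {M : Fin n → Matrix (Option (Fin 3)) (Option (Fin 3)) ℝ}
    (hM : ∀ k, (M k).PosSemidef) (c : (Fin n → Option (Fin 3)) → ℝ) : 0 ≤ tensorForm M c := by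
  rw [tensorForm_eq]
  exact (tensorMat_posSemidef hM).dotProduct_mulVec_nonneg c

theorem tensorForm_add {n : ℕ} (M N : Fin n → Matrix (Option (Fin 3)) (Option (Fin 3)) ℝ)
    (c : (Fin n → Option (Fin 3)) → ℝ) :
    tensorForm (fun k => M k + N k) c =
      ∑ A : Finset (Fin n), tensorForm (fun k => if k ∈ A then M k else N k) c := by
  simp only [tensorForm, Matrix.add_apply]
  rw [Finset.sum_comm]
  conv_rhs => rw [Finset.sum_comm]
  conv_lhs => rw [Finset.sum_comm]
  refine Finset.sum_congr rfl fun P _ => ?_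
  rw [Finset.sum_comm]
  refine Finset.sum_congr rfl fun Q _ => ?_
  rw [Finset.prod_add, Finset.powerset_univ, Finset.mul_sum]
  refine Finset.sum_congr rfl fun A _ => ?_
  congr 1
  rw [← Finset.prod_mul_prod_compl A fun k => (if k ∈ A then M k else N k) (P k) (Q k)]
  congr 1
  · exact Finset.prod_congr rfl fun k hk => by rw [if_pos hk]
  · rw [Finset.compl_eq_univ_sdiff]
    exact Finset.prod_congr rfl fun k hk => by rw [if_neg (Finset.mem_sdiff.mp hk).2]

theorem tensorForm_mono {n : ℕ} {M N : Fin n → Matrix (Option (Fin 3)) (Option (Fin 3)) ℝ}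
    (hM : ∀ k, (M k).PosSemidef) (hMN : ∀ k, (N k - M k).PosSemidef)
    (c : (Fin n → Option (Fin 3)) → ℝ) : tensorForm M c ≤ tensorForm N c := by
  have h := tensorForm_add (fun k => N k - M k) M c
  simp only [sub_add_cancel] at h
  rw [h]
  refine le_trans (le_of_eq ?_) (Finset.single_le_sum (f := fun A : Finset (Fin n) =>
    tensorForm (fun k => if k ∈ A then N k - M k else M k) c) (fun A _ =>
      tensorForm_nonneg (fun k => ?_) c) (Finset.mem_univ ∅))
  · simp
  · split_ifs
    exacts [hMN k, hM k]

/-- The component of `multi c` on the set `A` of sites in the decomposition around `m`: the factors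
on `A` are centred at `m`, the others are evaluated at `m`. -/
noncomputable def component {n : ℕ} (c : (Fin n → Option (Fin 3)) → ℝ) (m : Fin 3 → ℝ)
    (A : Finset (Fin n)) (v : Fin n → Fin 3 → ℝ) : ℝ :=
  ∑ P, c P * ∏ k, (if k ∈ A then extend (v k) (P k) - extend m (P k) else extend m (P k))

theorem multi_eq_sum_component {n : ℕ} (c : (Fin n → Option (Fin 3)) → ℝ) (m : Fin 3 → ℝ)
    (v : Fin n → Fin 3 → ℝ) : multi c v = ∑ A, component c m A v := by
  simp only [component, multi]
  rw [Finset.sum_comm]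
  refine Finset.sum_congr rfl fun P _ => ?_
  rw [← Finset.mul_sum]
  congr 1
  have h := Finset.prod_add (fun k => extend (v k) (P k) - extend m (P k))
    (fun k => extend m (P k)) Finset.univ
  simp only [sub_add_cancel] at h
  rw [h, Finset.powerset_univ]
  refine Finset.sum_congr rfl fun A _ => ?_
  rw [Finset.prod_ite]
  congr 1
  · exact Finset.prod_congr (by ext; simp) fun _ _ => rfl
  · exact Finset.prod_congr (by ext; simp) fun _ _ => rfl

theorem continuous_component {n : ℕ} (c : (Fin n → Option (Fin 3)) → ℝ) (m : Fin 3 → ℝ)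
    (A : Finset (Fin n)) :
    Continuous fun x : Fin n → BlochSphere => component c m A fun k => bloch (x k) := by
  have h : ∀ (k : Fin n) (a : Option (Fin 3)),
      Continuous fun x : Fin n → BlochSphere => extend (bloch (x k)) a := fun k a =>
    (continuous_extend_bloch a).comp (continuous_apply k)
  unfold component
  refine continuous_finsetSum _ fun P _ => continuous_const.mul
    (continuous_finsetProd _ fun k _ => ?_)
  by_cases hk : k ∈ A
  · simp only [hk, if_true]; exact (h k _).sub continuous_const
  · simp only [hk, if_false]; exact continuous_const

theorem meanSqForm_posSemidef (D : Measure BlochSphere) : (meanSqForm D).PosSemidef :=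
  Matrix.posSemidef_vecMulVec_self_star (R := ℝ) (extend (meanBloch D))

section
variable (D : Measure BlochSphere) [IsProbabilityMeasure D]

theorem integral_extend (a : Option (Fin 3)) :
    ∫ x, extend (bloch x) a ∂D = extend (meanBloch D) a := by
  rcases a with _ | p
  · simp [extend]
  · rfl

/-- Components on different sets are orthogonal, and the norm of a component is a tensor form. -/
theorem integral_component_mul {n : ℕ} (c : (Fin n → Option (Fin 3)) → ℝ)
    (A B : Finset (Fin n)) :
    ∫ x, component c (meanBloch D) A (fun k => bloch (x k)) *
      component c (meanBloch D) B (fun k => bloch (x k)) ∂(productLaw n D) =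
      if A = B then tensorForm (fun k => if k ∈ A then covForm D else meanSqForm D) c else 0 := by
  set φ : Finset (Fin n) → Fin n → Option (Fin 3) → BlochSphere → ℝ := fun A k a x =>
    if k ∈ A then extend (bloch x) a - extend (meanBloch D) a else extend (meanBloch D) a with hφ
  have hcont : ∀ A k a, Continuous (φ A k a) := by
    intro A k a
    simp only [hφ]
    by_cases hk : k ∈ A
    · simp only [hk, if_true]; exact (continuous_extend_bloch a).sub continuous_const
    · simp only [hk, if_false]; exact continuous_const
  have hexp : ∀ x : Fin n → BlochSphere, component c (meanBloch D) A (fun k => bloch (x k)) *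
      component c (meanBloch D) B (fun k => bloch (x k)) =
      ∑ P, ∑ Q, c P * c Q * ∏ k, (φ A k (P k) (x k) * φ B k (Q k) (x k)) := by
    intro x
    simp only [component, hφ]
    rw [Finset.sum_mul_sum]
    refine Finset.sum_congr rfl fun P _ => Finset.sum_congr rfl fun Q _ => ?_
    rw [Finset.prod_mul_distrib]
    ring
  have hint : ∀ P Q : Fin n → Option (Fin 3), Integrable (fun x : Fin n → BlochSphere =>
      c P * c Q * ∏ k, (φ A k (P k) (x k) * φ B k (Q k) (x k))) (productLaw n D) := by
    intro P Q
    have : IsFiniteMeasure (productLaw n D) := by unfold productLaw; infer_instance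
    refine integrable_of_continuous (continuous_const.mul (continuous_finsetProd _ fun k _ => ?_))
    exact ((hcont A k _).comp (continuous_apply k)).mul ((hcont B k _).comp (continuous_apply k))
  simp only [hexp]
  rw [integral_finsetSum _ fun P _ => integrable_finsetSum _ fun Q _ => hint P Q]
  rw [Finset.sum_congr rfl fun P _ => integral_finsetSum _ fun Q _ => hint P Q]
  have hprod : ∀ P Q : Fin n → Option (Fin 3), ∫ x : Fin n → BlochSphere,
      c P * c Q * ∏ k, (φ A k (P k) (x k) * φ B k (Q k) (x k)) ∂(productLaw n D) =
      c P * c Q * ∏ k, ∫ x, φ A k (P k) x * φ B k (Q k) x ∂D := by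
    intro P Q
    rw [integral_const_mul, productLaw,
      integral_fintype_prod_eq_prod (fun k x => φ A k (P k) x * φ B k (Q k) x)]
  simp only [hprod]
  have hzero : ∀ a, ∫ x, (extend (bloch x) a - extend (meanBloch D) a) ∂D = 0 := by
    intro a
    rw [integral_sub (integrable_of_continuous (continuous_extend_bloch a)) (integrable_const _),
      integral_extend]
    simp
  by_cases hAB : A = B
  · subst hAB
    rw [if_pos rfl, tensorForm]
    refine Finset.sum_congr rfl fun P _ => Finset.sum_congr rfl fun Q _ => ?_
    congr 1
    refine Finset.prod_congr rfl fun k _ => ?_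
    by_cases hk : k ∈ A
    · simp [hφ, hk, covForm]
    · simp [hφ, hk, meanSqForm]
  · rw [if_neg hAB]
    refine Finset.sum_eq_zero fun P _ => Finset.sum_eq_zero fun Q _ => ?_
    -- a site in exactly one of the two sets contributes a centred factor
    obtain ⟨k, hk⟩ : ∃ k, ¬ (k ∈ A ↔ k ∈ B) := by
      by_contra hcon
      push Not at hcon
      exact hAB (Finset.ext hcon)
    rw [Finset.prod_eq_zero (Finset.mem_univ k), mul_zero]
    by_cases hA : k ∈ A
    · have hB : k ∉ B := fun hB => hk (by simp [hA, hB])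
      simp [hφ, hA, hB, integral_mul_const, hzero]
    · have hB : k ∈ B := by by_contra hB; exact hk (by simp [hA, hB])
      simp [hφ, hA, hB, integral_const_mul, hzero]

theorem covForm_posSemidef : (covForm D).PosSemidef := by
  refine Matrix.PosSemidef.of_dotProduct_mulVec_nonneg ?_ fun w => ?_
  · ext a b
    simp only [Matrix.conjTranspose_apply, covForm, Matrix.of_apply, star_trivial, mul_comm]
  · have hi : ∀ a b, Integrable (fun x => w a * ((extend (bloch x) a - extend (meanBloch D) a) *
        (extend (bloch x) b - extend (meanBloch D) b) * w b)) D := fun a b =>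
      integrable_of_continuous (by have := continuous_extend_bloch; fun_prop)
    simp only [dotProduct, Matrix.mulVec, covForm, Matrix.of_apply, star_trivial, Finset.mul_sum,
      ← integral_mul_const, ← integral_const_mul]
    rw [← Finset.sum_congr rfl fun p _ => integral_finsetSum _ fun q _ => hi p q,
      ← integral_finsetSum _ fun p _ => integrable_finsetSum _ fun q _ => hi p q]
    refine integral_nonneg fun x => ?_
    have : ∑ a, ∑ b, w a * ((extend (bloch x) a - extend (meanBloch D) a) *
        (extend (bloch x) b - extend (meanBloch D) b) * w b) =
        (∑ a, w a * (extend (bloch x) a - extend (meanBloch D) a)) ^ 2 := by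
      rw [sq, Finset.sum_mul_sum]
      exact Finset.sum_congr rfl fun p _ => Finset.sum_congr rfl fun q _ => by ring
    simp only [this]
    exact sq_nonneg _

/-- The midpoint of two Bloch vectors lies in the Bloch ball, so that `tensorForm_kmsForm_le` can be
averaged over independent pairs at all sites. -/
theorem tensorForm_meanForm_le {n : ℕ} {l : Op n →ₗ[ℂ] ℂ} (hl : IsContractive l) :
    tensorForm (fun _ => meanForm D) (pauliCoeff l) ≤ 1 := by
  set c := pauliCoeff l with hc
  have hc : ∀ P Q : Fin n → Option (Fin 3), Continuous fun z : Fin n → BlochSphere × BlochSphere =>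
      c P * c Q * ∏ k, kmsForm (midpointBloch (z k)) (P k) (Q k) := fun P Q =>
    continuous_const.mul (continuous_finsetProd _ fun k _ =>
      (continuous_kmsForm_midpoint _ _).comp (continuous_apply k))
  have hi : ∀ P Q, Integrable (fun z : Fin n → BlochSphere × BlochSphere =>
      c P * c Q * ∏ k, kmsForm (midpointBloch (z k)) (P k) (Q k))
        (Measure.pi fun _ => D.prod D) := fun P Q => integrable_of_continuous (hc P Q)
  have h1 : tensorForm (fun _ => meanForm D) c =
      ∫ z : Fin n → BlochSphere × BlochSphere,
        tensorForm (fun k => kmsForm (midpointBloch (z k))) c ∂(Measure.pi fun _ => D.prod D) := by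
    simp only [tensorForm]
    rw [integral_finsetSum _ fun P _ => integrable_finsetSum _ fun Q _ => hi P Q]
    refine Finset.sum_congr rfl fun P _ => ?_
    rw [integral_finsetSum _ fun Q _ => hi P Q]
    refine Finset.sum_congr rfl fun Q _ => ?_
    rw [integral_const_mul,
      integral_fintype_prod_eq_prod (fun k z => kmsForm (midpointBloch z) (P k) (Q k))]
    rfl
  rw [h1]
  have h2 : ∫ z : Fin n → BlochSphere × BlochSphere,
        tensorForm (fun k => kmsForm (midpointBloch (z k))) c ∂(Measure.pi fun _ => D.prod D) ≤
      ∫ _ : Fin n → BlochSphere × BlochSphere, (1 : ℝ) ∂(Measure.pi fun _ => D.prod D) := by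
    refine integral_mono (integrable_finsetSum _ fun P _ => integrable_finsetSum _ fun Q _ =>
      hi P Q) (integrable_const _) fun z =>
        hl.tensorForm_kmsForm_le fun k => sum_midpointBloch_sq_le (z k)
  simpa using h2

/-- The components weighted by `(1 + η/8)^|A|` have total mean square at most `1`. -/
theorem sum_weighted_component_le {n : ℕ} {l : Op n →ₗ[ℂ] ℂ} (hl : IsContractive l) {η : ℝ}
    (hη0 : 0 ≤ η) (hη : opNorm (secondMoment D) ≤ 1 - η) :
    ∑ A : Finset (Fin n), (1 + η / 8) ^ A.card *
      tensorForm (fun k => if k ∈ A then covForm D else meanSqForm D) (pauliCoeff l) ≤ 1 := by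
  have ht : 0 ≤ 1 + η / 8 := by linarith
  have h := tensorForm_mono (n := n) (M := fun _ => (1 + η / 8) • covForm D + meanSqForm D)
    (fun _ => ((covForm_posSemidef D).smul ht).add (meanSqForm_posSemidef D))
    (fun _ => meanForm_gap D hη0 hη) (pauliCoeff l)
  refine le_trans (le_of_eq ?_) (h.trans (tensorForm_meanForm_le D hl))
  rw [tensorForm_add (fun _ => (1 + η / 8) • covForm D) (fun _ => meanSqForm D)]
  refine Finset.sum_congr rfl fun A _ => ?_
  simp only [tensorForm, Finset.mul_sum]
  refine Finset.sum_congr rfl fun P _ => Finset.sum_congr rfl fun Q _ => ?_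
  have h1 : ∀ k, (if k ∈ A then (1 + η / 8) • covForm D else meanSqForm D) (P k) (Q k) =
      (if k ∈ A then 1 + η / 8 else 1) *
        (if k ∈ A then covForm D else meanSqForm D) (P k) (Q k) := by
    intro k
    split_ifs <;> simp
  rw [Finset.prod_congr rfl fun k _ => h1 k, Finset.prod_mul_distrib, Finset.prod_ite_mem,
    Finset.univ_inter, Finset.prod_const]
  ring

/-- Truncating the decomposition at sets of `k` sites costs a mean square error of at most
`(1 + η/8)^{-k}`, and nothing when `k ≥ n`. -/
theorem truncation_error {n : ℕ} {l : Op n →ₗ[ℂ] ℂ} (hl : IsContractive l) {η : ℝ}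
    (hη0 : 0 ≤ η) (hη : opNorm (secondMoment D) ≤ 1 - η) {k : ℕ} {τ : ℝ} (hτ : 0 ≤ τ)
    (hk : n ≤ k ∨ 1 ≤ τ * (1 + η / 8) ^ k) :
    ∫ x, (multi (pauliCoeff l) (fun i => bloch (x i)) -
      ∑ A : Finset (Fin n) with A.card ≤ k,
        component (pauliCoeff l) (meanBloch D) A fun i => bloch (x i)) ^ 2
        ∂(productLaw n D) ≤ τ := by
  set c := pauliCoeff l with hc
  have : IsFiniteMeasure (productLaw n D) := by unfold productLaw; infer_instance
  have h1 : ∀ x : Fin n → BlochSphere, (multi c (fun i => bloch (x i)) -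
      ∑ A : Finset (Fin n) with A.card ≤ k, component c (meanBloch D) A fun i => bloch (x i)) ^ 2 =
      ∑ A : Finset (Fin n) with ¬ A.card ≤ k, ∑ B : Finset (Fin n) with ¬ B.card ≤ k,
        component c (meanBloch D) A (fun i => bloch (x i)) *
          component c (meanBloch D) B fun i => bloch (x i) := by
    intro x
    rw [multi_eq_sum_component c (meanBloch D), ← Finset.sum_filter_add_sum_filter_not
      Finset.univ (fun A : Finset (Fin n) => A.card ≤ k), add_sub_cancel_left, sq,
      Finset.sum_mul_sum]
  have hi : ∀ A B, Integrable (fun x : Fin n → BlochSphere =>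
      component c (meanBloch D) A (fun i => bloch (x i)) *
          component c (meanBloch D) B fun i => bloch (x i)) (productLaw n D) := fun A B =>
    integrable_of_continuous ((continuous_component _ _ A).mul (continuous_component _ _ B))
  simp only [h1]
  rw [integral_finsetSum _ fun A _ => integrable_finsetSum _ fun B _ => hi A B,
    Finset.sum_congr rfl fun A _ => integral_finsetSum _ fun B _ => hi A B]
  simp only [integral_component_mul]
  have h2 : ∀ A ∈ Finset.univ.filter fun A : Finset (Fin n) => ¬ A.card ≤ k,
      (∑ B : Finset (Fin n) with ¬ B.card ≤ k, if A = B then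
        tensorForm (fun k => if k ∈ A then covForm D else meanSqForm D) c else 0) =
      tensorForm (fun k => if k ∈ A then covForm D else meanSqForm D) c := by
    intro A hA
    rw [Finset.sum_ite_eq, if_pos hA]
  rw [Finset.sum_congr rfl h2]
  have hnn : ∀ A : Finset (Fin n),
      0 ≤ tensorForm (fun k => if k ∈ A then covForm D else meanSqForm D) c := fun A =>
    tensorForm_nonneg (fun k => by
      split_ifs
      exacts [covForm_posSemidef D, meanSqForm_posSemidef D]) c
  rcases hk with hk | hk
  · rw [Finset.sum_eq_zero]
    · exact hτ
    · intro A hA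
      have := (Finset.mem_filter.mp hA).2
      exact absurd ((Finset.card_le_univ A).trans (by simpa using hk)) this
  · calc ∑ A : Finset (Fin n) with ¬ A.card ≤ k,
          tensorForm (fun k => if k ∈ A then covForm D else meanSqForm D) c
        ≤ ∑ A : Finset (Fin n) with ¬ A.card ≤ k, τ * ((1 + η / 8) ^ A.card *
            tensorForm (fun k => if k ∈ A then covForm D else meanSqForm D) c) := by
          refine Finset.sum_le_sum fun A hA => ?_
          have hA := (Finset.mem_filter.mp hA).2
          have h3 : (1 + η / 8) ^ k ≤ (1 + η / 8) ^ A.card :=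
            pow_le_pow_right₀ (by linarith) (by omega)
          have h4 : 1 ≤ τ * (1 + η / 8) ^ A.card :=
            hk.trans (mul_le_mul_of_nonneg_left h3 hτ)
          rw [← mul_assoc]
          exact le_mul_of_one_le_left (hnn A) h4
      _ ≤ ∑ A : Finset (Fin n), τ * ((1 + η / 8) ^ A.card *
            tensorForm (fun k => if k ∈ A then covForm D else meanSqForm D) c) :=
          Finset.sum_le_sum_of_subset_of_nonneg (Finset.filter_subset _ _) fun A _ _ =>
            mul_nonneg hτ (mul_nonneg (by positivity) (hnn A))
      _ ≤ τ := by
          rw [← Finset.mul_sum]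
          exact mul_le_of_le_one_right hτ (sum_weighted_component_le D hl hη0 hη)

end

/-! ### Probe patterns and the interpolation formula -/

/-- A coordinate axis together with an orientation. -/
abbrev Dir : Type := Fin 3 × Bool

/-- The unit vector of a direction. -/
noncomputable def dirVec (d : Dir) : Fin 3 → ℝ := Pi.single d.1 (if d.2 then 1 else -1)

/-- A probe pattern marks some sites with a direction. -/
abbrev Pattern (n : ℕ) : Type := Fin n → Option Dir

/-- The number of marked sites of a pattern. -/
def Pattern.weight {n : ℕ} (q : Pattern n) : ℕ := (Finset.univ.filter fun i => q i ≠ none).card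

/-- The Bloch vectors of the probe state of a pattern: marked sites carry the marking direction,
the others the vector `ν`. -/
noncomputable def Pattern.probe {n : ℕ} (ν : Fin 3 → ℝ) (q : Pattern n) (i : Fin n) :
    Fin 3 → ℝ :=
  (q i).elim ν dirVec

/-- The interpolation coefficient at `x` of a pattern, with factor `d·(xᵢ - ν)/2` at a site `i` that
is marked with `d`. -/
noncomputable def Pattern.coeff {n : ℕ} (ν : Fin 3 → ℝ) (x : Fin n → Fin 3 → ℝ)
    (q : Pattern n) : ℝ :=
  ∏ i, (q i).elim 1 fun d => (∑ p, dirVec d p * (x i p - ν p)) / 2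

/-- The patterns with at most `k` marked sites. -/
def lowPatterns (n k : ℕ) : Finset (Pattern n) := Finset.univ.filter fun q => q.weight ≤ k

theorem dirVec_sq (d : Dir) : ∑ p, dirVec d p ^ 2 = 1 := by
  rcases d with ⟨p, b⟩
  fin_cases p <;> cases b <;> simp [dirVec, Pi.single_apply]

/-- A sum over patterns is a sum over the marked set, with an independent direction at each marked
site. -/
theorem sum_lowPatterns_prod {n k : ℕ} {R : Type} [CommRing R] (h : Fin n → Option Dir → R) :
    ∑ q ∈ lowPatterns n k, ∏ i, h i (q i) =
      ∑ A : Finset (Fin n) with A.card ≤ k,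
        ∏ i, if i ∈ A then ∑ d, h i (some d) else h i none := by
  classical
  rw [← Finset.sum_fiberwise_of_maps_to (s := lowPatterns n k)
    (t := Finset.univ.filter fun A : Finset (Fin n) => A.card ≤ k)
    (g := fun q => Finset.univ.filter fun i => q i ≠ none)]
  · refine Finset.sum_congr rfl fun A hA => ?_
    have hA := (Finset.mem_filter.mp hA).2
    have h1 : ∀ i, (if i ∈ A then ∑ d, h i (some d) else h i none) =
        ∑ o ∈ (if i ∈ A then Finset.univ.map Function.Embedding.some else {none} :
          Finset (Option Dir)), h i o := by
      intro i
      split_ifs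
      · rw [Finset.sum_map]; rfl
      · simp
    rw [Finset.prod_congr rfl fun i _ => h1 i, Finset.prod_univ_sum]
    refine Finset.sum_congr ?_ fun _ _ => rfl
    ext q
    simp only [lowPatterns, Finset.mem_filter, Finset.mem_univ, true_and, Fintype.mem_piFinset]
    constructor
    · rintro ⟨_, rfl⟩ i
      by_cases hi : q i = none
      · simp [hi]
      · obtain ⟨d, hd⟩ := Option.ne_none_iff_exists'.mp hi
        simp [hd]
    · intro hq
      have hsupp : (Finset.univ.filter fun i => q i ≠ none) = A := by
        ext i
        have := hq i
        by_cases hi : i ∈ A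
        · rw [if_pos hi] at this
          obtain ⟨d, -, hd⟩ := Finset.mem_map.mp this
          simp [← hd, hi]
        · rw [if_neg hi] at this
          simp [Finset.mem_singleton.mp this, hi]
      exact ⟨by rw [Pattern.weight, hsupp]; exact hA, hsupp⟩
  · intro q hq
    exact Finset.mem_filter.mpr ⟨Finset.mem_univ _, (Finset.mem_filter.mp hq).2⟩

/-- Interpolation at one site: the values at the six unit vectors `±e_p`, with weights
`d·(y - ν)/2`, give the increment of an affine function from `ν` to `y`. -/
theorem sum_dir_interpolation (ν y : Fin 3 → ℝ) (a : Option (Fin 3)) :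
    ∑ d : Dir, (∑ p, dirVec d p * (y p - ν p)) / 2 * extend (dirVec d) a =
      extend y a - extend ν a := by
  rcases a with _ | p
  · rw [Fintype.sum_prod_type]
    refine (Finset.sum_eq_zero fun p _ => ?_).trans (sub_self _).symm
    simp [dirVec, extend, Pi.single_apply]
    ring
  · fin_cases p <;>
    · simp [Fintype.sum_prod_type, dirVec, extend, Pi.single_apply]
      ring

/-- The truncated decomposition around `ν` is interpolated from the values at probe states. -/
theorem sum_coeff_mul_multi {n k : ℕ} (c : (Fin n → Option (Fin 3)) → ℝ) (ν : Fin 3 → ℝ)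
    (x : Fin n → Fin 3 → ℝ) :
    ∑ q ∈ lowPatterns n k, q.coeff ν x * multi c (q.probe ν) =
      ∑ A : Finset (Fin n) with A.card ≤ k, component c ν A x := by
  simp only [multi, component, Finset.mul_sum]
  rw [Finset.sum_comm]
  conv_rhs => rw [Finset.sum_comm]
  refine Finset.sum_congr rfl fun P _ => ?_
  rw [← Finset.mul_sum]
  have h := sum_lowPatterns_prod (n := n) (k := k) fun i o =>
    (o.elim 1 fun d => (∑ p, dirVec d p * (x i p - ν p)) / 2) *
      extend (o.elim ν dirVec) (P i)
  simp only [Option.elim_some, Option.elim_none, one_mul, sum_dir_interpolation] at h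
  rw [← h, Finset.mul_sum]
  refine Finset.sum_congr rfl fun q _ => ?_
  rw [Finset.prod_mul_distrib]
  simp only [Pattern.coeff, Pattern.probe]
  ring

/-! ### Perturbation bounds -/

theorem abs_prod_le_one {ι : Type} (s : Finset ι) (a : ι → ℝ) (ha : ∀ i, |a i| ≤ 1) :
    |∏ i ∈ s, a i| ≤ 1 := by
  rw [Finset.abs_prod]
  exact Finset.prod_le_one (fun i _ => abs_nonneg _) fun i _ => ha i

theorem abs_prod_sub_prod_le {ι : Type} (s : Finset ι) (a b : ι → ℝ) (ha : ∀ i, |a i| ≤ 1)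
    (hb : ∀ i, |b i| ≤ 1) : |∏ i ∈ s, a i - ∏ i ∈ s, b i| ≤ ∑ i ∈ s, |a i - b i| := by
  classical
  induction s using Finset.induction_on with
  | empty => simp
  | insert j s hj ih =>
    rw [Finset.prod_insert hj, Finset.prod_insert hj, Finset.sum_insert hj]
    have h1 : a j * ∏ i ∈ s, a i - b j * ∏ i ∈ s, b i =
        (a j - b j) * ∏ i ∈ s, a i + b j * (∏ i ∈ s, a i - ∏ i ∈ s, b i) := by ring
    rw [h1]
    refine (abs_add_le _ _).trans (add_le_add ?_ ?_)
    · rw [abs_mul]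
      exact mul_le_of_le_one_right (abs_nonneg _) (abs_prod_le_one s a ha)
    · rw [abs_mul]
      exact (mul_le_of_le_one_left (abs_nonneg _) (hb j)).trans ih

theorem abs_le_one_of_sum_sq_le {v : Fin 3 → ℝ} (hv : ∑ p, v p ^ 2 ≤ 1) (p : Fin 3) :
    |v p| ≤ 1 := by
  have h2 : v p ^ 2 ≤ ∑ q, v q ^ 2 :=
    Finset.single_le_sum (f := fun q => v q ^ 2) (fun _ _ => sq_nonneg _) (Finset.mem_univ p)
  exact (sq_le_one_iff_abs_le_one _).mp (h2.trans hv)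

theorem sum_dirVec_mul (d : Dir) (y : Fin 3 → ℝ) :
    ∑ p, dirVec d p * y p = (if d.2 then 1 else -1) * y d.1 := by
  simp [dirVec, Pi.single_apply]

theorem coeff_factor_abs_le {ν y : Fin 3 → ℝ} (hν : ∑ p, ν p ^ 2 ≤ 1) (hy : ∑ p, y p ^ 2 ≤ 1)
    (o : Option Dir) : |o.elim 1 fun d => (∑ p, dirVec d p * (y p - ν p)) / 2| ≤ 1 := by
  rcases o with _ | d
  · simp
  · have h1 := abs_le.mp (abs_le_one_of_sum_sq_le hν d.1)
    have h2 := abs_le.mp (abs_le_one_of_sum_sq_le hy d.1)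
    simp only [Option.elim_some, sum_dirVec_mul d fun p => y p - ν p]
    rw [abs_le]
    split_ifs <;> constructor <;> linarith

theorem Pattern.abs_coeff_le {n : ℕ} {ν : Fin 3 → ℝ} {x : Fin n → Fin 3 → ℝ}
    (hν : ∑ p, ν p ^ 2 ≤ 1) (hx : ∀ i, ∑ p, x i p ^ 2 ≤ 1) (q : Pattern n) :
    |q.coeff ν x| ≤ 1 :=
  abs_prod_le_one _ _ fun i => coeff_factor_abs_le hν (hx i) (q i)

theorem Pattern.abs_coeff_sub_le {n : ℕ} {ν m : Fin 3 → ℝ} {x : Fin n → Fin 3 → ℝ}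
    (hν : ∑ p, ν p ^ 2 ≤ 1) (hm : ∑ p, m p ^ 2 ≤ 1) (hx : ∀ i, ∑ p, x i p ^ 2 ≤ 1)
    {τ : ℝ} (hτ : ∀ p, |ν p - m p| ≤ τ) (q : Pattern n) :
    |q.coeff ν x - q.coeff m x| ≤ n * τ := by
  have hτ0 : 0 ≤ τ := (abs_nonneg _).trans (hτ 0)
  refine (abs_prod_sub_prod_le _ _ _ (fun i => coeff_factor_abs_le hν (hx i) (q i))
    fun i => coeff_factor_abs_le hm (hx i) (q i)).trans ?_
  have : ∀ i ∈ (Finset.univ : Finset (Fin n)),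
      |((q i).elim 1 fun d => (∑ p, dirVec d p * (x i p - ν p)) / 2) -
        ((q i).elim 1 fun d => (∑ p, dirVec d p * (x i p - m p)) / 2)| ≤ τ := by
    intro i _
    rcases q i with _ | d
    · simpa using hτ0
    · have h1 := abs_le.mp (hτ d.1)
      simp only [Option.elim_some, sum_dirVec_mul d fun p => x i p - ν p,
        sum_dirVec_mul d fun p => x i p - m p]
      rw [abs_le]
      split_ifs <;> constructor <;> linarith
  refine (Finset.sum_le_sum this).trans ?_
  simp

theorem multi_update {n : ℕ} (c : (Fin n → Option (Fin 3)) → ℝ) (v : Fin n → Fin 3 → ℝ)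
    (i : Fin n) (a : Fin 3 → ℝ) :
    multi c (Function.update v i a) =
      ∑ P, extend a (P i) * (c P * ∏ k ∈ Finset.univ.erase i, extend (v k) (P k)) := by
  rw [multi]
  refine Finset.sum_congr rfl fun P _ => ?_
  rw [← Finset.mul_prod_erase Finset.univ _ (Finset.mem_univ i), Function.update_self,
    Finset.prod_congr rfl fun k hk => by
      rw [Function.update_of_ne (Finset.ne_of_mem_erase hk)]]
  ring

/-- A function that is affine in each Bloch vector and bounded by `1` on states is Lipschitz. -/
theorem abs_multi_sub_le {n : ℕ} {c : (Fin n → Option (Fin 3)) → ℝ}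
    (hc : ∀ v : Fin n → Fin 3 → ℝ, (∀ k, ∑ p, v k p ^ 2 ≤ 1) → |multi c v| ≤ 1)
    {v w : Fin n → Fin 3 → ℝ} (hv : ∀ k, ∑ p, v k p ^ 2 ≤ 1) (hw : ∀ k, ∑ p, w k p ^ 2 ≤ 1) :
    |multi c v - multi c w| ≤ ∑ i, ∑ p, |v i p - w i p| := by
  classical
  -- in one argument, the slope along `e_p` is half the difference of the values at `e_p` and
  -- `-e_p`, which are bounded by `1`
  have hstep : ∀ (u : Fin n → Fin 3 → ℝ) (_ : ∀ k, ∑ p, u k p ^ 2 ≤ 1) (i : Fin n)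
      (a b : Fin 3 → ℝ), |multi c (Function.update u i a) - multi c (Function.update u i b)| ≤
        ∑ p, |a p - b p| := by
    intro u hu i a b
    have h1 : multi c (Function.update u i a) - multi c (Function.update u i b) =
        ∑ p, (a p - b p) * ((multi c (Function.update u i (dirVec (p, true))) -
          multi c (Function.update u i (dirVec (p, false)))) / 2) := by
      simp only [multi_update, ← Finset.sum_sub_distrib, Finset.sum_div, Finset.mul_sum]
      rw [Finset.sum_comm]
      refine Finset.sum_congr rfl fun P _ => ?_
      rcases P i with _ | q
      · simp [extend]
      · fin_cases q <;> simp [extend, dirVec, Fin.sum_univ_three, Pi.single_apply] <;> ring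
    rw [h1]
    refine (Finset.abs_sum_le_sum_abs _ _).trans (Finset.sum_le_sum fun p _ => ?_)
    rw [abs_mul]
    refine mul_le_of_le_one_right (abs_nonneg _) ?_
    have hd : ∀ d, |multi c (Function.update u i (dirVec d))| ≤ 1 := fun d => hc _ fun k => by
      by_cases hk : k = i
      · subst hk; simp [dirVec_sq]
      · rw [Function.update_of_ne hk]; exact hu k
    have e1 := abs_le.mp (hd (p, true))
    have e2 := abs_le.mp (hd (p, false))
    rw [abs_le]
    constructor <;> linarith
  -- the arguments are exchanged one after the other
  have key : ∀ s : Finset (Fin n), |multi c (s.piecewise v w) - multi c w| ≤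
      ∑ i ∈ s, ∑ p, |v i p - w i p| := by
    intro s
    induction s using Finset.induction_on with
    | empty => simp
    | insert i s hi ih =>
      rw [Finset.sum_insert hi, Finset.piecewise_insert]
      have hb : Function.update (s.piecewise v w) i (w i) = s.piecewise v w := by
        rw [Function.update_eq_self_iff, Finset.piecewise_eq_of_notMem _ _ _ hi]
      have h2 := hstep (s.piecewise v w) (fun k => by
        by_cases hk : k ∈ s
        · rw [Finset.piecewise_eq_of_mem _ _ _ hk]; exact hv k
        · rw [Finset.piecewise_eq_of_notMem _ _ _ hk]; exact hw k) i (v i) (w i)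
      rw [hb] at h2
      have := abs_sub_le (multi c (Function.update (s.piecewise v w) i (v i)))
        (multi c (s.piecewise v w)) (multi c w)
      linarith
  have := key Finset.univ
  rwa [Finset.piecewise_univ] at this

theorem Pattern.probe_sq_le {n : ℕ} {ν : Fin 3 → ℝ} (hν : ∑ p, ν p ^ 2 ≤ 1) (q : Pattern n)
    (i : Fin n) : ∑ p, q.probe ν i p ^ 2 ≤ 1 := by
  unfold Pattern.probe
  rcases q i with _ | d
  · exact hν
  · exact (dirVec_sq d).le

/-- One term of the interpolation formula, with an estimated value and an estimated mean, is close
to the term with the exact value and the exact mean. -/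
theorem Pattern.abs_term_sub_le {n : ℕ} {c : (Fin n → Option (Fin 3)) → ℝ}
    (hc : ∀ v : Fin n → Fin 3 → ℝ, (∀ k, ∑ p, v k p ^ 2 ≤ 1) → |multi c v| ≤ 1)
    {ν m : Fin 3 → ℝ} {x : Fin n → Fin 3 → ℝ} (hν : ∑ p, ν p ^ 2 ≤ 1) (hm : ∑ p, m p ^ 2 ≤ 1)
    (hx : ∀ i, ∑ p, x i p ^ 2 ≤ 1) {τ : ℝ} (hτ : ∀ p, |ν p - m p| ≤ τ) (q : Pattern n) {g : ℝ}
    (hg : |g - multi c (q.probe ν)| ≤ τ) :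
    |q.coeff ν x * g - q.coeff m x * multi c (q.probe m)| ≤ (4 * n + 1) * τ := by
  have hτ0 : 0 ≤ τ := (abs_nonneg _).trans (hτ 0)
  have e1 := q.abs_coeff_le hν hx
  have e2 := q.abs_coeff_sub_le hν hm hx hτ
  have e4 := hc _ (q.probe_sq_le hm)
  have e5 : |multi c (q.probe ν) - multi c (q.probe m)| ≤ n * (3 * τ) := by
    refine (abs_multi_sub_le hc (q.probe_sq_le hν) (q.probe_sq_le hm)).trans ?_
    have : ∀ i ∈ (Finset.univ : Finset (Fin n)), ∑ p, |q.probe ν i p - q.probe m i p| ≤ 3 * τ := by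
      intro i _
      unfold Pattern.probe
      rcases q i with _ | d
      · simp only [Option.elim_none, Fin.sum_univ_three]
        linarith [hτ 0, hτ 1, hτ 2]
      · simp [hτ0]
    refine (Finset.sum_le_sum this).trans ?_
    simp
  have hid : q.coeff ν x * g - q.coeff m x * multi c (q.probe m) =
      q.coeff ν x * (g - multi c (q.probe ν)) +
        q.coeff ν x * (multi c (q.probe ν) - multi c (q.probe m)) +
        (q.coeff ν x - q.coeff m x) * multi c (q.probe m) := by ring
  rw [hid]
  refine (abs_add_three _ _ _).trans ?_
  rw [abs_mul, abs_mul, abs_mul]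
  have f1 := mul_le_of_le_one_left (abs_nonneg (g - multi c (q.probe ν))) e1
  have f2 := mul_le_of_le_one_left (abs_nonneg (multi c (q.probe ν) - multi c (q.probe m))) e1
  have f3 := mul_le_of_le_one_right (abs_nonneg (q.coeff ν x - q.coeff m x)) e4
  linarith

/-- The interpolated function with estimated values and an estimated mean is uniformly close to
the truncated decomposition around the exact mean. The family `Q` enumerates the patterns. -/
theorem interpolation_error {n k M : ℕ} {c : (Fin n → Option (Fin 3)) → ℝ}
    (hc : ∀ v : Fin n → Fin 3 → ℝ, (∀ k, ∑ p, v k p ^ 2 ≤ 1) → |multi c v| ≤ 1)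
    {Q : ℕ → Pattern n}
    (hQ : ∀ Φ : Pattern n → ℝ, ∑ j ∈ Finset.range M, Φ (Q j) = ∑ q ∈ lowPatterns n k, Φ q)
    {ν m : Fin 3 → ℝ} {x : Fin n → Fin 3 → ℝ} (hν : ∑ p, ν p ^ 2 ≤ 1) (hm : ∑ p, m p ^ 2 ≤ 1)
    (hx : ∀ i, ∑ p, x i p ^ 2 ≤ 1) {τ : ℝ} (hτ : ∀ p, |ν p - m p| ≤ τ) {g : ℕ → ℝ}
    (hg : ∀ j < M, |g j - multi c ((Q j).probe ν)| ≤ τ) :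
    |∑ j ∈ Finset.range M, (Q j).coeff ν x * g j -
      ∑ A : Finset (Fin n) with A.card ≤ k, component c m A x| ≤ M * ((4 * n + 1) * τ) := by
  rw [← sum_coeff_mul_multi, ← hQ fun q => q.coeff m x * multi c (q.probe m),
    ← Finset.sum_sub_distrib]
  refine (Finset.abs_sum_le_sum_abs _ _).trans ?_
  refine (Finset.sum_le_card_nsmul _ _ _ fun j hj =>
    (Q j).abs_term_sub_le hc hν hm hx hτ (hg j (Finset.mem_range.mp hj))).trans_eq ?_
  rw [nsmul_eq_mul, Finset.card_range]

/-! ### The number of patterns -/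

theorem card_lowPatterns_eq (n k : ℕ) :
    (lowPatterns n k).card = ∑ j ∈ Finset.range (n + 1),
      n.choose j * (if j ≤ k then 6 ^ j else 0) := by
  have h := sum_lowPatterns_prod (n := n) (k := k) (R := ℤ) fun _ _ => 1
  have h2 := Finset.sum_powerset_apply_card (fun j => if j ≤ k then (6 : ℤ) ^ j else 0)
    (x := (Finset.univ : Finset (Fin n)))
  simp only [Finset.prod_const_one, Finset.sum_const, nsmul_eq_mul, mul_one, Finset.card_univ,
    Fintype.card_prod, Fintype.card_fin, Fintype.card_bool, Finset.prod_ite, Finset.prod_const,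
    Finset.filter_mem_eq_inter, Finset.univ_inter] at h
  rw [Finset.powerset_univ, ← Finset.sum_filter] at h2
  zify
  rw [h]
  simp only [Finset.card_univ, Fintype.card_fin, nsmul_eq_mul] at h2
  norm_num at h2 ⊢
  exact h2

theorem card_lowPatterns_le_pow (n k : ℕ) : (lowPatterns n k).card ≤ (6 * n + 1) ^ k := by
  rw [card_lowPatterns_eq, add_pow]
  have h1 : ∑ j ∈ Finset.range (n + 1), n.choose j * (if j ≤ k then 6 ^ j else 0) ≤
      ∑ j ∈ Finset.range (n + 1), if j ≤ k then (6 * n) ^ j * k.choose j else 0 := by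
    refine Finset.sum_le_sum fun j _ => ?_
    split_ifs with hj
    · rw [mul_pow]
      have := Nat.choose_le_pow n j
      have h2 := Nat.choose_pos hj
      nlinarith [Nat.mul_le_mul this h2, Nat.zero_le (6 ^ j),
        Nat.mul_le_mul_left (6 ^ j) (Nat.mul_le_mul this h2)]
    · simp
  refine h1.trans ?_
  rw [← Finset.sum_filter]
  simp only [one_pow, mul_one]
  refine Finset.sum_le_sum_of_subset fun j hj => ?_
  have := (Finset.mem_filter.mp hj).2
  exact Finset.mem_range.mpr (by omega)

theorem card_lowPatterns_le_seven_pow (n k : ℕ) : (lowPatterns n k).card ≤ 7 ^ n := by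
  refine (Finset.card_le_univ _).trans ?_
  simp [Pattern]

theorem six_mul_lt_card_lowPatterns {n k : ℕ} (hn : 1 ≤ n) (hk : 1 ≤ k) :
    6 * n < (lowPatterns n k).card := by
  rw [card_lowPatterns_eq]
  have h : ∑ j ∈ ({0, 1} : Finset ℕ), n.choose j * (if j ≤ k then 6 ^ j else 0) ≤
      ∑ j ∈ Finset.range (n + 1), n.choose j * (if j ≤ k then 6 ^ j else 0) :=
    Finset.sum_le_sum_of_subset fun j hj => by
      simp at hj
      exact Finset.mem_range.mpr (by omega)
  refine lt_of_lt_of_le ?_ h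
  simp [hk]
  omega

/-! ### Concentration of the empirical means -/

/-- Hoeffding's inequality for the empirical mean of `R` variables with values in `[-1, 1]`. -/
theorem hoeffding_mean {Ω : Type*} [MeasurableSpace Ω] {P : Measure Ω} [IsProbabilityMeasure P]
    {X : ℕ → Ω → ℝ} (hind : ProbabilityTheory.iIndepFun X P) (hmeas : ∀ i, Measurable (X i))
    (hb : ∀ i ω, X i ω ∈ Set.Icc (-1 : ℝ) 1) {m : ℝ} (hm : ∀ i, ∫ ω, X i ω ∂P = m)
    {R : ℕ} (hR : 1 ≤ R) {τ : ℝ} (hτ : 0 ≤ τ) :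
    P {ω | τ < |(∑ i ∈ Finset.range R, X i ω) / R - m|} ≤
      ENNReal.ofReal (2 * Real.exp (-(R * τ ^ 2 / 2))) := by
  have hR0 : (0 : ℝ) < R := by exact_mod_cast hR
  have hone : ∀ (Y : ℕ → Ω → ℝ) (_ : ProbabilityTheory.iIndepFun Y P)
      (_ : ∀ i, Measurable (Y i)) (_ : ∀ i ω, Y i ω ∈ Set.Icc (-1 : ℝ) 1) (m' : ℝ)
      (_ : ∀ i, ∫ ω, Y i ω ∂P = m'),
      P {ω | R * τ ≤ ∑ i ∈ Finset.range R, (Y i ω - m')} ≤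
        ENNReal.ofReal (Real.exp (-(R * τ ^ 2 / 2))) := by
    intro Y hY hYm hYb m' hm'
    have hsub : ∀ i < R, ProbabilityTheory.HasSubgaussianMGF (fun ω => Y i ω - m') 1 P := by
      intro i _
      have h := ProbabilityTheory.hasSubgaussianMGF_of_mem_Icc (μ := P) (X := Y i)
        (hYm i).aemeasurable (Filter.Eventually.of_forall (hYb i))
      rw [hm'] at h
      convert h using 1
      ext
      norm_num
    have hind' : ProbabilityTheory.iIndepFun (fun i ω => Y i ω - m') P :=
      hY.comp (fun _ x => x - m') fun _ => measurable_id.sub_const m'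
    have h := ProbabilityTheory.HasSubgaussianMGF.measure_sum_range_ge_le_of_iIndepFun hind' hsub
      (ε := R * τ) (by positivity)
    rw [Measure.real, ← ENNReal.le_ofReal_iff_toReal_le (measure_ne_top _ _)
      (Real.exp_nonneg _)] at h
    refine h.trans (le_of_eq ?_)
    congr 2
    push_cast
    field_simp
  have h1 := hone X hind hmeas hb m hm
  have h2 := hone (fun i ω => -X i ω) (hind.comp (fun _ x => -x) fun _ => measurable_neg)
    (fun i => (hmeas i).neg) (fun i ω => by
      have := hb i ω
      simp only [Set.mem_Icc] at *
      constructor <;> linarith) (-m) (fun i => by rw [integral_neg, hm])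
  have hsub : {ω | τ < |(∑ i ∈ Finset.range R, X i ω) / R - m|} ⊆
      {ω | R * τ ≤ ∑ i ∈ Finset.range R, (X i ω - m)} ∪
        {ω | R * τ ≤ ∑ i ∈ Finset.range R, (-X i ω - -m)} := by
    intro ω hω
    simp only [Set.mem_ofPred_eq, Set.mem_union, Finset.sum_sub_distrib, Finset.sum_const,
      Finset.card_range, Finset.sum_neg_distrib, nsmul_eq_mul] at *
    set S := ∑ i ∈ Finset.range R, X i ω
    have hS : R * (S / R) = S := by field_simp
    rcases lt_abs.mp hω with h | h
    · left
      have := mul_lt_mul_of_pos_left h hR0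
      rw [mul_sub, hS] at this
      linarith
    · right
      have := mul_lt_mul_of_pos_left h hR0
      rw [mul_neg, mul_sub, hS] at this
      linarith
  refine (measure_mono hsub).trans ((measure_union_le _ _).trans ((add_le_add h1 h2).trans ?_))
  rw [← ENNReal.ofReal_add (Real.exp_nonneg _) (Real.exp_nonneg _), two_mul]

/-- The measurement outcome that the random number `u` determines, for an expectation value `r`. -/
noncomputable def signOutcome (u : unitInterval) (r : ℝ) : ℝ :=
  open Classical in if (u : ℝ) < (1 + r) / 2 then 1 else -1

/-- The average of the outcomes number `j R, …, j R + R - 1`. -/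
noncomputable def valueEstimate (R j : ℕ) (u : ℕ → unitInterval) (r : ℝ) : ℝ :=
  (∑ t ∈ Finset.range R, signOutcome (u (j * R + t)) r) / R

/-- The empirical mean of the Bloch vectors of the site `i` in the first `R` examples. -/
noncomputable def meanEstimate {n : ℕ} (R : ℕ) (y : ℕ → Fin n → BlochSphere) (i : Fin n)
    (p : Fin 3) : ℝ :=
  (∑ t ∈ Finset.range R, bloch (y t i) p) / R

theorem measurable_signOutcome : Measurable fun z : unitInterval × ℝ => signOutcome z.1 z.2 := by
  classical
  unfold signOutcome
  refine Measurable.ite ?_ measurable_const measurable_const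
  exact measurableSet_lt (by fun_prop) (by fun_prop)

theorem signOutcome_mem (u : unitInterval) (r : ℝ) : signOutcome u r ∈ Set.Icc (-1 : ℝ) 1 := by
  unfold signOutcome
  split_ifs <;> norm_num

theorem integral_signOutcome {r : ℝ} (hr : |r| ≤ 1) :
    ∫ u, signOutcome u r ∂(volume : Measure unitInterval) = r := by
  classical
  have h := abs_le.mp hr
  set b : unitInterval := ⟨(1 + r) / 2, by constructor <;> linarith⟩ with hb
  have h1 : ∀ u : unitInterval, signOutcome u r =
      2 * Set.indicator (Set.Iio b) (fun _ => (1 : ℝ)) u - 1 := by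
    intro u
    have : u ∈ Set.Iio b ↔ (u : ℝ) < (1 + r) / 2 := Iff.rfl
    simp only [signOutcome, Set.indicator_apply, this]
    split_ifs <;> norm_num
  simp only [h1]
  rw [integral_sub ((integrable_indicator_iff measurableSet_Iio).mpr
    (integrable_const _).integrableOn |>.const_mul 2) (integrable_const _), integral_const_mul,
    integral_indicator measurableSet_Iio, setIntegral_const, Measure.real,
    unitInterval.volume_Iio, ENNReal.toReal_ofReal b.2.1]
  simp [hb]
  ring

theorem meanEstimate_sq_le {n R : ℕ} (y : ℕ → Fin n → BlochSphere) (i : Fin n) :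
    ∑ p, meanEstimate R y i p ^ 2 ≤ 1 := by
  have h : ∀ p, meanEstimate R y i p ^ 2 ≤ (∑ t ∈ Finset.range R, bloch (y t i) p ^ 2) / R := by
    intro p
    rcases R.eq_zero_or_pos with rfl | hR
    · simp [meanEstimate]
    · have hR0 : (0 : ℝ) < R := by exact_mod_cast hR
      have := sq_sum_le_card_mul_sum_sq (s := Finset.range R) (f := fun t => bloch (y t i) p)
      rw [Finset.card_range] at this
      rw [meanEstimate, div_pow, div_le_div_iff₀ (by positivity) hR0]
      nlinarith
  refine (Finset.sum_le_sum fun p _ => h p).trans ?_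
  rw [← Finset.sum_div, Finset.sum_comm]
  simp only [sum_bloch_sq]
  simp
  exact div_self_le_one _

theorem integral_infinitePi_eval {Ω : Type*} [MeasurableSpace Ω] (P : Measure Ω)
    [IsProbabilityMeasure P] (t : ℕ) {f : Ω → ℝ} (hf : Measurable f) :
    ∫ y : ℕ → Ω, f (y t) ∂(Measure.infinitePi fun _ => P) = ∫ z, f z ∂P := by
  have h := (measurePreserving_eval_infinitePi (fun _ : ℕ => P) t).map_eq
  conv_rhs => rw [← h]
  rw [integral_map (measurable_pi_apply t).aemeasurable hf.aestronglyMeasurable]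

section
variable {n : ℕ} (D : Measure BlochSphere) [IsProbabilityMeasure D]

theorem meanEstimate_concentration (i : Fin n) (p : Fin 3) {R : ℕ} (hR : 1 ≤ R) {τ : ℝ}
    (hτ : 0 ≤ τ) :
    (Measure.infinitePi fun _ : ℕ => Measure.pi fun _ : Fin n => D)
      {y | τ < |meanEstimate R y i p - meanBloch D p|} ≤
      ENNReal.ofReal (2 * Real.exp (-(R * τ ^ 2 / 2))) := by
  have hX : Measurable fun z : Fin n → BlochSphere => bloch (z i) p :=
    (measurable_bloch p).comp (measurable_pi_apply i)
  have hm : ∀ t : ℕ, ∫ y : ℕ → Fin n → BlochSphere, bloch (y t i) p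
      ∂(Measure.infinitePi fun _ : ℕ => Measure.pi fun _ : Fin n => D) = meanBloch D p := by
    intro t
    rw [integral_infinitePi_eval (Measure.pi fun _ : Fin n => D) t hX]
    have h := (measurePreserving_eval (fun _ : Fin n => D) i).map_eq
    rw [meanBloch]
    conv_rhs => rw [← h]
    rw [integral_map (measurable_pi_apply i).aemeasurable
      (measurable_bloch p).aestronglyMeasurable]
  have hi := ProbabilityTheory.iIndepFun_infinitePi
    (P := fun _ : ℕ => Measure.pi fun _ : Fin n => D) (X := fun _ z => bloch (z i) p) fun _ => hX
  have h := hoeffding_mean hi (fun t => hX.comp (measurable_pi_apply t))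
    (fun t y => abs_le.mp (abs_bloch_le _ _)) hm hR hτ
  exact h

theorem valueEstimate_concentration {R : ℕ} (hR : 1 ≤ R) (j : ℕ) {r : ℝ} (hr : |r| ≤ 1) {τ : ℝ}
    (hτ : 0 ≤ τ) :
    (Measure.infinitePi fun _ : ℕ => (volume : Measure unitInterval))
      {u | τ < |valueEstimate R j u r - r|} ≤
      ENNReal.ofReal (2 * Real.exp (-(R * τ ^ 2 / 2))) := by
  have hX : Measurable fun u : unitInterval => signOutcome u r :=
    measurable_signOutcome.comp (measurable_id.prodMk measurable_const)
  have hm : ∀ t : ℕ, ∫ u : ℕ → unitInterval, signOutcome (u (j * R + t)) r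
      ∂(Measure.infinitePi fun _ : ℕ => (volume : Measure unitInterval)) = r := by
    intro t
    rw [integral_infinitePi_eval (volume : Measure unitInterval) (j * R + t) hX,
      integral_signOutcome hr]
  have hi := (ProbabilityTheory.iIndepFun_infinitePi
    (P := fun _ : ℕ => (volume : Measure unitInterval)) (X := fun _ z => signOutcome z r)
      fun _ => hX).precomp (add_right_injective (j * R))
  have h := hoeffding_mean hi (fun t => hX.comp (measurable_pi_apply _))
    (fun t y => signOutcome_mem _ _) hm hR hτ
  exact h

/-- With high probability the empirical mean and all value estimates are accurate. The values
that are estimated depend on the empirical mean, which is independent of the measurements. -/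
theorem estimates_concentration (i : Fin n) {R : ℕ} (hR : 1 ≤ R) {τ : ℝ} (hτ : 0 ≤ τ) (M : ℕ)
    (g : ℕ → (Fin 3 → ℝ) → ℝ) (hgm : ∀ j, Measurable (g j))
    (hg : ∀ j (y : ℕ → Fin n → BlochSphere), |g j (meanEstimate R y i)| ≤ 1) :
    randomnessLaw n D {ω | ¬ ((∀ p, |meanEstimate R ω.1 i p - meanBloch D p| ≤ τ) ∧
      ∀ j < M, |valueEstimate R j ω.2 (g j (meanEstimate R ω.1 i)) -
        g j (meanEstimate R ω.1 i)| ≤ τ)} ≤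
      ENNReal.ofReal ((3 + M) * (2 * Real.exp (-(R * τ ^ 2 / 2)))) := by
  set B := ENNReal.ofReal (2 * Real.exp (-(R * τ ^ 2 / 2))) with hB
  have hmean : ∀ p, Measurable fun y : ℕ → Fin n → BlochSphere => meanEstimate R y i p := by
    intro p
    unfold meanEstimate
    refine Measurable.div_const (Finset.measurable_sum _ fun t _ => ?_) _
    exact (measurable_bloch p).comp ((measurable_pi_apply i).comp (measurable_pi_apply t))
  have h1 : ∀ p, randomnessLaw n D {ω | τ < |meanEstimate R ω.1 i p - meanBloch D p|} ≤ B := by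
    intro p
    have h := meanEstimate_concentration D i p hR hτ
    have hset : {ω : Randomness n | τ < |meanEstimate R ω.1 i p - meanBloch D p|} =
        {y | τ < |meanEstimate R y i p - meanBloch D p|} ×ˢ Set.univ := by
      ext ω; simp
    rw [hset, randomnessLaw, Measure.prod_prod, measure_univ, mul_one]
    exact h
  have h2 : ∀ j, randomnessLaw n D {ω | τ < |valueEstimate R j ω.2 (g j (meanEstimate R ω.1 i)) -
      g j (meanEstimate R ω.1 i)|} ≤ B := by
    intro j
    have hgm' : Measurable fun ω : Randomness n => g j (meanEstimate R ω.1 i) :=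
      (hgm j).comp ((measurable_pi_lambda _ fun p => hmean p).comp measurable_fst)
    have hv : Measurable fun ω : Randomness n =>
        valueEstimate R j ω.2 (g j (meanEstimate R ω.1 i)) := by
      unfold valueEstimate
      refine Measurable.div_const (Finset.measurable_sum _ fun t _ => ?_) _
      have hu : Measurable fun ω : Randomness n => ω.2 (j * R + t) :=
        (measurable_pi_apply (j * R + t)).comp measurable_snd
      exact measurable_signOutcome.comp (hu.prodMk hgm')
    have hS : MeasurableSet {ω : Randomness n |
        τ < |valueEstimate R j ω.2 (g j (meanEstimate R ω.1 i)) -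
          g j (meanEstimate R ω.1 i)|} :=
      measurableSet_lt measurable_const (hv.sub hgm').abs
    rw [randomnessLaw]
    -- condition on the examples, which fix the value to be estimated
    refine (Measure.prod_apply_le hS).trans ?_
    refine (lintegral_mono fun y => valueEstimate_concentration hR j (hg j y) hτ).trans ?_
    simp [hB]
  have hsub : {ω : Randomness n | ¬ ((∀ p, |meanEstimate R ω.1 i p - meanBloch D p| ≤ τ) ∧
      ∀ j < M, |valueEstimate R j ω.2 (g j (meanEstimate R ω.1 i)) -
        g j (meanEstimate R ω.1 i)| ≤ τ)} ⊆
      (⋃ p ∈ (Finset.univ : Finset (Fin 3)),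
        {ω | τ < |meanEstimate R ω.1 i p - meanBloch D p|}) ∪
      ⋃ j ∈ Finset.range M, {ω | τ < |valueEstimate R j ω.2 (g j (meanEstimate R ω.1 i)) -
        g j (meanEstimate R ω.1 i)|} := by
    intro ω hω
    simp only [Set.mem_ofPred_eq, not_and_or, not_forall, not_le] at hω
    simp only [Set.mem_union, Set.mem_iUnion, Finset.mem_univ, Finset.mem_range,
      Set.mem_ofPred_eq]
    rcases hω with ⟨p, hp⟩ | ⟨j, hj, h⟩
    · exact Or.inl ⟨p, trivial, hp⟩
    · exact Or.inr ⟨j, hj, h⟩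
  refine (measure_mono hsub).trans ((measure_union_le _ _).trans ?_)
  refine (add_le_add ((measure_biUnion_finset_le _ _).trans (Finset.sum_le_sum fun p _ => h1 p))
    ((measure_biUnion_finset_le _ _).trans (Finset.sum_le_sum fun j _ => h2 j))).trans ?_
  rw [Finset.sum_const, Finset.sum_const, ← add_smul, hB, nsmul_eq_mul, Finset.card_univ,
    Fintype.card_fin, Finset.card_range, ENNReal.ofReal_mul (p := 3 + (M : ℝ)) (by positivity)]
  refine mul_le_mul' (le_of_eq ?_) le_rfl
  rw [← ENNReal.ofReal_natCast]
  push_cast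
  rfl

end

/-! ### Reasoning about machine runs -/

/-- From `s` the program `c` halts within `T` steps in a state satisfying `Q`. -/
def Runs {n : ℕ} (w : World n) (inp : ℕ → ℝ) (c : Prog) (T : ℕ) (s : State)
    (Q : State → Prop) : Prop :=
  ∃ (t : ℕ) (s' : State), Exec w inp c s t s' ∧ t ≤ T ∧ Q s'

/-- Straight-line programs: no branching, no loops, no oracle. -/
def Prog.straight : Prog → Bool
  | .skip => true
  | .setNat _ _ => true
  | .setReal _ _ => true
  | .seq c d => c.straight && d.straight
  | _ => false

/-- The effect of a straight-line program. -/
noncomputable def Prog.run (inp : ℕ → ℝ) : Prog → State → State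
  | .setNat a e, s => { s with nat := Function.update s.nat (a.eval s) (e.eval s) }
  | .setReal a e, s => { s with real := Function.update s.real (a.eval s) (e.eval inp s) }
  | .seq c d, s => d.run inp (c.run inp s)
  | _, s => s

/-- The running time of a straight-line program. -/
def Prog.time : Prog → ℕ
  | .skip => 1
  | .setNat a e => a.cost + e.cost + 1
  | .setReal a e => a.cost + e.cost + 1
  | .seq c d => c.time + d.time
  | _ => 0

section
variable {n : ℕ} {w : World n} {inp : ℕ → ℝ}

theorem exec_straight {c : Prog} (hc : c.straight = true) (s : State) :
    Exec w inp c s c.time (c.run inp s) := by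
  induction c generalizing s with
  | skip => exact Exec.skip s
  | setNat a e => exact Exec.setNat a e s
  | setReal a e => exact Exec.setReal a e s
  | seq c d ihc ihd =>
    simp only [Prog.straight, Bool.and_eq_true] at hc
    exact Exec.seq (ihc hc.1 s) (ihd hc.2 _)
  | ite => simp [Prog.straight] at hc
  | loop => simp [Prog.straight] at hc
  | draw => simp [Prog.straight] at hc
  | query => simp [Prog.straight] at hc

theorem Runs.straight {c : Prog} {T : ℕ} {s : State} {Q : State → Prop}
    (hc : c.straight = true) (hT : c.time ≤ T) (hQ : Q (c.run inp s)) : Runs w inp c T s Q :=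
  ⟨_, _, exec_straight hc s, hT, hQ⟩

theorem Runs.seq {c d : Prog} {T₁ T₂ : ℕ} {s : State} {Q : State → Prop}
    (h : Runs w inp c T₁ s fun s₁ => Runs w inp d T₂ s₁ Q) :
    Runs w inp (.seq c d) (T₁ + T₂) s Q := by
  obtain ⟨t₁, s₁, e₁, ht₁, t₂, s₂, e₂, ht₂, hQ⟩ := h
  exact ⟨_, _, Exec.seq e₁ e₂, add_le_add ht₁ ht₂, hQ⟩

theorem Runs.mono {c : Prog} {T T' : ℕ} {s : State} {Q Q' : State → Prop}
    (h : Runs w inp c T s Q) (hT : T ≤ T') (hQ : ∀ s', Q s' → Q' s') :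
    Runs w inp c T' s Q' := by
  obtain ⟨t, s', e, ht, hs⟩ := h
  exact ⟨t, s', e, ht.trans hT, hQ _ hs⟩

theorem Runs.ite {b : BExp} {c d : Prog} {T : ℕ} {s : State} {Q : State → Prop}
    (hc : b.Holds inp s → Runs w inp c T s Q) (hd : ¬ b.Holds inp s → Runs w inp d T s Q) :
    Runs w inp (.ite b c d) (b.cost + 1 + T) s Q := by
  by_cases hb : b.Holds inp s
  · obtain ⟨t, s', e, ht, hs⟩ := hc hb
    exact ⟨_, s', Exec.iteTrue hb e, by omega, hs⟩
  · obtain ⟨t, s', e, ht, hs⟩ := hd hb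
    exact ⟨_, s', Exec.iteFalse hb e, by omega, hs⟩

/-- Total correctness of a loop, from an invariant `I` and a variant `V` that decreases in each
round. -/
theorem Runs.loop {b : BExp} {c : Prog} {T : ℕ} (I : State → Prop) (V : State → ℕ)
    (hstep : ∀ s, I s → b.Holds inp s → Runs w inp c T s fun s' => I s' ∧ V s' < V s)
    {s : State} (hs : I s) :
    Runs w inp (.loop b c) (V s * (b.cost + 1 + T) + (b.cost + 1)) s
      fun s' => I s' ∧ ¬ b.Holds inp s' := by
  induction hv : V s using Nat.strong_induction_on generalizing s with
  | _ v ih =>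
    by_cases hb : b.Holds inp s
    · obtain ⟨t₁, s₁, e₁, ht₁, hI, hlt⟩ := hstep s hs hb
      obtain ⟨t₂, s₂, e₂, ht₂, hQ⟩ := ih (V s₁) (hv ▸ hlt) hI rfl
      refine ⟨_, s₂, Exec.loopStep hb e₁ e₂, ?_, hQ⟩
      have : (V s₁ + 1) * (b.cost + 1 + T) ≤ v * (b.cost + 1 + T) :=
        Nat.mul_le_mul_right _ (by omega)
      rw [add_mul, one_mul] at this
      omega
    · exact ⟨_, s, Exec.loopDone hb, by omega, hs, hb⟩

theorem Runs.draw {a : NExp} {s : State} {Q : State → Prop}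
    (hQ : Q { s with
      real := writeExample (w.random.1 s.drawn) (a.eval s) s.real
      drawn := s.drawn + 1 }) :
    Runs w inp (.draw a) (a.cost + 3 * n + 1) s Q :=
  ⟨_, _, Exec.draw a s, le_rfl, hQ⟩

theorem Runs.query {a b : NExp} {s : State} {Q : State → Prop}
    (hv : ∀ i : Fin n, ∑ p, readBloch s.real (a.eval s) i p ^ 2 ≤ 1)
    (hQ : Q { s with
      real := Function.update s.real (b.eval s) (w.outcome s.queried
        (tensorOp fun i : Fin n => qubitState (readBloch s.real (a.eval s) i)))
      queried := s.queried + 1 }) :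
    Runs w inp (.query a b) (a.cost + b.cost + 3 * n + 1) s Q :=
  ⟨_, _, Exec.query a b s hv, le_rfl, hQ⟩

end

/-! ### The learning and the prediction program

Natural-number cells: `0` holds `n`, `1` the degree `k`, `2` the number of table entries, `3` a
site, `4` an entry, `5` the number of entries before the current site, `6` the number of
repetitions made, `8` the address of the probe state, `9` an entry; the table starts at `16`, with
three cells (parent, marked site, weight) per entry. Real cells: `0` is an accumulator, `1, 2, 3`
hold the mean Bloch vector, `4` the number of repetitions, `5, 6, 7` are temporary; the table starts
at `16`, with five cells (marking direction, estimated value, interpolation coefficient) per entry,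
and is followed by the probe state. -/

/-- The natural-number cell `r`. -/
def reg (r : ℕ) : NExp := .get (.lit r)

/-- The real cell `r`. -/
def rreg (r : ℕ) : RExp := .get (.lit r)

/-- The address of the `o`-th natural number of the table entry `e`. -/
def natAddr (e : NExp) (o : ℕ) : NExp := .add (.lit (16 + o)) (.add e (.add e e))

/-- The address of the `o`-th real number of the table entry `e`. -/
def realAddr (e : NExp) (o : ℕ) : NExp :=
  .add (.lit (16 + o)) (.add e (.add e (.add e (.add e e))))

/-- The address of the coordinate `p` of the site `i` in the probe state. -/
def probeAddr (i : NExp) (p : ℕ) : NExp := .add (.add (reg 8) (.lit p)) (.add i (.add i i))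

/-- Execute programs one after the other. -/
def block : List Prog → Prog
  | [] => .skip
  | [c] => c
  | c :: l => .seq c (block l)

/-- The unit vector of a direction, as rational numbers. -/
def dirRat (d : Dir) (p : Fin 3) : ℚ := if p = d.1 then (if d.2 then 1 else -1) else 0

/-- Compute the degree: the least `k ≤ n` with `(1 + η/8)^k ≥ 4/ε`, or `n` if there is none. -/
def degreeProg : Prog :=
  block [.setReal (.lit 5) (.lit 1),
    .loop (.and (.natLt (reg 1) (reg 0)) (.realLt (rreg 5) (.div (.lit 4) (.input (.lit 0)))))
      (block [.setReal (.lit 5) (.mul (rreg 5) (.add (.lit 1) (.div (.input (.lit 2)) (.lit 8)))),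
        .setNat (.lit 1) (.add (reg 1) (.lit 1))])]

/-- Append to the table the pattern that extends the entry in cell `4` by the mark `d` at the site
in cell `3`. -/
def appendProg (d : Dir) : Prog :=
  block [.setNat (natAddr (reg 2) 0) (reg 4),
    .setNat (natAddr (reg 2) 1) (reg 3),
    .setNat (natAddr (reg 2) 2) (.add (.get (natAddr (reg 4) 2)) (.lit 1)),
    .setReal (realAddr (reg 2) 0) (.lit (dirRat d 0)),
    .setReal (realAddr (reg 2) 1) (.lit (dirRat d 1)),
    .setReal (realAddr (reg 2) 2) (.lit (dirRat d 2)),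
    .setNat (.lit 2) (.add (reg 2) (.lit 1))]

/-- All directions. -/
def dirs : List Dir :=
  [(0, false), (0, true), (1, false), (1, true), (2, false), (2, true)]

/-- Extend the entry in cell `4`, if its weight allows it, in all directions. -/
def extendProg : Prog :=
  .seq (.ite (.natLt (.get (natAddr (reg 4) 2)) (reg 1)) (block (dirs.map appendProg)) .skip)
    (.setNat (.lit 4) (.add (reg 4) (.lit 1)))

/-- Build the table of all patterns of weight at most `k`, site by site. -/
def tableProg : Prog :=
  .seq (block [.setNat (.lit 2) (.lit 1), .setNat (.lit 3) (.lit 0)])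
    (.loop (.natLt (reg 3) (reg 0))
      (.seq (block [.setNat (.lit 5) (reg 2), .setNat (.lit 4) (.lit 0)])
        (.seq (.loop (.natLt (reg 4) (reg 5)) extendProg)
          (.setNat (.lit 3) (.add (reg 3) (.lit 1))))))

/-- Compute the number of repetitions `512 M⁴ J / ε`, with `J` such that `2^J ≥ 8 M / δ`. -/
def repetitionProg : Prog :=
  .seq (block [.setReal (.lit 5) (.div (.input (.lit 1)) (.mul (.lit 8) (.ofNat (reg 2)))),
      .setReal (.lit 6) (.lit 0)])
    (.seq (.loop (.realLt (rreg 5) (.lit 1))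
        (block [.setReal (.lit 5) (.add (rreg 5) (rreg 5)),
          .setReal (.lit 6) (.add (rreg 6) (.lit 1))]))
      (block [.setReal (.lit 4) (.div (.mul (.mul (.lit 512)
          (.mul (.mul (.ofNat (reg 2)) (.ofNat (reg 2)))
            (.mul (.ofNat (reg 2)) (.ofNat (reg 2))))) (rreg 6)) (.input (.lit 0))),
        .setNat (.lit 8) (realAddr (reg 2) 0)]))

/-- Estimate the mean Bloch vector from the first site of fresh examples. -/
def meanProg : Prog :=
  .seq (block [.setReal (.lit 1) (.lit 0), .setReal (.lit 2) (.lit 0), .setReal (.lit 3) (.lit 0),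
      .setNat (.lit 6) (.lit 0)])
    (.seq (.loop (.realLt (.ofNat (reg 6)) (rreg 4))
        (.seq (.draw (reg 8))
          (block [.setReal (.lit 1) (.add (rreg 1) (.get (reg 8))),
            .setReal (.lit 2) (.add (rreg 2) (.get (.add (reg 8) (.lit 1)))),
            .setReal (.lit 3) (.add (rreg 3) (.get (.add (reg 8) (.lit 2)))),
            .setNat (.lit 6) (.add (reg 6) (.lit 1))])))
      (block [.setReal (.lit 1) (.div (rreg 1) (.ofNat (reg 6))),
        .setReal (.lit 2) (.div (rreg 2) (.ofNat (reg 6))),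
        .setReal (.lit 3) (.div (rreg 3) (.ofNat (reg 6)))]))

/-- Write the mean Bloch vector to all sites of the probe state. -/
def fillProg : Prog :=
  .seq (.setNat (.lit 3) (.lit 0))
    (.loop (.natLt (reg 3) (reg 0))
      (block [.setReal (probeAddr (reg 3) 0) (rreg 1),
        .setReal (probeAddr (reg 3) 1) (rreg 2),
        .setReal (probeAddr (reg 3) 2) (rreg 3),
        .setNat (.lit 3) (.add (reg 3) (.lit 1))]))

/-- Write the marks of the entry in cell `4` to the probe state, following the parents. -/
def markProg : Prog :=
  .seq (.setNat (.lit 9) (reg 4))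
    (.loop (.natLt (.lit 0) (reg 9))
      (block [.setReal (probeAddr (.get (natAddr (reg 9) 1)) 0) (.get (realAddr (reg 9) 0)),
        .setReal (probeAddr (.get (natAddr (reg 9) 1)) 1) (.get (realAddr (reg 9) 1)),
        .setReal (probeAddr (.get (natAddr (reg 9) 1)) 2) (.get (realAddr (reg 9) 2)),
        .setNat (.lit 9) (.get (natAddr (reg 9) 0))]))

/-- Average the outcomes of repeated measurements on the probe state. -/
def measureProg : Prog :=
  .seq (block [.setNat (.lit 6) (.lit 0), .setReal (.lit 0) (.lit 0)])
    (.seq (.loop (.realLt (.ofNat (reg 6)) (rreg 4))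
        (.seq (.query (reg 8) (.lit 7))
          (block [.setReal (.lit 0) (.add (rreg 0) (rreg 7)),
            .setNat (.lit 6) (.add (reg 6) (.lit 1))])))
      (block [.setReal (realAddr (reg 4) 3) (.div (rreg 0) (.ofNat (reg 6))),
        .setNat (.lit 4) (.add (reg 4) (.lit 1))]))

/-- Estimate the values at all probe states. -/
def valuesProg : Prog :=
  .seq (.setNat (.lit 4) (.lit 0))
    (.loop (.natLt (reg 4) (reg 2)) (.seq fillProg (.seq markProg measureProg)))

/-- The learning program. -/
def learnProg : Prog :=
  .seq degreeProg (.seq tableProg (.seq repetitionProg (.seq meanProg valuesProg)))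

/-- One term of `d · (x - ν)` at the site of the entry in cell `4`, for the coordinate `p`. -/
def coeffTerm (p : ℕ) : RExp :=
  .mul (.get (realAddr (reg 4) p))
    (.sub (.input (.add (.lit p) (.add (.get (natAddr (reg 4) 1))
      (.add (.get (natAddr (reg 4) 1)) (.get (natAddr (reg 4) 1)))))) (rreg (p + 1)))

/-- The prediction program: the interpolation formula, with the coefficient of each pattern computed
from that of its parent. -/
def predictProg : Prog :=
  .seq (block [.setNat (.lit 4) (.lit 1), .setReal (.lit 0) (.get (.lit 19)),
      .setReal (.lit 20) (.lit 1)])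
    (.loop (.natLt (reg 4) (reg 2))
      (block [.setReal (realAddr (reg 4) 4)
          (.mul (.get (realAddr (.get (natAddr (reg 4) 0)) 4))
            (.div (.add (.add (coeffTerm 0) (coeffTerm 1)) (coeffTerm 2)) (.lit 2))),
        .setReal (.lit 0) (.add (rreg 0)
          (.mul (.get (realAddr (reg 4) 4)) (.get (realAddr (reg 4) 3)))),
        .setNat (.lit 4) (.add (reg 4) (.lit 1))]))

theorem predictProg_oracleFree : predictProg.OracleFree := by
  simp [predictProg, block, Prog.OracleFree]

section
variable (s : State)

@[simp] theorem reg_eval (r : ℕ) : (reg r).eval s = s.nat r := rfl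

@[simp] theorem rreg_eval (inp : ℕ → ℝ) (r : ℕ) : (rreg r).eval inp s = s.real r := rfl

@[simp] theorem natAddr_eval (e : NExp) (o : ℕ) :
    (natAddr e o).eval s = 16 + 3 * e.eval s + o := by
  simp only [natAddr, NExp.eval]; ring

@[simp] theorem realAddr_eval (e : NExp) (o : ℕ) :
    (realAddr e o).eval s = 16 + 5 * e.eval s + o := by
  simp only [realAddr, NExp.eval]; ring

@[simp] theorem probeAddr_eval (i : NExp) (p : ℕ) :
    (probeAddr i p).eval s = s.nat 8 + 3 * i.eval s + p := by
  simp only [probeAddr, NExp.eval, reg_eval]; ring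

end

/-! ### The degree -/

section
variable {n : ℕ} {w : World n}

/-- The second bound on the power says that `k` is minimal. Here and below, the numerals in time
bounds are generous bounds for the costs of straight-line parts. -/
theorem degreeProg_runs (hn : 1 ≤ n) {ε δ η : ℝ} (hε : ε ∈ Set.Ioo (0 : ℝ) 1) {s : State}
    (hs0 : s.nat 0 = n) (hs1 : s.nat 1 = 0) :
    Runs w (paramInput ε δ η) degreeProg (42 * n + 30) s fun s' =>
      s'.nat 0 = n ∧ 1 ≤ s'.nat 1 ∧ s'.nat 1 ≤ n ∧
      (n ≤ s'.nat 1 ∨ 4 / ε ≤ (1 + η / 8) ^ s'.nat 1) ∧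
      (1 + η / 8) ^ (s'.nat 1 - 1) < 4 / ε ∧ s'.nat 18 = s.nat 18 ∧ s'.drawn = s.drawn ∧
      s'.queried = s.queried := by
  have h4 : (1 : ℝ) < 4 / ε := by
    rw [lt_div_iff₀ hε.1]
    linarith [hε.2]
  refine Runs.mono (T := 10 + (n * (13 + 1 + 28) + 20))
    (Runs.seq (Runs.straight rfl (by decide) ?_)) (by omega) fun s' h => h
  refine Runs.mono (Runs.loop (T := 28) (fun s' => s'.nat 0 = n ∧ s'.nat 1 ≤ n ∧
    s'.real 5 = (1 + η / 8) ^ s'.nat 1 ∧ (1 + η / 8) ^ (s'.nat 1 - 1) < 4 / ε ∧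
    s'.nat 18 = s.nat 18 ∧ s'.drawn = s.drawn ∧ s'.queried = s.queried)
    (fun s' => n - s'.nat 1) ?_ ?_) ?_ ?_
  · rintro s' ⟨h0, h1, h5, h6, h9, h7, h8⟩ hb
    simp [BExp.Holds, RExp.eval, NExp.eval, paramInput, h0] at hb
    refine Runs.straight rfl (by decide) ?_
    simp [block, Prog.run, RExp.eval, NExp.eval, paramInput]
    refine ⟨⟨h0, by omega, by rw [h5]; ring, by rw [← h5]; exact hb.2, h9, h7, h8⟩, by omega⟩
  · simp [Prog.run, RExp.eval, NExp.eval, hs0, hs1, h4]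
  · simp [Prog.run, RExp.eval, NExp.eval, hs1]
    simp [BExp.cost, NExp.cost, RExp.cost, reg, rreg]
  · rintro s' ⟨⟨h0, h1, h5, h6, h9, h7, h8⟩, hb⟩
    simp only [BExp.Holds, RExp.eval, NExp.eval, paramInput, rreg_eval, reg_eval, h0, not_and,
      not_lt, Rat.cast_ofNat, if_true] at hb
    refine ⟨h0, ?_, h1, ?_, h6, h9, h7, h8⟩
    · by_contra hlt
      have h : s'.nat 1 = 0 := by omega
      rw [h, pow_zero] at h5
      have := hb (by omega)
      linarith
    · by_cases h : s'.nat 1 < n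
      · right
        rw [← h5]
        exact hb h
      · left
        omega

/-! ### The table of patterns -/

/-- The two memories hold the patterns `Q 0, …, Q (M - 1)`: the first one is empty, and every other
one extends an earlier one, its parent, by one mark. -/
structure IsTable (M : ℕ) (Q : ℕ → Pattern n) (nat : ℕ → ℕ) (real : ℕ → ℝ) : Prop where
  pos : 0 < M
  zero : Q 0 = fun _ => none
  weight : ∀ j < M, nat (16 + 3 * j + 2) = (Q j).weight
  entry : ∀ j < M, 0 < j → ∃ (d : Dir) (i : Fin n), nat (16 + 3 * j) < j ∧
    Q (nat (16 + 3 * j)) i = none ∧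
    Q j = Function.update (Q (nat (16 + 3 * j))) i (some d) ∧
    nat (16 + 3 * j + 1) = i ∧ ∀ p : Fin 3, real (16 + 5 * j + p) = dirVec d p

/-- The estimated values and the coefficients, in the cells `3` and `4` of each entry, do not
matter. -/
theorem IsTable.congr {M : ℕ} {Q : ℕ → Pattern n} {nat nat' : ℕ → ℕ} {real real' : ℕ → ℝ}
    (h : IsTable M Q nat real) (hnat : ∀ a, 16 ≤ a → nat' a = nat a)
    (hreal : ∀ j < M, ∀ p : Fin 3, real' (16 + 5 * j + p) = real (16 + 5 * j + p)) :
    IsTable M Q nat' real' where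
  pos := h.pos
  zero := h.zero
  weight j hj := by rw [hnat _ (by omega)]; exact h.weight j hj
  entry j hj hj0 := by
    obtain ⟨d, i, h1, h2, h3, h4, h5⟩ := h.entry j hj hj0
    rw [hnat _ (by omega), hnat _ (by omega)]
    exact ⟨d, i, h1, h2, h3, h4, fun p => by rw [hreal j hj]; exact h5 p⟩

theorem Pattern.weight_update {q : Pattern n} {i : Fin n} (hq : q i = none) (d : Dir) :
    Pattern.weight (Function.update q i (some d)) = q.weight + 1 := by
  unfold Pattern.weight
  rw [← Finset.card_insert_of_notMem (s := Finset.univ.filter fun i => q i ≠ none) (a := i)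
    (by simp [hq])]
  congr 1
  ext j
  by_cases hj : j = i
  · subst hj; simp
  · simp [hj]

theorem dirRat_cast (d : Dir) (p : Fin 3) : ((dirRat d p : ℚ) : ℝ) = dirVec d p := by
  simp only [dirRat, dirVec, Pi.single_apply]
  split_ifs <;> simp

theorem appendProg_runs {inp : ℕ → ℝ} {s : State} {M e : ℕ} {i : Fin n} {Q : ℕ → Pattern n}
    (hT : IsTable M Q s.nat s.real) (h2 : s.nat 2 = M) (h3 : s.nat 3 = i) (h4 : s.nat 4 = e)
    (he : e < M) (hq : Q e i = none) (d : Dir) :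
    Runs w inp (appendProg d) 120 s fun s' =>
      IsTable (M + 1) (Function.update Q M (Function.update (Q e) i (some d))) s'.nat s'.real ∧
      s'.nat 2 = M + 1 ∧ (∀ a < 16, a ≠ 2 → s'.nat a = s.nat a) ∧ s'.drawn = s.drawn ∧
      s'.queried = s.queried := by
  have hM := hT.pos
  refine Runs.straight rfl (by simp [appendProg, block, Prog.time, NExp.cost, RExp.cost, natAddr,
    realAddr, reg]) ?_
  simp only [appendProg, block, Prog.run, natAddr_eval, realAddr_eval, reg_eval, NExp.eval,
    RExp.eval, dirRat_cast, add_zero]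
  simp (disch := omega) only [Function.update_of_ne, Function.update_self, h2, h3, h4]
  -- what the memories have to satisfy for the longer table
  have key : ∀ {nat' : ℕ → ℕ} {real' : ℕ → ℝ},
      (∀ j < M, ∀ o < 3, nat' (16 + 3 * j + o) = s.nat (16 + 3 * j + o)) →
      (∀ j < M, ∀ p : Fin 3, real' (16 + 5 * j + p) = s.real (16 + 5 * j + p)) →
      nat' (16 + 3 * M) = e → nat' (16 + 3 * M + 1) = i →
      nat' (16 + 3 * M + 2) = (Q e).weight + 1 →
      (∀ p : Fin 3, real' (16 + 5 * M + p) = dirVec d p) →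
      IsTable (M + 1) (Function.update Q M (Function.update (Q e) i (some d))) nat' real' := by
    intro nat' real' hn hr e0 e1 e2 er
    constructor
    · omega
    · rw [Function.update_of_ne hM.ne]; exact hT.zero
    · intro j hj
      rcases Nat.lt_succ_iff_lt_or_eq.mp hj with hj | rfl
      · rw [Function.update_of_ne hj.ne, hn j hj 2 (by norm_num)]
        exact hT.weight j hj
      · rw [Function.update_self, e2, Pattern.weight_update hq]
    · intro j hj hj0
      rcases Nat.lt_succ_iff_lt_or_eq.mp hj with hj | rfl
      · obtain ⟨d', i', f1, f2, f3, f4, f5⟩ := hT.entry j hj hj0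
        have g0 := hn j hj 0 (by norm_num)
        rw [add_zero] at g0
        rw [g0, hn j hj 1 (by norm_num), Function.update_of_ne (by omega),
          Function.update_of_ne hj.ne]
        exact ⟨d', i', f1, f2, f3, f4, fun p => by rw [hr j hj]; exact f5 p⟩
      · rw [e0, Function.update_self, Function.update_of_ne he.ne]
        exact ⟨d, i, he, hq, rfl, e1, er⟩
  refine ⟨key ?_ ?_ ?_ ?_ ?_ ?_, trivial, ?_, trivial, trivial⟩
  · intro j hj o ho
    repeat rw [Function.update_of_ne (by omega)]
  · intro j hj p
    have := p.2
    repeat rw [Function.update_of_ne (by omega)]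
  · simp only [Function.update_apply]
    grind
  · simp only [Function.update_apply]
    grind
  · have := hT.weight e he
    simp only [Function.update_apply]
    grind
  · intro p
    simp only [Function.update_apply]
    fin_cases p <;> grind
  · intro a ha ha2
    simp (disch := omega) only [Function.update_of_ne]

/-- Appending the extensions of the entry `e` in several directions. -/
theorem appendProgs_runs {inp : ℕ → ℝ} {e : ℕ} {i : Fin n} {q : Pattern n} (hq : q i = none)
    (l : List Dir) {s : State} {M : ℕ} {Q : ℕ → Pattern n}
    (hT : IsTable M Q s.nat s.real) (h2 : s.nat 2 = M) (h3 : s.nat 3 = i) (h4 : s.nat 4 = e)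
    (he : e < M) (hQ : Q e = q) :
    Runs w inp (block (l.map appendProg)) (120 * l.length + 1) s fun s' =>
      (∃ Q' : ℕ → Pattern n, IsTable (M + l.length) Q' s'.nat s'.real ∧ (∀ j < M, Q' j = Q j) ∧
        ∀ Φ : Pattern n → ℝ, ∑ j ∈ Finset.range (M + l.length), Φ (Q' j) =
          ∑ j ∈ Finset.range M, Φ (Q j) +
            (l.map fun d => Φ (Function.update q i (some d))).sum) ∧
      s'.nat 2 = M + l.length ∧ (∀ a < 16, a ≠ 2 → s'.nat a = s.nat a) ∧
      s'.drawn = s.drawn ∧ s'.queried = s.queried := by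
  induction l generalizing s M Q with
  | nil =>
    refine Runs.straight rfl le_rfl ?_
    exact ⟨⟨Q, hT, fun _ _ => rfl, by simp⟩, h2, fun _ _ _ => rfl, rfl, rfl⟩
  | cons d l ih =>
    have hd := appendProg_runs (w := w) (inp := inp) hT h2 h3 h4 he (hQ ▸ hq) d
    rw [hQ] at hd
    set Q₁ := Function.update Q M (Function.update q i (some d)) with hQ₁
    have hQ₁Q : ∀ j < M, Q₁ j = Q j := fun j hj => Function.update_of_ne hj.ne _ _
    have hsum : ∀ Φ : Pattern n → ℝ, ∑ j ∈ Finset.range (M + 1), Φ (Q₁ j) =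
        ∑ j ∈ Finset.range M, Φ (Q j) + Φ (Function.update q i (some d)) := by
      intro Φ
      rw [Finset.sum_range_succ, Finset.sum_congr rfl fun j hj => by
        rw [hQ₁Q j (Finset.mem_range.mp hj)], hQ₁, Function.update_self]
    cases l with
    | nil =>
      refine hd.mono (by simp) ?_
      rintro s' ⟨g1, g2, g3, g4, g5⟩
      exact ⟨⟨Q₁, g1, hQ₁Q, fun Φ => by simpa using hsum Φ⟩, g2, g3, g4, g5⟩
    | cons d' l =>
      refine Runs.mono (T := 120 + (120 * (d' :: l).length + 1))
        (Runs.seq (hd.mono le_rfl fun s₁ hs₁ => ?_)) (by simp; omega) fun _ h => h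
      obtain ⟨g1, g2, g3, g4, g5⟩ := hs₁
      refine (ih g1 g2 ((g3 3 (by norm_num) (by norm_num)).trans h3)
        ((g3 4 (by norm_num) (by norm_num)).trans h4) (by omega)
        ((hQ₁Q e he).trans hQ)).mono le_rfl ?_
      rintro s' ⟨⟨Q', f1, f2, f3⟩, f4, f5, f6, f7⟩
      have hlen : M + (d :: d' :: l).length = M + 1 + (d' :: l).length := by
        rw [List.length_cons (a := d)]
        omega
      rw [hlen]
      refine ⟨⟨Q', f1, fun j hj => (f2 j (by omega)).trans (hQ₁Q j hj), fun Φ => ?_⟩, f4,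
        fun a ha ha2 => (f5 a ha ha2).trans (g3 a ha ha2), f6.trans g4, f7.trans g5⟩
      rw [f3, hsum, List.map_cons (a := d), List.sum_cons, add_assoc]

theorem sum_dirs_map (φ : Dir → ℝ) : (dirs.map φ).sum = ∑ d, φ d := by
  simp [dirs, Fintype.sum_prod_type, Fin.sum_univ_three]
  ring

/-- The patterns of weight at most `k` that mark only sites before `i`. -/
def earlyPatterns (n k i : ℕ) : Finset (Pattern n) :=
  Finset.univ.filter fun q => q.weight ≤ k ∧ ∀ i' : Fin n, i ≤ i' → q i' = none

theorem earlyPatterns_zero (k : ℕ) : earlyPatterns n k 0 = {fun _ => none} := by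
  ext q
  simp only [earlyPatterns, Finset.mem_filter, Finset.mem_univ, true_and, Finset.mem_singleton,
    zero_le, forall_const]
  constructor
  · rintro ⟨-, h⟩
    exact funext h
  · rintro rfl
    simp [Pattern.weight]

theorem earlyPatterns_self (k : ℕ) : earlyPatterns n k n = lowPatterns n k := by
  ext q
  simp only [earlyPatterns, lowPatterns, Finset.mem_filter, Finset.mem_univ, true_and,
    and_iff_left_iff_imp]
  intro _ i hi
  omega

theorem card_earlyPatterns_le (k i : ℕ) : (earlyPatterns n k i).card ≤ (lowPatterns n k).card :=
  Finset.card_le_card fun q hq => by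
    simp only [earlyPatterns, lowPatterns, Finset.mem_filter, Finset.mem_univ, true_and] at hq ⊢
    exact hq.1

/-- A pattern that marks only sites up to `i` either marks only sites before `i`, or extends such a
pattern of smaller weight by a mark at `i`. -/
theorem sum_earlyPatterns_succ (k : ℕ) (i : Fin n) (Φ : Pattern n → ℝ) :
    ∑ q ∈ earlyPatterns n k (i + 1), Φ q = ∑ q ∈ earlyPatterns n k i, Φ q +
      ∑ q ∈ earlyPatterns n k i,
        if q.weight < k then ∑ d, Φ (Function.update q i (some d)) else 0 := by
  classical
  rw [← Finset.sum_filter_add_sum_filter_not (earlyPatterns n k (i + 1)) fun q => q i = none]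
  congr 1
  · refine Finset.sum_congr ?_ fun _ _ => rfl
    ext q
    simp only [earlyPatterns, Finset.mem_filter, Finset.mem_univ, true_and]
    constructor
    · rintro ⟨⟨h1, h2⟩, h3⟩
      refine ⟨h1, fun i' hi' => ?_⟩
      by_cases h : i' = i
      · rw [h, h3]
      · exact h2 i' (by have := Fin.val_ne_of_ne h; omega)
    · rintro ⟨h1, h2⟩
      exact ⟨⟨h1, fun i' hi' => h2 i' (by omega)⟩, h2 i le_rfl⟩
  · rw [← Finset.sum_filter, ← Finset.sum_product']
    symm
    refine Finset.sum_bij (fun qd _ => Function.update qd.1 i (some qd.2)) ?_ ?_ ?_ fun _ _ => rfl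
    · rintro ⟨q, d⟩ h
      simp only [earlyPatterns, Finset.mem_product, Finset.mem_filter, Finset.mem_univ, true_and,
        and_true] at h ⊢
      obtain ⟨⟨h1, h2⟩, h3⟩ := h
      refine ⟨⟨?_, fun i' hi' => ?_⟩, by simp⟩
      · rw [Pattern.weight_update (h2 i le_rfl)]; exact h3
      · rw [Function.update_of_ne (fun h => by rw [h] at hi'; omega)]
        exact h2 i' (by omega)
    · rintro ⟨q, d⟩ h ⟨q', d'⟩ h' heq
      simp only [earlyPatterns, Finset.mem_product, Finset.mem_filter, Finset.mem_univ, true_and,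
        and_true] at h h' heq
      have hd : d = d' := by simpa using congrFun heq i
      have hq : q = q' := by
        ext1 j
        by_cases hj : j = i
        · rw [hj, h.1.2 i le_rfl, h'.1.2 i le_rfl]
        · simpa [Function.update_of_ne hj] using congrFun heq j
      rw [hd, hq]
    · intro q h
      simp only [earlyPatterns, Finset.mem_filter, Finset.mem_univ, true_and] at h
      obtain ⟨⟨h1, h2⟩, h3⟩ := h
      obtain ⟨d, hd⟩ := Option.ne_none_iff_exists'.mp h3
      have hback : Function.update (Function.update q i none) i (some d) = q := by
        rw [Function.update_idem, ← hd, Function.update_eq_self]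
      have hw := Pattern.weight_update (q := Function.update q i none) (i := i) (by simp) d
      rw [hback] at hw
      refine ⟨(Function.update q i none, d), ?_, hback⟩
      simp only [earlyPatterns, Finset.mem_product, Finset.mem_filter, Finset.mem_univ, true_and,
        and_true]
      refine ⟨⟨by omega, fun i' hi' => ?_⟩, by omega⟩
      by_cases h : i' = i
      · rw [h, Function.update_self]
      · rw [Function.update_of_ne h]
        exact h2 i' (by have := Fin.val_ne_of_ne h; omega)

end

section
variable {n : ℕ} {w : World n}

/-- The state while the entries `Q₀ 0, …, Q₀ (M₀ - 1)` are being extended at the site `i`: the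
extensions of the entries before the one in cell `4` have been appended. The contents of the table
are described by the sums of all functions over it; `dr` and `qu` count the oracle calls. -/
structure Extending (k M₀ : ℕ) (i : Fin n) (Q₀ : ℕ → Pattern n) (dr qu : ℕ) (s : State) :
    Prop where
  qubits : s.nat 0 = n
  degree : s.nat 1 = k
  site : s.nat 3 = i
  entry_le : s.nat 4 ≤ M₀
  bound : s.nat 5 = M₀
  drawn : s.drawn = dr
  queried : s.queried = qu
  le : M₀ ≤ s.nat 2
  table : ∃ Q : ℕ → Pattern n, IsTable (s.nat 2) Q s.nat s.real ∧ (∀ j < M₀, Q j = Q₀ j) ∧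
    ∀ Φ : Pattern n → ℝ, ∑ j ∈ Finset.range (s.nat 2), Φ (Q j) =
      ∑ j ∈ Finset.range M₀, Φ (Q₀ j) + ∑ j ∈ Finset.range (s.nat 4),
        if (Q₀ j).weight < k then ∑ d, Φ (Function.update (Q₀ j) i (some d)) else 0

theorem extendProg_runs {inp : ℕ → ℝ} {k M₀ : ℕ} {i : Fin n} {Q₀ : ℕ → Pattern n} {dr qu : ℕ}
    (hQ₀ : ∀ j < M₀, Q₀ j i = none) {s : State} (hs : Extending k M₀ i Q₀ dr qu s)
    (hlt : s.nat 4 < M₀) :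
    Runs w inp extendProg 800 s fun s' =>
      Extending k M₀ i Q₀ dr qu s' ∧ s'.nat 4 = s.nat 4 + 1 := by
  obtain ⟨Q, hT, hQ, hsum⟩ := hs.table
  have hle := hs.le
  refine Runs.mono (T := 14 + 1 + 721 + 10) (Runs.seq (Q := fun s' =>
    Extending k M₀ i Q₀ dr qu s' ∧ s'.nat 4 = s.nat 4 + 1) ?_) (by norm_num) fun _ h => h
  refine Runs.mono (Runs.ite (T := 721) (Q := fun s₁ => ∃ M' Q', IsTable M' Q' s₁.nat s₁.real ∧
    M₀ ≤ M' ∧ s₁.nat 2 = M' ∧ (∀ j < M₀, Q' j = Q₀ j) ∧ (∀ Φ : Pattern n → ℝ,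
      ∑ j ∈ Finset.range M', Φ (Q' j) =
      ∑ j ∈ Finset.range M₀, Φ (Q₀ j) + ∑ j ∈ Finset.range (s.nat 4 + 1),
        if (Q₀ j).weight < k then ∑ d, Φ (Function.update (Q₀ j) i (some d)) else 0) ∧
    (∀ a < 16, a ≠ 2 → s₁.nat a = s.nat a) ∧ s₁.drawn = s.drawn ∧ s₁.queried = s.queried)
    ?_ ?_) (by simp [BExp.cost, NExp.cost, natAddr, reg]) ?_
  · intro hb
    simp only [BExp.Holds, NExp.eval, natAddr_eval, reg_eval, hT.weight _ (hlt.trans_le hle),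
      hs.degree, hQ _ hlt] at hb
    refine (appendProgs_runs (hQ₀ _ hlt) dirs hT rfl hs.site rfl (hlt.trans_le hle)
      (hQ _ hlt)).mono (by simp [dirs]) ?_
    rintro s' ⟨⟨Q', f1, f2, f3⟩, f4, f5, f6, f7⟩
    refine ⟨_, Q', f1, by omega, f4, fun j hj => (f2 j (by omega)).trans (hQ j hj), fun Φ => ?_,
      f5, f6, f7⟩
    rw [f3, hsum, Finset.sum_range_succ, if_pos hb, sum_dirs_map, add_assoc]
  · intro hb
    simp only [BExp.Holds, NExp.eval, natAddr_eval, reg_eval, hT.weight _ (hlt.trans_le hle),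
      hs.degree, hQ _ hlt] at hb
    refine Runs.straight rfl (by decide) ?_
    refine ⟨_, Q, hT, hle, rfl, hQ, fun Φ => ?_, fun _ _ _ => rfl, rfl, rfl⟩
    rw [hsum, Finset.sum_range_succ, if_neg hb, add_zero]
  · rintro s' ⟨M', Q', f1, f2, f3, f4, f5, f6, f7, f8⟩
    subst f3
    have g4 := f6 4 (by norm_num) (by norm_num)
    refine Runs.straight rfl (by decide) ⟨⟨?_, ?_, ?_, ?_, ?_, ?_, ?_, ?_, Q', ?_, f4, ?_⟩, ?_⟩
    · simpa [Prog.run, NExp.eval] using (f6 0 (by norm_num) (by norm_num)).trans hs.qubits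
    · simpa [Prog.run, NExp.eval] using (f6 1 (by norm_num) (by norm_num)).trans hs.degree
    · simpa [Prog.run, NExp.eval] using (f6 3 (by norm_num) (by norm_num)).trans hs.site
    · simp [Prog.run, NExp.eval]; omega
    · simpa [Prog.run, NExp.eval] using (f6 5 (by norm_num) (by norm_num)).trans hs.bound
    · simpa [Prog.run] using f7.trans hs.drawn
    · simpa [Prog.run] using f8.trans hs.queried
    · simpa [Prog.run, NExp.eval] using f2
    · simp [Prog.run, NExp.eval]
      exact f1.congr (fun a ha => Function.update_of_ne (by omega) _ _) fun _ _ _ => rfl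
    · simpa [Prog.run, NExp.eval, g4] using f5
    · simp [Prog.run, NExp.eval, g4]

/-- The state while the table is built: all patterns are there that mark only sites before the one
in cell `3`. -/
structure Building (k dr qu : ℕ) (s : State) : Prop where
  qubits : s.nat 0 = n
  degree : s.nat 1 = k
  site_le : s.nat 3 ≤ n
  drawn : s.drawn = dr
  queried : s.queried = qu
  table : ∃ Q : ℕ → Pattern n, IsTable (s.nat 2) Q s.nat s.real ∧
    ∀ Φ : Pattern n → ℝ, ∑ j ∈ Finset.range (s.nat 2), Φ (Q j) =
      ∑ q ∈ earlyPatterns n k (s.nat 3), Φ q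

/-- Two enumerations with the same sums have the same members. -/
theorem mem_of_sum_eq {α : Type} {M : ℕ} {Q : ℕ → α} {S : Finset α}
    (h : ∀ Φ : α → ℝ, ∑ j ∈ Finset.range M, Φ (Q j) = ∑ q ∈ S, Φ q) {j : ℕ} (hj : j < M) :
    Q j ∈ S := by
  classical
  by_contra hmem
  have := h fun q => if q ∈ S then 0 else 1
  rw [Finset.sum_eq_zero (s := S) fun q hq => if_pos hq,
    Finset.sum_eq_zero_iff_of_nonneg fun j _ => by split_ifs <;> norm_num] at this
  simpa [hmem] using this j (Finset.mem_range.mpr hj)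

theorem card_of_sum_eq {α : Type} {M : ℕ} {Q : ℕ → α} {S : Finset α}
    (h : ∀ Φ : α → ℝ, ∑ j ∈ Finset.range M, Φ (Q j) = ∑ q ∈ S, Φ q) : M = S.card := by
  have := h fun _ => 1
  simpa using this

theorem tableProg_runs {inp : ℕ → ℝ} {k : ℕ} {s : State} (hs0 : s.nat 0 = n)
    (hs1 : s.nat 1 = k) (hs18 : s.nat 18 = 0) :
    Runs w inp tableProg (n * (820 * (lowPatterns n k).card + 50) + 30) s fun s' =>
      s'.nat 0 = n ∧ s'.nat 1 = k ∧ s'.drawn = s.drawn ∧ s'.queried = s.queried ∧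
      ∃ Q : ℕ → Pattern n, IsTable (s'.nat 2) Q s'.nat s'.real ∧
        ∀ Φ : Pattern n → ℝ, ∑ j ∈ Finset.range (s'.nat 2), Φ (Q j) =
          ∑ q ∈ lowPatterns n k, Φ q := by
  refine Runs.mono (T := 10 + (n * (5 + 1 + (820 * (lowPatterns n k).card + 40)) + 6))
    (Runs.seq (Runs.straight rfl (by decide) ?_)) (by
      have : n * (5 + 1 + (820 * (lowPatterns n k).card + 40)) ≤
        n * (820 * (lowPatterns n k).card + 50) := Nat.mul_le_mul_left _ (by omega)
      omega) fun _ h => h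
  refine Runs.mono (Runs.loop (T := 820 * (lowPatterns n k).card + 40)
    (Building (n := n) k s.drawn s.queried) (fun s' => n - s'.nat 3) ?_ ?_) ?_ ?_
  · intro s₁ h₁ hb
    simp only [BExp.Holds, reg_eval, h₁.qubits] at hb
    obtain ⟨Q₀, hT, hsum⟩ := h₁.table
    have hcard : s₁.nat 2 ≤ (lowPatterns n k).card := by
      rw [card_of_sum_eq hsum]
      exact card_earlyPatterns_le _ _
    have hnone : ∀ j < s₁.nat 2, Q₀ j ⟨s₁.nat 3, hb⟩ = none := fun j hj =>
      (Finset.mem_filter.mp (mem_of_sum_eq hsum hj)).2.2 _ le_rfl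
    refine Runs.mono (T := 10 + ((s₁.nat 2 * (5 + 1 + 800) + 6) + 10))
      (Runs.seq (Runs.straight rfl (by decide) ?_)) (by omega) fun _ h => h
    refine Runs.seq ?_
    refine Runs.mono (Runs.loop (T := 800) (Extending k (s₁.nat 2) ⟨s₁.nat 3, hb⟩ Q₀ s.drawn
      s.queried) (fun s' => s₁.nat 2 - s'.nat 4) ?_ ?_) ?_ ?_
    · intro s₂ h₂ hb₂
      simp only [BExp.Holds, reg_eval, h₂.bound] at hb₂
      refine (extendProg_runs hnone h₂ hb₂).mono le_rfl ?_
      rintro s₃ ⟨h₃, h4⟩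
      exact ⟨h₃, by omega⟩
    · refine ⟨?_, ?_, ?_, ?_, ?_, ?_, ?_, ?_, Q₀, ?_, fun _ _ => rfl, ?_⟩ <;>
        simp [block, Prog.run, NExp.eval, h₁.qubits, h₁.degree, h₁.drawn, h₁.queried]
      exact hT.congr (fun a ha => by simp (disch := omega) only [Function.update_of_ne])
        fun _ _ _ => rfl
    · simp [block, Prog.run, NExp.eval, BExp.cost, reg, NExp.cost]
    · rintro s₂ ⟨h₂, hb₂⟩
      simp only [BExp.Holds, reg_eval, h₂.bound, not_lt] at hb₂
      obtain ⟨Q, hT₂, hQ, hsum₂⟩ := h₂.table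
      have h4 : s₂.nat 4 = s₁.nat 2 := le_antisymm h₂.entry_le hb₂
      refine Runs.straight rfl (by decide) ⟨⟨?_, ?_, ?_, ?_, ?_, Q, ?_, ?_⟩, ?_⟩ <;>
        simp [Prog.run, NExp.eval, h₂.qubits, h₂.degree, h₂.drawn, h₂.queried, h₂.site]
      · omega
      · exact hT₂.congr (fun a ha => Function.update_of_ne (by omega) _ _) fun _ _ _ => rfl
      · intro Φ
        rw [hsum₂, h4, hsum, sum_earlyPatterns_succ k ⟨s₁.nat 3, hb⟩ Φ]
        congr 1
        exact hsum fun q => if q.weight < k then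
          ∑ d, Φ (Function.update q ⟨s₁.nat 3, hb⟩ (some d)) else 0
      · omega
  · refine ⟨?_, ?_, ?_, ?_, ?_, fun _ _ => none, ?_, ?_⟩ <;>
      simp [block, Prog.run, NExp.eval, hs0, hs1, earlyPatterns_zero]
    refine ⟨one_pos, rfl, fun j hj => ?_, fun j hj hj0 => by omega⟩
    obtain rfl : j = 0 := by omega
    simpa [Function.update_apply, Pattern.weight] using hs18
  · simp [block, Prog.run, NExp.eval, BExp.cost, reg, NExp.cost]
  · rintro s₂ ⟨h₂, hb₂⟩
    simp only [BExp.Holds, reg_eval, h₂.qubits, not_lt] at hb₂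
    have h3 : s₂.nat 3 = n := le_antisymm h₂.site_le hb₂
    obtain ⟨Q, hT, hsum⟩ := h₂.table
    rw [h3, earlyPatterns_self] at hsum
    exact ⟨h₂.qubits, h₂.degree, h₂.drawn, h₂.queried, Q, hT, hsum⟩

end

/-! ### The number of repetitions and the mean Bloch vector -/

section
variable {n : ℕ} {w : World n}

/-- The state when table and number of repetitions are ready. -/
structure Prepared (M : ℕ) (Q : ℕ → Pattern n) (N : ℝ) (s : State) : Prop where
  qubits : s.nat 0 = n
  entries : s.nat 2 = M
  base : s.nat 8 = 16 + 5 * M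
  repetitions : s.real 4 = N
  table : IsTable M Q s.nat s.real

/-- `J` is the least number with `2^J ≥ 8 M / δ`. -/
theorem repetitionProg_runs {ε δ η : ℝ} {M J : ℕ} {Q : ℕ → Pattern n} {s : State}
    (hs0 : s.nat 0 = n) (hs2 : s.nat 2 = M) (hT : IsTable M Q s.nat s.real)
    (hJ : 1 ≤ 2 ^ J * (δ / (8 * M))) (hJ' : ∀ j < J, 2 ^ j * (δ / (8 * M)) < 1) :
    Runs w (paramInput ε δ η) repetitionProg (40 * J + 80) s fun s' =>
      Prepared M Q (512 * M ^ 4 * J / ε) s' ∧ s'.drawn = s.drawn ∧ s'.queried = s.queried := by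
  refine Runs.mono (T := 13 + ((J * (5 + 1 + 20) + 10) + 50))
    (Runs.seq (Runs.straight rfl (by decide) ?_)) (by omega) fun _ h => h
  refine Runs.seq ?_
  refine Runs.mono (Runs.loop (T := 20) (fun s' => ∃ j ≤ J, s'.real 6 = j ∧
    s'.real 5 = 2 ^ j * (δ / (8 * M)) ∧ s'.nat = s.nat ∧ (∀ a, 16 ≤ a → s'.real a = s.real a) ∧
    s'.drawn = s.drawn ∧ s'.queried = s.queried) (fun s' => J - ⌊s'.real 6⌋₊) ?_ ?_) ?_ ?_
  · rintro s' ⟨j, h1, h2, h3, h4, h5, h6, h7⟩ hb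
    simp only [BExp.Holds, RExp.eval, rreg_eval, h3, Rat.cast_one] at hb
    have hlt : j < J := by
      by_contra h
      obtain rfl : j = J := by omega
      linarith
    refine Runs.straight rfl (by decide) ⟨⟨j + 1, hlt, ?_, ?_, h4, ?_, h6, h7⟩, ?_⟩
    · simp [block, Prog.run, RExp.eval, NExp.eval, h2]
    · simp [block, Prog.run, RExp.eval, NExp.eval, h3]
      ring
    · intro a ha
      simp only [block, Prog.run, NExp.eval]
      rw [Function.update_of_ne (by omega), Function.update_of_ne (by omega), h5 a ha]
    · have : ⌊(j : ℝ) + 1⌋₊ = j + 1 := by exact_mod_cast Nat.floor_natCast (j + 1)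
      simp [block, Prog.run, RExp.eval, NExp.eval, h2, this]
      omega
  · refine ⟨0, Nat.zero_le _, ?_, ?_, rfl, fun a ha => ?_, rfl, rfl⟩
    · simp [block, Prog.run, RExp.eval, NExp.eval]
    · simp [block, Prog.run, RExp.eval, NExp.eval, paramInput, hs2]
    · simp only [block, Prog.run, NExp.eval]
      rw [Function.update_of_ne (by omega), Function.update_of_ne (by omega)]
  · simp [block, Prog.run, RExp.eval, NExp.eval, BExp.cost, RExp.cost, NExp.cost, rreg]
    omega
  · rintro s' ⟨⟨j, h1, h2, h3, h4, h5, h6, h7⟩, hb⟩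
    simp only [BExp.Holds, RExp.eval, rreg_eval, h3, Rat.cast_one, not_lt] at hb
    obtain rfl : j = J := by
      by_contra h
      linarith [hJ' j (by omega)]
    refine Runs.straight rfl (by decide) ⟨⟨?_, ?_, ?_, ?_, ?_⟩, h6, h7⟩
    · simp [block, Prog.run, NExp.eval, h4, hs0]
    · simp [block, Prog.run, NExp.eval, h4, hs2]
    · simp [block, Prog.run, NExp.eval, h4, hs2]
    · simp [block, Prog.run, RExp.eval, NExp.eval, h4, hs2, h2, paramInput]
      ring
    · refine hT.congr (fun a ha => ?_) fun j hj p => ?_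
      · simp only [block, Prog.run, NExp.eval, h4]
        rw [Function.update_of_ne (by omega)]
      · simp only [block, Prog.run, NExp.eval]
        rw [Function.update_of_ne (by omega), h5 _ (by omega)]

theorem meanProg_runs (hn : 1 ≤ n) {inp : ℕ → ℝ} {M : ℕ} {Q : ℕ → Pattern n} {N : ℝ} {s : State}
    (hs : Prepared M Q N s) (hd : s.drawn = 0) :
    Runs w inp meanProg (⌈N⌉₊ * (3 * n + 60) + 80) s fun s' =>
      Prepared M Q N s' ∧
      (∀ p : Fin 3, s'.real (p + 1) = meanEstimate ⌈N⌉₊ w.random.1 ⟨0, hn⟩ p) ∧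
      s'.drawn = ⌈N⌉₊ ∧ s'.queried = s.queried := by
  refine Runs.mono (T := 16 + ((⌈N⌉₊ * (6 + 1 + (3 + 3 * n + 40)) + 10) + 30))
    (Runs.seq (Runs.straight rfl (by decide) ?_)) (by
      have : ⌈N⌉₊ * (6 + 1 + (3 + 3 * n + 40)) ≤ ⌈N⌉₊ * (3 * n + 60) :=
        Nat.mul_le_mul_left _ (by omega)
      omega) fun _ h => h
  refine Runs.seq ?_
  refine Runs.mono (Runs.loop (T := 3 + 3 * n + 40) (fun s' => Prepared M Q N s' ∧
    s'.nat 6 ≤ ⌈N⌉₊ ∧ (∀ p : Fin 3, s'.real (p + 1) = ∑ t ∈ Finset.range (s'.nat 6),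
      bloch (w.random.1 t ⟨0, hn⟩) p) ∧ s'.drawn = s'.nat 6 ∧ s'.queried = s.queried)
      (fun s' => ⌈N⌉₊ - s'.nat 6) ?_ ?_) ?_ ?_
  · rintro s' ⟨h1, h2, h3, h4, h5⟩ hb
    simp only [BExp.Holds, RExp.eval, rreg_eval, reg_eval, h1.repetitions, ← Nat.lt_ceil] at hb
    -- the first three cells of the example describe its first site
    have hex : ∀ p : Fin 3, writeExample (w.random.1 s'.drawn) (s'.nat 8) s'.real (s'.nat 8 + p) =
        bloch (w.random.1 (s'.nat 6) ⟨0, hn⟩) p := by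
      intro p
      have hp := p.2
      have h3 : (p : ℕ) / 3 = 0 := Nat.div_eq_of_lt hp
      have hp3 : (⟨p % 3, Nat.mod_lt p (by norm_num)⟩ : Fin 3) = p := Fin.ext (Nat.mod_eq_of_lt hp)
      rw [writeExample, if_pos (by omega), Nat.add_sub_cancel_left, description,
        dif_pos (by omega), ← pauliExp_state, h4, hp3]
      simp only [h3]
    have hlow : ∀ a < 16, writeExample (w.random.1 s'.drawn) (s'.nat 8) s'.real a =
        s'.real a := fun a ha => by
      rw [writeExample, if_neg]
      rw [h1.base]
      omega
    have hex0 := hex 0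
    have hex1 := hex 1
    have hex2 := hex 2
    have h31 := h3 0
    have h32 := h3 1
    have h33 := h3 2
    simp only [Fin.val_zero, Fin.val_one, Fin.val_two, zero_add, add_zero, Nat.reduceAdd]
      at hex0 hex1 hex2 h31 h32 h33
    refine Runs.seq ((Runs.draw ?_).mono (T' := 3 + 3 * n) (by simp [reg, NExp.cost])
      fun _ h => h)
    have h8 : 16 ≤ s'.nat 8 := by rw [h1.base]; omega
    refine Runs.straight rfl (by decide) ⟨⟨⟨?_, ?_, ?_, ?_, ?_⟩, ?_, ?_, ?_, ?_⟩, ?_⟩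
    · simpa [block, Prog.run, NExp.eval] using h1.qubits
    · simpa [block, Prog.run, NExp.eval] using h1.entries
    · simpa [block, Prog.run, NExp.eval] using h1.base
    · simpa [block, Prog.run, NExp.eval, hlow] using h1.repetitions
    · refine h1.table.congr (fun a ha => ?_) fun j hj p => ?_
      · simp only [block, Prog.run, NExp.eval]
        rw [Function.update_of_ne (by omega)]
      · have := p.2
        simp only [block, Prog.run, NExp.eval]
        repeat rw [Function.update_of_ne (by omega)]
        rw [writeExample, if_neg]
        simp only [reg_eval, h1.base]
        omega
    · simp [block, Prog.run, NExp.eval]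
      omega
    · intro p
      simp only [block, Prog.run, NExp.eval, RExp.eval, rreg_eval, reg_eval]
      simp (disch := omega) only [Function.update_of_ne, Function.update_self, hlow, hex0, hex1,
        hex2]
      rw [Finset.sum_range_succ]
      fin_cases p
      · simp [h31]
      · simp [h32]
      · simp [h33]
    · simp [block, Prog.run, NExp.eval, h4]
    · simp [block, Prog.run, h5]
    · simp [block, Prog.run, NExp.eval]
      omega
  · refine ⟨⟨?_, ?_, ?_, ?_, ?_⟩, ?_, ?_, ?_, ?_⟩
    · simpa [block, Prog.run, NExp.eval] using hs.qubits
    · simpa [block, Prog.run, NExp.eval] using hs.entries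
    · simpa [block, Prog.run, NExp.eval] using hs.base
    · simpa [block, Prog.run, NExp.eval] using hs.repetitions
    · refine hs.table.congr (fun a ha => ?_) fun j hj p => ?_
      · simp only [block, Prog.run, NExp.eval]
        rw [Function.update_of_ne (by omega)]
      · simp only [block, Prog.run, NExp.eval]
        repeat rw [Function.update_of_ne (by omega)]
    · simp [block, Prog.run, NExp.eval]
    · intro p
      fin_cases p <;> simp [block, Prog.run, NExp.eval, RExp.eval]
    · simpa [block, Prog.run, NExp.eval] using hd
    · rfl
  · simp [block, Prog.run, NExp.eval, BExp.cost, RExp.cost, NExp.cost, reg, rreg]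
  · rintro s' ⟨⟨h1, h2, h3, h4, h5⟩, hb⟩
    simp only [BExp.Holds, RExp.eval, rreg_eval, reg_eval, h1.repetitions, ← Nat.lt_ceil,
      not_lt] at hb
    have h6 : s'.nat 6 = ⌈N⌉₊ := le_antisymm h2 hb
    have h31 := h3 0
    have h32 := h3 1
    have h33 := h3 2
    simp only [Fin.val_zero, Fin.val_one, Fin.val_two, zero_add, Nat.reduceAdd] at h31 h32 h33
    refine Runs.straight rfl (by decide) ⟨⟨?_, ?_, ?_, ?_, ?_⟩, ?_, ?_, ?_⟩
    · simpa [block, Prog.run, NExp.eval] using h1.qubits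
    · simpa [block, Prog.run, NExp.eval] using h1.entries
    · simpa [block, Prog.run, NExp.eval] using h1.base
    · simpa [block, Prog.run, NExp.eval] using h1.repetitions
    · refine h1.table.congr (fun a ha => rfl) fun j hj p => ?_
      simp only [block, Prog.run, NExp.eval]
      repeat rw [Function.update_of_ne (by omega)]
    · intro p
      simp only [block, Prog.run, NExp.eval, RExp.eval, rreg_eval, reg_eval, meanEstimate]
      simp (disch := omega) only [Function.update_of_ne, ← h6]
      fin_cases p
      · simp [h31]
      · simp [h32]
      · simp [h33]
    · simp [block, Prog.run, h4, h6]
    · simp [block, Prog.run, h5]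

end

/-! ### Measuring at the probe states -/

section
variable {n : ℕ} {w : World n}

/-- Only temporary cells and the region of the probe state differ. -/
structure SameTable (M : ℕ) (s s' : State) : Prop where
  nat : ∀ a, a ≠ 3 → a ≠ 6 → a ≠ 9 → s'.nat a = s.nat a
  real : ∀ a, 1 ≤ a → a ≠ 7 → a < 16 + 5 * M → s'.real a = s.real a
  drawn : s'.drawn = s.drawn

theorem SameTable.trans {M : ℕ} {s s' s'' : State} (h : SameTable M s s')
    (h' : SameTable M s' s'') : SameTable M s s'' where
  nat a h3 h6 h9 := (h'.nat a h3 h6 h9).trans (h.nat a h3 h6 h9)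
  real a h1 h7 hM := (h'.real a h1 h7 hM).trans (h.real a h1 h7 hM)
  drawn := h'.drawn.trans h.drawn

theorem SameTable.prepared {M : ℕ} {Q : ℕ → Pattern n} {N : ℝ} {s s' : State}
    (h : SameTable M s s') (hs : Prepared M Q N s) : Prepared M Q N s' where
  qubits := (h.nat 0 (by norm_num) (by norm_num) (by norm_num)).trans hs.qubits
  entries := (h.nat 2 (by norm_num) (by norm_num) (by norm_num)).trans hs.entries
  base := (h.nat 8 (by norm_num) (by norm_num) (by norm_num)).trans hs.base
  repetitions := (h.real 4 (by norm_num) (by norm_num) (by omega)).trans hs.repetitions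
  table := hs.table.congr (fun a ha => h.nat a (by omega) (by omega) (by omega))
    fun j hj p => h.real _ (by omega) (by omega) (by omega)

/-- The probe state stands from the address `16 + 5 M` on, right after the table. -/
theorem fillProg_runs {inp : ℕ → ℝ} {M : ℕ} {Q : ℕ → Pattern n} {N : ℝ} {ν : Fin 3 → ℝ}
    {s : State} (hs : Prepared M Q N s) (hν : ∀ p : Fin 3, s.real (p + 1) = ν p) :
    Runs w inp fillProg (100 * n + 20) s fun s' =>
      SameTable M s s' ∧ s'.queried = s.queried ∧
      ∀ i < n, ∀ p, readBloch s'.real (16 + 5 * M) i p = ν p := by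
  refine Runs.mono (T := 4 + (n * (5 + 1 + 80) + 10))
    (Runs.seq (Runs.straight rfl (by decide) ?_)) (by omega) fun _ h => h
  refine Runs.mono (Runs.loop (T := 80) (fun s' => SameTable M s s' ∧ s'.queried = s.queried ∧
    s'.nat 3 ≤ n ∧ ∀ i < s'.nat 3, ∀ p, readBloch s'.real (16 + 5 * M) i p = ν p)
    (fun s' => n - s'.nat 3) ?_ ?_) ?_ ?_
  · rintro s' ⟨h1, h2, h3, h4⟩ hb
    have hs' := h1.prepared hs
    simp only [BExp.Holds, reg_eval, hs'.qubits] at hb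
    have hν' : ∀ p : Fin 3, s'.real (p + 1) = ν p := fun p =>
      (h1.real _ (by omega) (by omega) (by omega)).trans (hν p)
    have hν0 := hν' 0
    have hν1 := hν' 1
    have hν2 := hν' 2
    simp only [Fin.val_zero, Fin.val_one, Fin.val_two, zero_add, Nat.reduceAdd] at hν0 hν1 hν2
    refine Runs.straight rfl (by decide) ⟨⟨h1.trans ⟨?_, ?_, rfl⟩, h2, ?_, ?_⟩, ?_⟩
    · intro a ha _ _
      simp only [block, Prog.run, NExp.eval]
      rw [Function.update_of_ne ha]
    · intro a _ _ ha
      simp only [block, Prog.run, probeAddr_eval, reg_eval, hs'.base]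
      repeat rw [Function.update_of_ne (by omega)]
    · simp [block, Prog.run, NExp.eval]
      omega
    · intro i hi p
      simp [block, Prog.run, NExp.eval] at hi
      have hp := p.2
      simp only [block, Prog.run, probeAddr_eval, reg_eval, hs'.base, readBloch, rreg_eval]
      rcases Nat.lt_or_eq_of_le hi with hi | rfl
      · simp (disch := omega) only [Function.update_of_ne]
        exact h4 i hi p
      · simp (disch := omega) only [Function.update_of_ne, hν0, hν1, hν2]
        fin_cases p <;> simp
    · simp [block, Prog.run, NExp.eval]
      omega
  · refine ⟨⟨?_, fun _ _ _ _ => rfl, rfl⟩, rfl, ?_, ?_⟩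
    · intro a ha _ _
      simp [Prog.run, NExp.eval, ha]
    · simp [Prog.run, NExp.eval]
    · simp [Prog.run, NExp.eval]
  · simp [Prog.run, NExp.eval, BExp.cost, NExp.cost, reg]
  · rintro s' ⟨⟨h1, h2, h3, h4⟩, hb⟩
    simp only [BExp.Holds, reg_eval, (h1.prepared hs).qubits, not_lt] at hb
    exact ⟨h1, h2, fun i hi => h4 i (by omega)⟩

theorem markProg_runs {inp : ℕ → ℝ} {M j : ℕ} {Q : ℕ → Pattern n} {N : ℝ} {ν : Fin 3 → ℝ}
    {s : State} (hs : Prepared M Q N s) (h4 : s.nat 4 = j) (hj : j < M)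
    (hν : ∀ i : Fin n, readBloch s.real (16 + 5 * M) i = ν) :
    Runs w inp markProg (306 * M + 20) s fun s' =>
      SameTable M s s' ∧ s'.queried = s.queried ∧
      ∀ i : Fin n, readBloch s'.real (16 + 5 * M) i = (Q j).probe ν i := by
  refine Runs.mono (T := 5 + (M * (5 + 1 + 300) + 10))
    (Runs.seq (Runs.straight rfl (by decide) ?_)) (by omega) fun _ h => h
  -- the marks of the entry in cell `9` are still to be written, the other marks of `Q j` are there
  refine Runs.mono (Runs.loop (T := 300) (fun s' => SameTable M s s' ∧ s'.queried = s.queried ∧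
    s'.nat 9 < M ∧ (∀ i, Q (s'.nat 9) i = none ∨ Q (s'.nat 9) i = Q j i) ∧
    ∀ i : Fin n, readBloch s'.real (16 + 5 * M) i =
      if Q (s'.nat 9) i = none then (Q j).probe ν i else ν)
    (fun s' => s'.nat 9) ?_ ?_) ?_ ?_
  · rintro s' ⟨g1, g2, g3, g4, g5⟩ hb
    have hs' := g1.prepared hs
    simp only [BExp.Holds, reg_eval, NExp.eval] at hb
    obtain ⟨d, i, f1, f2, f3, f4, f5⟩ := hs'.table.entry _ g3 hb
    set e := s'.nat 9 with he
    set e' := s'.nat (16 + 3 * e) with he'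
    have f50 := f5 0
    have f51 := f5 1
    have f52 := f5 2
    simp only [Fin.val_zero, Fin.val_one, Fin.val_two, add_zero] at f50 f51 f52
    have hd : Q j i = some d := by
      have := g4 i
      rw [f3, Function.update_self] at this
      exact (this.resolve_left (by simp)).symm
    refine Runs.straight rfl (by decide) ⟨⟨g1.trans ⟨?_, ?_, rfl⟩, g2, ?_, ?_, ?_⟩, ?_⟩
    · intro a _ _ ha
      simp only [block, Prog.run, NExp.eval]
      rw [Function.update_of_ne ha]
    · intro a _ _ ha
      simp only [block, Prog.run, probeAddr_eval, hs'.base]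
      repeat rw [Function.update_of_ne (by omega)]
    · simp [block, Prog.run, NExp.eval, ← he, ← he']
      omega
    · simp only [block, Prog.run, NExp.eval, Function.update_self, natAddr_eval, reg_eval, ← he,
        add_zero, ← he']
      intro i'
      by_cases hi : i' = i
      · exact Or.inl (hi ▸ f2)
      · have := g4 i'
        rwa [f3, Function.update_of_ne hi] at this
    · simp only [block, Prog.run, NExp.eval, Function.update_self, natAddr_eval, reg_eval, ← he,
        add_zero, ← he', probeAddr_eval, hs'.base, RExp.eval, realAddr_eval, f4]
      intro i'
      have g5' := g5 i'
      by_cases hi : i' = i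
      · subst hi
        rw [if_pos f2]
        ext p
        have hp := p.2
        simp only [Pattern.probe, hd, Option.elim_some]
        simp (disch := omega) only [readBloch, Function.update_of_ne, f51, f52]
        fin_cases p <;> simp
        exact f50
      · rw [f3, Function.update_of_ne hi] at g5'
        rw [← g5']
        ext p
        have hp := p.2
        have hi' := Fin.val_ne_of_ne hi
        simp only [readBloch]
        repeat rw [Function.update_of_ne (by omega)]
    · simp [block, Prog.run, NExp.eval, ← he, ← he']
      omega
  · simp only [Prog.run, NExp.eval, reg_eval, h4, Function.update_self]
    refine ⟨⟨?_, fun _ _ _ _ => rfl, rfl⟩, trivial, hj, fun _ => Or.inr trivial, fun i => ?_⟩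
    · intro a _ _ ha
      simp [ha]
    · rw [hν]
      split_ifs with h
      · simp [Pattern.probe, h]
      · rfl
  · simp [Prog.run, NExp.eval, BExp.cost, NExp.cost, reg, h4]
    omega
  · rintro s' ⟨⟨g1, g2, g3, g4, g5⟩, hb⟩
    simp only [BExp.Holds, reg_eval, NExp.eval, not_lt, Nat.le_zero] at hb
    refine ⟨g1, g2, fun i => ?_⟩
    rw [g5, hb, hs.table.zero, if_pos rfl]

/-- Since entry `j` is treated after `j R` channel uses, its outcomes are those that `valueEstimate`
averages. -/
theorem measureProg_runs (hO : IsBoundedObservable w.obs) {inp : ℕ → ℝ} {M j : ℕ}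
    {Q : ℕ → Pattern n} {N : ℝ} {s : State} (hs : Prepared M Q N s) (h4 : s.nat 4 = j)
    (hj : j < M) (hq : s.queried = j * ⌈N⌉₊) {v : Fin n → Fin 3 → ℝ}
    (hv : ∀ i, ∑ p, v i p ^ 2 ≤ 1) (hr : ∀ i : Fin n, readBloch s.real (16 + 5 * M) i = v i) :
    Runs w inp measureProg (⌈N⌉₊ * (3 * n + 60) + 80) s fun s' =>
      Prepared M Q N s' ∧ s'.nat 4 = j + 1 ∧ s'.drawn = s.drawn ∧
      s'.queried = (j + 1) * ⌈N⌉₊ ∧ s'.real (16 + 5 * j + 3) =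
        valueEstimate ⌈N⌉₊ j w.random.2 (multi (pauliCoeff (channelFunctional w.channel w.obs)) v) ∧
      ∀ a, 1 ≤ a → a ≠ 7 → a < 16 + 5 * M → a ≠ 16 + 5 * j + 3 → s'.real a = s.real a := by
  set g := multi (pauliCoeff (channelFunctional w.channel w.obs)) v with hg
  refine Runs.mono (T := 8 + ((⌈N⌉₊ * (6 + 1 + (4 + 3 * n + 40)) + 10) + 40))
    (Runs.seq (Runs.straight rfl (by decide) ?_)) (by
      have : ⌈N⌉₊ * (6 + 1 + (4 + 3 * n + 40)) ≤ ⌈N⌉₊ * (3 * n + 60) :=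
        Nat.mul_le_mul_left _ (by omega)
      omega) fun _ h => h
  refine Runs.seq ?_
  refine Runs.mono (Runs.loop (T := 4 + 3 * n + 40) (fun s' => SameTable M s s' ∧
    s'.nat 6 ≤ ⌈N⌉₊ ∧ s'.real 0 = ∑ t ∈ Finset.range (s'.nat 6),
      signOutcome (w.random.2 (j * ⌈N⌉₊ + t)) g ∧ s'.queried = j * ⌈N⌉₊ + s'.nat 6 ∧
      ∀ a, 16 + 5 * M ≤ a → s'.real a = s.real a) (fun s' => ⌈N⌉₊ - s'.nat 6) ?_ ?_) ?_ ?_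
  · rintro s' ⟨h1, h2, h3, h5, h6⟩ hb
    have hs' := h1.prepared hs
    simp only [BExp.Holds, RExp.eval, rreg_eval, reg_eval, hs'.repetitions, ← Nat.lt_ceil] at hb
    have hread : ∀ i : Fin n, readBloch s'.real ((reg 8).eval s') i = v i := by
      intro i
      rw [← hr, reg_eval, hs'.base]
      ext p
      exact h6 _ (by omega)
    have hout : w.outcome s'.queried (tensorOp fun i : Fin n =>
        qubitState (readBloch s'.real ((reg 8).eval s') i)) =
        signOutcome (w.random.2 (j * ⌈N⌉₊ + s'.nat 6)) g := by
      simp only [hread]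
      rw [World.outcome, plusProb_productOp _ hO, h5]
      rfl
    refine Runs.seq ((Runs.query (fun i => by rw [hread]; exact hv i) ?_).mono
      (T' := 4 + 3 * n) (by simp [reg, NExp.cost]) fun _ h => h)
    rw [hout]
    refine Runs.straight rfl (by decide) ⟨⟨h1.trans ⟨?_, ?_, rfl⟩, ?_, ?_, ?_, ?_⟩, ?_⟩
    · intro a _ ha _
      simp [block, Prog.run, NExp.eval, ha]
    · intro a ha0 ha7 _
      simp only [block, Prog.run, NExp.eval]
      rw [Function.update_of_ne (by omega), Function.update_of_ne ha7]
    · simp [block, Prog.run, NExp.eval]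
      omega
    · simp [block, Prog.run, NExp.eval, RExp.eval, h3, Finset.sum_range_succ]
    · simp [block, Prog.run, NExp.eval, h5]
      ring
    · intro a ha
      simp only [block, Prog.run, NExp.eval]
      rw [Function.update_of_ne (by omega), Function.update_of_ne (by omega)]
      exact h6 a ha
    · simp [block, Prog.run, NExp.eval]
      omega
  · refine ⟨⟨?_, ?_, rfl⟩, ?_, ?_, ?_, ?_⟩
    · intro a _ ha _
      simp [block, Prog.run, NExp.eval, ha]
    · intro a ha _ _
      simp only [block, Prog.run, NExp.eval]
      rw [Function.update_of_ne (by omega)]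
    · simp [block, Prog.run, NExp.eval]
    · simp [block, Prog.run, NExp.eval, RExp.eval]
    · simpa [block, Prog.run, NExp.eval] using hq
    · intro a ha
      simp only [block, Prog.run, NExp.eval]
      rw [Function.update_of_ne (by omega)]
  · simp [block, Prog.run, NExp.eval, BExp.cost, RExp.cost, NExp.cost, reg, rreg]
  · rintro s' ⟨⟨h1, h2, h3, h5, h6⟩, hb⟩
    have hs' := h1.prepared hs
    simp only [BExp.Holds, RExp.eval, rreg_eval, reg_eval, hs'.repetitions, ← Nat.lt_ceil,
      not_lt] at hb
    have h6N : s'.nat 6 = ⌈N⌉₊ := le_antisymm h2 hb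
    have h4' : s'.nat 4 = j := (h1.nat 4 (by norm_num) (by norm_num) (by norm_num)).trans h4
    refine Runs.straight rfl (by decide) ⟨⟨?_, ?_, ?_, ?_, ?_⟩, ?_, h1.drawn, ?_, ?_, ?_⟩
    · simpa [block, Prog.run, NExp.eval] using hs'.qubits
    · simpa [block, Prog.run, NExp.eval] using hs'.entries
    · simpa [block, Prog.run, NExp.eval] using hs'.base
    · simp only [block, Prog.run, NExp.eval, realAddr_eval]
      rw [Function.update_of_ne (by omega)]
      exact hs'.repetitions
    · refine hs'.table.congr (fun a ha => ?_) fun j' hj' p => ?_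
      · simp only [block, Prog.run, NExp.eval]
        rw [Function.update_of_ne (by omega)]
      · have := p.2
        simp only [block, Prog.run, realAddr_eval, reg_eval, h4']
        rw [Function.update_of_ne (by omega)]
    · simp [block, Prog.run, NExp.eval, h4']
    · simp only [block, Prog.run, h5, h6N]
      ring
    · simp only [block, Prog.run, NExp.eval, realAddr_eval, reg_eval, h4', Function.update_self,
        RExp.eval, rreg_eval, h3, h6N, valueEstimate]
    · intro a ha0 ha7 haM haj
      simp only [block, Prog.run, NExp.eval, realAddr_eval, reg_eval, h4']
      rw [Function.update_of_ne haj]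
      exact h1.real a ha0 ha7 haM

/-- The value estimates computed by the learner. -/
theorem valuesProg_runs (hO : IsBoundedObservable w.obs) {inp : ℕ → ℝ} {M : ℕ}
    {Q : ℕ → Pattern n} {N : ℝ} {ν : Fin 3 → ℝ} (hνsq : ∑ p, ν p ^ 2 ≤ 1) {s : State}
    (hs : Prepared M Q N s) (hν : ∀ p : Fin 3, s.real (p + 1) = ν p) (hq : s.queried = 0) :
    Runs w inp valuesProg (M * (⌈N⌉₊ * (3 * n + 60) + 306 * M + 100 * n + 150) + 20) s fun s' =>
      Prepared M Q N s' ∧ (∀ p : Fin 3, s'.real (p + 1) = ν p) ∧ s'.drawn = s.drawn ∧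
      s'.queried = M * ⌈N⌉₊ ∧ ∀ j < M, s'.real (16 + 5 * j + 3) =
        valueEstimate ⌈N⌉₊ j w.random.2
          (multi (pauliCoeff (channelFunctional w.channel w.obs)) ((Q j).probe ν)) := by
  set T := ⌈N⌉₊ * (3 * n + 60) with hT
  refine Runs.mono (T := 3 + (M * (5 + 1 + (100 * n + 20 + (306 * M + 20 + (T + 80)))) + 6))
    (Runs.seq (Runs.straight rfl (by decide) ?_)) (by
      have : M * (5 + 1 + (100 * n + 20 + (306 * M + 20 + (T + 80)))) ≤
        M * (T + 306 * M + 100 * n + 150) := Nat.mul_le_mul_left _ (by omega)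
      omega) fun _ h => h
  refine Runs.mono (Runs.loop (T := 100 * n + 20 + (306 * M + 20 + (T + 80)))
    (fun s' => Prepared M Q N s' ∧ s'.nat 4 ≤ M ∧ (∀ p : Fin 3, s'.real (p + 1) = ν p) ∧
      s'.drawn = s.drawn ∧ s'.queried = s'.nat 4 * ⌈N⌉₊ ∧
      ∀ j < s'.nat 4, s'.real (16 + 5 * j + 3) = valueEstimate ⌈N⌉₊ j w.random.2
        (multi (pauliCoeff (channelFunctional w.channel w.obs)) ((Q j).probe ν)))
    (fun s' => M - s'.nat 4) ?_ ?_) ?_ ?_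
  · rintro s₁ ⟨h1, h2, h3, h5, h6, h7⟩ hb
    simp only [BExp.Holds, reg_eval, h1.entries] at hb
    refine Runs.seq ((fillProg_runs h1 h3).mono le_rfl ?_)
    rintro s₂ ⟨g1, g2, g3⟩
    have hs₂ := g1.prepared h1
    have h42 : s₂.nat 4 = s₁.nat 4 := g1.nat 4 (by norm_num) (by norm_num) (by norm_num)
    refine Runs.seq ((markProg_runs hs₂ h42 hb fun i => funext (g3 i i.2)).mono le_rfl ?_)
    rintro s₃ ⟨f1, f2, f3⟩
    have h43 : s₃.nat 4 = s₁.nat 4 :=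
      (f1.nat 4 (by norm_num) (by norm_num) (by norm_num)).trans h42
    refine (measureProg_runs hO (f1.prepared hs₂) h43 hb (by rw [f2, g2, h6])
      ((Q (s₁.nat 4)).probe_sq_le hνsq) f3).mono le_rfl ?_
    rintro s₄ ⟨e1, e2, e3, e4, e5, e6⟩
    have hreal : ∀ a, 1 ≤ a → a ≠ 7 → a < 16 + 5 * M → a ≠ 16 + 5 * s₁.nat 4 + 3 →
        s₄.real a = s₁.real a := fun a a1 a2 a3 a4 =>
      (e6 a a1 a2 a3 a4).trans ((f1.real a a1 a2 a3).trans (g1.real a a1 a2 a3))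
    refine ⟨⟨e1, by omega, fun p => ?_, ?_, by rw [e4, e2], fun j hj => ?_⟩, by omega⟩
    · rw [hreal _ (by omega) (by omega) (by omega) (by omega), h3]
    · rw [e3, f1.drawn, g1.drawn, h5]
    · rw [e2] at hj
      rcases Nat.lt_succ_iff_lt_or_eq.mp hj with hj | rfl
      · rw [hreal _ (by omega) (by omega) (by omega) (by omega), h7 j hj]
      · exact e5
  · refine ⟨⟨?_, ?_, ?_, ?_, ?_⟩, ?_, ?_, rfl, ?_, ?_⟩
    · simpa [Prog.run, NExp.eval] using hs.qubits
    · simpa [Prog.run, NExp.eval] using hs.entries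
    · simpa [Prog.run, NExp.eval] using hs.base
    · exact hs.repetitions
    · exact hs.table.congr (fun a ha =>
        Function.update_of_ne (by simp [NExp.eval]; omega) _ _) fun _ _ _ => rfl
    · simp [Prog.run, NExp.eval]
    · exact hν
    · simpa [Prog.run, NExp.eval] using hq
    · simp [Prog.run, NExp.eval]
  · simp [Prog.run, NExp.eval, BExp.cost, NExp.cost, reg]
  · rintro s' ⟨⟨h1, h2, h3, h5, h6, h7⟩, hb⟩
    simp only [BExp.Holds, reg_eval, h1.entries, not_lt] at hb
    have h4 : s'.nat 4 = M := le_antisymm h2 hb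
    exact ⟨h1, h3, h5, by rw [h6, h4], fun j hj => h7 j (by omega)⟩

end

/-! ### Evaluating the interpolation formula -/

section
variable {n : ℕ} {w : World n}

theorem Pattern.coeff_update {q : Pattern n} {i : Fin n} (hq : q i = none) (d : Dir)
    (ν : Fin 3 → ℝ) (x : Fin n → Fin 3 → ℝ) :
    Pattern.coeff ν x (Function.update q i (some d)) =
      q.coeff ν x * ((∑ p, dirVec d p * (x i p - ν p)) / 2) := by
  unfold Pattern.coeff
  rw [← Finset.mul_prod_erase _ _ (Finset.mem_univ i),
    ← Finset.mul_prod_erase Finset.univ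
      (fun j => (q j).elim 1 fun d => (∑ p, dirVec d p * (x j p - ν p)) / 2) (Finset.mem_univ i),
    Finset.prod_congr rfl fun j hj => by
      rw [Function.update_of_ne (Finset.ne_of_mem_erase hj)]]
  simp only [Function.update_self, hq, Option.elim_some, Option.elim_none, one_mul]
  ring

theorem description_apply (x : Fin n → BlochSphere) (i : Fin n) (p : Fin 3) :
    description x (3 * i + p) = bloch (x i) p := by
  have hi := i.2
  have hp := p.2
  have h3 : (3 * (i : ℕ) + p) / 3 = i := by omega
  have hp3 : (⟨(3 * (i : ℕ) + p) % 3, Nat.mod_lt _ (by norm_num)⟩ : Fin 3) = p :=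
    Fin.ext (by simp only; omega)
  rw [description, dif_pos (by omega), ← pauliExp_state, hp3]
  simp only [h3]

/-- The state in which the prediction is computed, before the entry in cell `4`. -/
structure Predicting (M : ℕ) (Q : ℕ → Pattern n) (ν : Fin 3 → ℝ) (g : ℕ → ℝ)
    (x : Fin n → BlochSphere) (s : State) : Prop where
  entries : s.nat 2 = M
  table : IsTable M Q s.nat s.real
  mean : ∀ p : Fin 3, s.real (p + 1) = ν p
  value : ∀ j < M, s.real (16 + 5 * j + 3) = g j
  entry_pos : 0 < s.nat 4
  entry_le : s.nat 4 ≤ M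
  coeff : ∀ j < s.nat 4, s.real (16 + 5 * j + 4) = (Q j).coeff ν fun i => bloch (x i)
  sum : s.real 0 = ∑ j ∈ Finset.range (s.nat 4), ((Q j).coeff ν fun i => bloch (x i)) * g j

theorem predictProg_runs {M : ℕ} {Q : ℕ → Pattern n} {ν : Fin 3 → ℝ} {g : ℕ → ℝ} {s : State}
    (h2 : s.nat 2 = M) (hT : IsTable M Q s.nat s.real) (hν : ∀ p : Fin 3, s.real (p + 1) = ν p)
    (hg : ∀ j < M, s.real (16 + 5 * j + 3) = g j) (x : Fin n → BlochSphere) :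
    Runs w (description x) predictProg (406 * M + 40) s fun s' =>
      s'.real 0 = ∑ j ∈ Finset.range M, ((Q j).coeff ν fun i => bloch (x i)) * g j := by
  have hM := hT.pos
  refine Runs.mono (T := 20 + (M * (5 + 1 + 400) + 10))
    (Runs.seq (Runs.straight rfl (by decide) ?_)) (by omega) fun _ h => h
  refine Runs.mono (Runs.loop (T := 400) (Predicting M Q ν g x) (fun s' => M - s'.nat 4) ?_ ?_)
    ?_ ?_
  · intro s' h hb
    simp only [BExp.Holds, reg_eval, h.entries] at hb
    set j := s'.nat 4 with hj
    obtain ⟨d, i, f1, f2, f3, f4, f5⟩ := h.table.entry j hb h.entry_pos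
    set e := s'.nat (16 + 3 * j) with he
    -- the coefficient of an entry is that of its parent times the factor of the new mark
    have hnew : s'.real (16 + 5 * e + 4) *
        (((s'.real (16 + 5 * j) * (description x (0 + (i + (i + i))) - s'.real 1) +
          s'.real (16 + 5 * j + 1) * (description x (1 + (i + (i + i))) - s'.real 2)) +
          s'.real (16 + 5 * j + 2) * (description x (2 + (i + (i + i))) - s'.real 3)) / 2) =
        (Q j).coeff ν fun i => bloch (x i) := by
      have e0 := f5 0
      have e1 := f5 1
      have e2 := f5 2
      have m0 := h.mean 0
      have m1 := h.mean 1
      have m2 := h.mean 2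
      have d0 := description_apply x i 0
      have d1 := description_apply x i 1
      have d2 := description_apply x i 2
      simp only [Fin.val_zero, Fin.val_one, Fin.val_two, add_zero, zero_add, Nat.reduceAdd]
        at e0 e1 e2 m0 m1 m2 d0 d1 d2
      have a0 : 0 + ((i : ℕ) + (i + i)) = 3 * i := by omega
      have a1 : 1 + ((i : ℕ) + (i + i)) = 3 * i + 1 := by omega
      have a2 : 2 + ((i : ℕ) + (i + i)) = 3 * i + 2 := by omega
      rw [f3, Pattern.coeff_update f2, h.coeff e f1, a0, a1, a2, e0, e1, e2, m0, m1, m2, d0, d1,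
        d2, Fin.sum_univ_three]
    refine Runs.straight rfl (by decide) ?_
    simp only [block, Prog.run, NExp.eval, RExp.eval, coeffTerm, realAddr_eval, natAddr_eval,
      reg_eval, rreg_eval, ← hj, ← he, add_zero, f4, Rat.cast_ofNat, Nat.reduceAdd, zero_add]
    simp only [zero_add] at hnew
    rw [hnew, Function.update_self, Function.update_of_ne (a := 0) (by omega),
      Function.update_of_ne (a := 16 + 5 * j + 3) (by omega), h.value j hb]
    have hreal : ∀ a, a ≠ 0 → a ≠ 16 + 5 * j + 4 → ∀ y z : ℝ,
        Function.update (Function.update s'.real (16 + 5 * j + 4) y) 0 z a = s'.real a := by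
      intro a h0 h4 y z
      rw [Function.update_of_ne h0, Function.update_of_ne h4]
    refine ⟨⟨?_, ?_, fun p => ?_, fun j' hj' => ?_, ?_, ?_, fun j' hj' => ?_, ?_⟩, ?_⟩
    · simpa using h.entries
    · refine h.table.congr (fun a ha => Function.update_of_ne (by omega) _ _) fun j' hj' p => ?_
      exact hreal _ (by omega) (by omega) _ _
    · dsimp only
      rw [hreal, h.mean] <;> omega
    · dsimp only
      rw [hreal, h.value j' hj'] <;> omega
    · simp
    · simpa using hb
    · simp only [Function.update_self] at hj'
      dsimp only
      rw [Function.update_of_ne (by omega)]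
      rcases Nat.lt_succ_iff_lt_or_eq.mp hj' with hlt | rfl
      · rw [Function.update_of_ne (by omega), h.coeff j' (by omega)]
      · rw [Function.update_self]
    · simp only [Function.update_self]
      rw [Finset.sum_range_succ, h.sum]
    · simp only [Function.update_self]
      omega
  · simp only [block, Prog.run, NExp.eval, RExp.eval, Rat.cast_one]
    refine ⟨?_, ?_, fun p => ?_, fun j' hj' => ?_, ?_, ?_, fun j' hj' => ?_, ?_⟩
    · simpa using h2
    · refine hT.congr (fun a ha => Function.update_of_ne (by omega) _ _) fun j' hj' p => ?_
      dsimp only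
      rw [Function.update_of_ne (by omega), Function.update_of_ne (by omega)]
    · dsimp only
      rw [Function.update_of_ne (by omega), Function.update_of_ne (by omega), hν]
    · dsimp only
      rw [Function.update_of_ne (by omega), Function.update_of_ne (by omega), hg j' hj']
    · simp
    · simpa using Nat.one_le_iff_ne_zero.mpr hM.ne'
    · simp only [Function.update_self] at hj'
      obtain rfl : j' = 0 := by omega
      simp [hT.zero, Pattern.coeff]
    · have := hg 0 hM
      simp only [mul_zero, add_zero, Nat.reduceAdd] at this
      simp [this, hT.zero, Pattern.coeff]
  · simp [block, Prog.run, NExp.eval, BExp.cost, NExp.cost, reg]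
    omega
  · rintro s' ⟨h, hb⟩
    simp only [BExp.Holds, reg_eval, h.entries, not_lt] at hb
    rw [h.sum, le_antisymm h.entry_le hb]

/-! ### The whole run -/

/-- The run of an oracle-free program does not depend on the world. -/
theorem Exec.of_oracleFree {w' : World n} {inp : ℕ → ℝ} {c : Prog} {s s' : State} {t : ℕ}
    (h : Exec w inp c s t s') (hc : c.OracleFree) : Exec w' inp c s t s' := by
  induction h with
  | skip s => exact Exec.skip s
  | setNat a e s => exact Exec.setNat a e s
  | setReal a e s => exact Exec.setReal a e s
  | seq _ _ ih₁ ih₂ => exact Exec.seq (ih₁ hc.1) (ih₂ hc.2)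
  | iteTrue hb _ ih => exact Exec.iteTrue hb (ih hc.1)
  | iteFalse hb _ ih => exact Exec.iteFalse hb (ih hc.2)
  | loopDone hb => exact Exec.loopDone hb
  | loopStep hb _ _ ih₁ ih₂ => exact Exec.loopStep hb (ih₁ hc) (ih₂ hc)
  | draw a s => exact hc.elim
  | query a b s _ => exact hc.elim

theorem Runs.of_oracleFree {inp : ℕ → ℝ} {c : Prog} {T : ℕ} {s : State} {P : State → Prop}
    (h : Runs w inp c T s P) (hc : c.OracleFree) :
    ∃ s', P s' ∧ ∀ w' : World n, Runs w' inp c T s (· = s') := by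
  obtain ⟨t, s', e, ht, hP⟩ := h
  exact ⟨s', hP, fun w' => ⟨t, s', e.of_oracleFree hc, ht, rfl⟩⟩

theorem exists_pow_two_mul_ge {z : ℝ} (hz : 0 < z) :
    ∃ J : ℕ, 1 ≤ 2 ^ J * z ∧ ∀ j < J, 2 ^ j * z < 1 := by
  classical
  have hex : ∃ J : ℕ, 1 ≤ 2 ^ J * z := by
    obtain ⟨J, hJ⟩ := pow_unbounded_of_one_lt z⁻¹ (one_lt_two : (1 : ℝ) < 2)
    refine ⟨J, ?_⟩
    rw [inv_lt_iff_one_lt_mul₀ hz] at hJ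
    linarith
  exact ⟨Nat.find hex, Nat.find_spec hex, fun j hj => not_le.mp (Nat.find_min hex hj)⟩

/-- The learner computes the degree `k` and a table of all patterns of weight at most `k`, which do
not depend on the world, and estimates the mean and the values at the probe states from `R`
examples and `M R` channel uses. The predictor computes the interpolation formula. -/
theorem learnProg_runs (hn : 1 ≤ n) (w₀ : World n) {ε δ η : ℝ} (hε : ε ∈ Set.Ioo (0 : ℝ) 1)
    (hδ : 0 < δ) :
    ∃ (k J M R : ℕ) (Q : ℕ → Pattern n), 1 ≤ k ∧ (n ≤ k ∨ 4 / ε ≤ (1 + η / 8) ^ k) ∧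
      (1 + η / 8) ^ (k - 1) < 4 / ε ∧
      (∀ Φ : Pattern n → ℝ, ∑ j ∈ Finset.range M, Φ (Q j) = ∑ q ∈ lowPatterns n k, Φ q) ∧
      1 ≤ 2 ^ J * (δ / (8 * M)) ∧ (∀ j < J, 2 ^ j * (δ / (8 * M)) < 1) ∧
      R = ⌈512 * M ^ 4 * J / ε⌉₊ ∧
      ∀ w : World n, IsBoundedObservable w.obs →
        Runs w (paramInput ε δ η) learnProg (2000 * M ^ 2 * (R + 1)) (initState n) fun s =>
          s.drawn = R ∧ s.queried = M * R ∧
          ∀ x, Runs w (description x) predictProg (406 * M + 40) s fun s' =>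
            s'.real 0 = ∑ j ∈ Finset.range M,
              ((Q j).coeff (meanEstimate R w.random.1 ⟨0, hn⟩) fun i => bloch (x i)) *
              valueEstimate R j w.random.2 (multi (pauliCoeff (channelFunctional w.channel w.obs))
                ((Q j).probe (meanEstimate R w.random.1 ⟨0, hn⟩))) := by
  obtain ⟨s₁, ⟨a0, a1, a2, a3, a4, a18, a5, a6⟩, hrun₁⟩ :=
    (degreeProg_runs (w := w₀) hn (δ := δ) (η := η) hε (s := initState n) rfl rfl).of_oracleFree
      (by simp [degreeProg, block, Prog.OracleFree])
  obtain ⟨s₂, ⟨b0, b1, b2, b3, Q, hT, hQ⟩, hrun₂⟩ :=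
    (tableProg_runs (w := w₀) (inp := paramInput ε δ η) a0 rfl
      (by rw [a18]; rfl)).of_oracleFree
      (by simp [tableProg, extendProg, appendProg, dirs, block, Prog.OracleFree])
  set k := s₁.nat 1 with hk
  set M := s₂.nat 2 with hM
  have hMpos := hT.pos
  have hcard : M = (lowPatterns n k).card := card_of_sum_eq hQ
  have hnM : 6 * n < M := hcard ▸ six_mul_lt_card_lowPatterns hn a1
  have hM0 : (0 : ℝ) < M := by exact_mod_cast hMpos
  obtain ⟨J, hJ, hJ'⟩ := exists_pow_two_mul_ge (z := δ / (8 * M)) (by positivity)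
  refine ⟨k, J, M, _, Q, a1, a3, a4, hQ, hJ, hJ', rfl, fun w hO => ?_⟩
  set N : ℝ := 512 * M ^ 4 * J / ε with hN
  set R := ⌈N⌉₊ with hR
  have hJR : J ≤ R := by
    have h1 : (J : ℝ) ≤ N := by
      rw [hN, le_div_iff₀ hε.1]
      have h2 : (1 : ℝ) ≤ (M : ℝ) ^ 4 := one_le_pow₀ (by exact_mod_cast hMpos)
      have h3 : (0 : ℝ) ≤ J := Nat.cast_nonneg J
      have h4 : (J : ℝ) * ε ≤ J * 1 := mul_le_mul_of_nonneg_left hε.2.le h3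
      nlinarith [mul_le_mul_of_nonneg_right h2 h3]
    exact_mod_cast h1.trans (Nat.le_ceil N)
  have htime : (42 * n + 30) + ((n * (820 * M + 50) + 30) + ((40 * J + 80) +
      ((R * (3 * n + 60) + 80) + (M * (R * (3 * n + 60) + 306 * M + 100 * n + 150) + 20)))) ≤
      2000 * M ^ 2 * (R + 1) := by
    have h1 : n ≤ M := by omega
    have h2 : n * (820 * M + 50) ≤ M * (820 * M + 50) := Nat.mul_le_mul_right _ h1
    have h3 : R * (3 * n + 60) ≤ R * (63 * M) := Nat.mul_le_mul_left _ (by omega)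
    have h4 : M * (R * (3 * n + 60) + 306 * M + 100 * n + 150) ≤
        M * (R * (63 * M) + 306 * M + 100 * M + 150 * M) := by gcongr; omega
    have h5 : M ≤ M ^ 2 := by nlinarith
    have h6 : R * M ≤ R * M ^ 2 := Nat.mul_le_mul_left _ h5
    have h7 : R ≤ R * M := Nat.le_mul_of_pos_right _ hMpos
    nlinarith
  refine Runs.mono (Runs.seq ((hrun₁ w).mono le_rfl ?_)) htime fun _ h => h
  rintro _ rfl
  refine Runs.seq ((hrun₂ w).mono (by rw [hcard]) ?_)
  rintro _ rfl
  refine Runs.seq ((repetitionProg_runs b0 rfl hT hJ hJ').mono le_rfl ?_)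
  rintro s₃ ⟨c1, c2, c3⟩
  refine Runs.seq ((meanProg_runs hn c1 (by rw [c2, b2, a5]; rfl)).mono le_rfl ?_)
  rintro s₄ ⟨d1, d2, d3, d4⟩
  refine (valuesProg_runs hO (meanEstimate_sq_le _ _) d1 d2
    (by rw [d4, c3, b3, a6]; rfl)).mono le_rfl ?_
  rintro s₅ ⟨e1, e2, e3, e4, e5⟩
  exact ⟨e3.trans d3, e4, fun x => predictProg_runs e1.entries e1.table e2 e5 x⟩

end

/-! ### Comparison of the running time with the claimed bound -/

theorem repetition_exponent_le {δ : ℝ} (hδ : δ ∈ Set.Ioo (0 : ℝ) 1) {M J : ℕ} (hM : 1 ≤ M)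
    (hJ : ∀ j < J, 2 ^ j * (δ / (8 * M)) < 1) : (J : ℝ) ≤ 34 * M * Real.log (2 / δ) := by
  have hM1 : (1 : ℝ) ≤ M := by exact_mod_cast hM
  have hδ0 := hδ.1
  have hlog2 := Real.log_two_gt_d9
  have hL : Real.log 2 ≤ Real.log (2 / δ) := by
    refine Real.log_le_log (by norm_num) ?_
    rw [le_div_iff₀ hδ0]
    linarith [hδ.2]
  rcases Nat.eq_zero_or_pos J with rfl | hpos
  · simp only [Nat.cast_zero]
    have : (0 : ℝ) ≤ Real.log (2 / δ) := by linarith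
    positivity
  · have h1 : (2 : ℝ) ^ J ≤ 8 * M * (2 / δ) := by
      have := hJ (J - 1) (by omega)
      rw [mul_div_assoc', div_lt_one (by positivity)] at this
      have h2 : (2 : ℝ) ^ J = 2 * 2 ^ (J - 1) := by
        rw [← pow_succ', Nat.sub_add_cancel hpos]
      rw [h2, mul_div_assoc', le_div_iff₀ hδ0]
      linarith
    have h2 := Real.log_le_log (by positivity) h1
    rw [Real.log_pow, Real.log_mul (by positivity) (by positivity)] at h2
    have h3 : Real.log (8 * M) ≤ 8 * M := (Real.log_le_sub_one_of_pos (by positivity)).trans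
      (by linarith)
    have h4 : (J : ℝ) * (1 / 2) ≤ J * Real.log 2 :=
      mul_le_mul_of_nonneg_left (by linarith) (Nat.cast_nonneg J)
    have h5 : (1 : ℝ) ≤ 2 * Real.log (2 / δ) := by linarith
    nlinarith

/-- The running time in terms of the number `M` of patterns. -/
theorem time_le {ε δ : ℝ} (hε : ε ∈ Set.Ioo (0 : ℝ) 1) (hδ : δ ∈ Set.Ioo (0 : ℝ) 1) {M J : ℕ}
    (hM : 1 ≤ M) (hJ : ∀ j < J, 2 ^ j * (δ / (8 * M)) < 1) :
    (2000 : ℝ) * M ^ 2 * (⌈512 * (M : ℝ) ^ 4 * J / ε⌉₊ + 1) ≤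
      2 ^ 26 * M ^ 7 / ε * Real.log (2 / δ) := by
  have hJ' := repetition_exponent_le hδ hM hJ
  set L := Real.log (2 / δ) with hLdef
  have hM1 : (1 : ℝ) ≤ M := by exact_mod_cast hM
  have hε0 := hε.1
  have hL : 1 / 2 ≤ L := by
    have hlog2 := Real.log_two_gt_d9
    have : Real.log 2 ≤ L := by
      refine Real.log_le_log (by norm_num) ?_
      rw [le_div_iff₀ hδ.1]
      linarith [hδ.2]
    linarith
  have h1 : 512 * (M : ℝ) ^ 4 * J / ε ≤ 17408 * (M ^ 5 * L / ε) := by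
    rw [mul_div_assoc', div_le_div_iff_of_pos_right hε0]
    calc 512 * (M : ℝ) ^ 4 * J ≤ 512 * M ^ 4 * (34 * M * L) :=
          mul_le_mul_of_nonneg_left hJ' (by positivity)
      _ = 17408 * (M ^ 5 * L) := by ring
  have h2 : 1 ≤ 2 * (M ^ 5 * L / ε) := by
    rw [mul_div_assoc', le_div_iff₀ hε0]
    have h5 : (1 : ℝ) ≤ (M : ℝ) ^ 5 := one_le_pow₀ hM1
    nlinarith [hε.2]
  have h3 : (⌈512 * (M : ℝ) ^ 4 * J / ε⌉₊ : ℝ) ≤ 512 * (M : ℝ) ^ 4 * J / ε + 1 :=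
    (Nat.ceil_lt_add_one (by positivity)).le
  calc (2000 : ℝ) * M ^ 2 * (⌈512 * (M : ℝ) ^ 4 * J / ε⌉₊ + 1)
      ≤ 2000 * M ^ 2 * (17412 * (M ^ 5 * L / ε)) :=
        mul_le_mul_of_nonneg_left (by linarith) (by positivity)
    _ = 34824000 * (M ^ 7 / ε * L) := by ring
    _ ≤ 2 ^ 26 * (M ^ 7 / ε * L) := mul_le_mul_of_nonneg_right (by norm_num) (by positivity)
    _ = 2 ^ 26 * M ^ 7 / ε * L := by ring

/-- All quantities are compared with powers of `n + 1` whose exponents are multiples of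
`Λ = log(2/ε)/log(1/(1-η))`. Constants are absorbed because `η ≤ 2/3` gives `Λ ≥ 1/2`. -/
theorem complexity_le {n k M J : ℕ} {ε δ η : ℝ} (hn : 1 ≤ n) (hε : ε ∈ Set.Ioo (0 : ℝ) 1)
    (hδ : δ ∈ Set.Ioo (0 : ℝ) 1) (hη0 : 0 < η) (hη : η ≤ 2 / 3) (hk : 1 ≤ k)
    (hk' : (1 + η / 8) ^ (k - 1) < 4 / ε) (hM : 1 ≤ M) (hM7 : M ≤ 7 ^ n)
    (hMk : M ≤ (6 * n + 1) ^ k) (hJ : ∀ j < J, 2 ^ j * (δ / (8 * M)) < 1) :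
    (2000 : ℝ) * M ^ 2 * (⌈512 * (M : ℝ) ^ 4 * J / ε⌉₊ + 1) ≤ complexityBound 1230 n ε δ η := by
  refine (time_le hε hδ hM hJ).trans ?_
  have hε0 := hε.1
  have hε1 := hε.2
  have hlog2 := Real.log_two_gt_d9
  have hL : 0 ≤ Real.log (2 / δ) := Real.log_nonneg (by
    rw [le_div_iff₀ hδ.1]
    linarith [hδ.2])
  refine mul_le_mul_of_nonneg_right (le_min ?_ ?_) hL
  · have h1 : (2 : ℝ) ^ 26 * M ^ 7 ≤ 2 ^ ((1230 : ℝ) * n) := by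
      have h2 : (M : ℝ) ≤ 2 ^ (3 * n) := by
        have h3 : M ≤ 2 ^ (3 * n) := hM7.trans (by
          rw [pow_mul]
          exact Nat.pow_le_pow_left (by norm_num) n)
        exact_mod_cast h3
      calc (2 : ℝ) ^ 26 * M ^ 7 ≤ 2 ^ 26 * (2 ^ (3 * n)) ^ 7 := by gcongr
        _ = 2 ^ (26 + 3 * n * 7) := by rw [← pow_mul, ← pow_add]
        _ ≤ 2 ^ (1230 * n) := pow_le_pow_right₀ (by norm_num) (by omega)
        _ = 2 ^ ((1230 : ℝ) * n) := by rw [← Real.rpow_natCast]; push_cast; rfl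
    refine (div_le_div_of_nonneg_right h1 hε0.le).trans ?_
    refine div_le_div_of_nonneg_left (by positivity) (by positivity) ?_
    nlinarith
  · set ℓ := Real.log (1 / (1 - η)) with hℓdef
    set Λ := Real.log (2 / ε) / ℓ with hΛdef
    have hℓ0 : 0 < ℓ := Real.log_pos (by
      rw [lt_div_iff₀ (by linarith)]
      linarith)
    have hℓη : ℓ ≤ 3 * η := by
      refine (Real.log_le_sub_one_of_pos (by
        have : 0 < 1 - η := by linarith
        positivity)).trans ?_
      rw [sub_le_iff_le_add, div_le_iff₀ (by linarith)]
      nlinarith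
    have hℓ2 : ℓ ≤ 2 * Real.log 2 := by
      rw [← Real.log_rpow (by norm_num)]
      refine Real.log_le_log (by
        have : 0 < 1 - η := by linarith
        positivity) ?_
      rw [div_le_iff₀ (by linarith)]
      norm_num
      linarith
    have hlogη : ℓ / 27 ≤ Real.log (1 + η / 8) := by
      have := Real.one_sub_inv_le_log_of_pos (show 0 < 1 + η / 8 by linarith)
      refine le_trans ?_ this
      have h2 : 1 - (1 + η / 8)⁻¹ = η / 8 / (1 + η / 8) := by
        field_simp
        ring
      rw [h2, le_div_iff₀ (by linarith)]
      nlinarith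
    have hlogε : Real.log 2 ≤ Real.log (2 / ε) := by
      refine Real.log_le_log (by norm_num) ?_
      rw [le_div_iff₀ hε0]
      linarith
    have hΛℓ : Real.log (2 / ε) = Λ * ℓ := by rw [hΛdef, div_mul_cancel₀ _ hℓ0.ne']
    have hΛ : 1 ≤ 2 * Λ := by
      by_contra h
      nlinarith
    have hkΛ : (k : ℝ) ≤ 56 * Λ := by
      have h1 := Real.log_lt_log (by positivity) hk'
      have h2 : Real.log (4 / ε) = Real.log 2 + Real.log (2 / ε) := by
        rw [← Real.log_mul (by norm_num) (by positivity)]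
        congr 1
        ring
      rw [Real.log_pow, h2, Nat.cast_sub hk, Nat.cast_one] at h1
      have h3 : (0 : ℝ) ≤ k - 1 := by
        have : (1 : ℝ) ≤ k := by exact_mod_cast hk
        linarith
      have h4 : ((k : ℝ) - 1) * (ℓ / 27) < 2 * (Λ * ℓ) := by
        have := mul_le_mul_of_nonneg_left hlogη h3
        linarith
      have h5 : ((k : ℝ) - 1) < 54 * Λ := by
        by_contra h
        nlinarith
      linarith
    set B : ℝ := (n : ℝ) + 1 with hBdef
    have hB2 : 2 ≤ B := by
      have : (1 : ℝ) ≤ n := by exact_mod_cast hn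
      linarith
    have hB0 : 0 < B := by linarith
    have hMB : (M : ℝ) ≤ B ^ (168 * Λ) := by
      have h1 : M ≤ (n + 1) ^ (3 * k) := hMk.trans (by
        rw [pow_mul]
        refine Nat.pow_le_pow_left ?_ k
        have h2 : n ≤ n * n := Nat.le_mul_of_pos_left _ hn
        have h3 : (n + 1) ^ 3 = n * n * n + 3 * (n * n) + 3 * n + 1 := by ring
        omega)
      calc (M : ℝ) ≤ B ^ (3 * k) := by rw [hBdef]; exact_mod_cast h1
        _ = B ^ (3 * (k : ℝ)) := by rw [← Real.rpow_natCast]; push_cast; rfl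
        _ ≤ B ^ (168 * Λ) := Real.rpow_le_rpow_of_exponent_le (by linarith) (by linarith)
    have h26 : (2 : ℝ) ^ 26 ≤ B ^ (52 * Λ) := by
      calc (2 : ℝ) ^ 26 ≤ B ^ 26 := pow_le_pow_left₀ (by norm_num) hB2 _
        _ = B ^ (26 : ℝ) := by rw [← Real.rpow_natCast]; norm_num
        _ ≤ B ^ (52 * Λ) := Real.rpow_le_rpow_of_exponent_le (by linarith) (by linarith)
    have hεB : 1 / ε ≤ B ^ (2 * Λ) := by
      have h1 : 1 / ε ≤ 2 / ε := div_le_div_of_nonneg_right (by norm_num) hε0.le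
      refine h1.trans ?_
      rw [← Real.log_le_log_iff (by positivity) (by positivity), Real.log_rpow hB0, hΛℓ]
      have h2 := Real.log_le_log (by norm_num) hB2
      nlinarith
    calc (2 : ℝ) ^ 26 * M ^ 7 / ε = 2 ^ 26 * M ^ 7 * (1 / ε) := by ring
      _ ≤ B ^ (52 * Λ) * (B ^ (168 * Λ)) ^ 7 * B ^ (2 * Λ) := by gcongr
      _ = B ^ (1230 * Λ) := by
        rw [← Real.rpow_natCast, ← Real.rpow_mul hB0.le, ← Real.rpow_add hB0,
          ← Real.rpow_add hB0]
        congr 1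
        push_cast
        ring

/-! ### The test loss -/

theorem continuous_coeff {n : ℕ} (q : Pattern n) (ν : Fin 3 → ℝ) :
    Continuous fun x : Fin n → BlochSphere => q.coeff ν fun i => bloch (x i) := by
  unfold Pattern.coeff
  refine continuous_finsetProd _ fun i _ => ?_
  rcases q i with _ | d
  · exact continuous_const
  · simp only [Option.elim_some]
    have : ∀ p, Continuous fun x : Fin n → BlochSphere => bloch (x i) p := fun p =>
      (continuous_bloch p).comp (continuous_apply i)
    fun_prop

theorem measurable_multi_probe {n : ℕ} (c : (Fin n → Option (Fin 3)) → ℝ) (q : Pattern n) :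
    Measurable fun ν => multi c (q.probe ν) := by
  unfold multi
  refine Continuous.measurable (continuous_finsetSum _ fun P _ => continuous_const.mul
    (continuous_finsetProd _ fun i _ => ?_))
  unfold Pattern.probe extend
  rcases q i with _ | d <;> rcases P i with _ | p <;> simp only [Option.elim_some, Option.elim_none]
    <;> fun_prop

/-- If the estimates are accurate up to `√ε / (16 M²)`, the prediction has mean squared error at
most `ε`: the truncation costs `ε / 4`, and the interpolation `√ε / 2` uniformly. -/
theorem hasTestLoss_of_accurate {n k M : ℕ} {D : Measure BlochSphere} [IsProbabilityMeasure D]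
    (E : Channel n) {O : Op n} (hO : IsBoundedObservable O) {ε η : ℝ} (hε : 0 < ε) (hη0 : 0 ≤ η)
    (hη : opNorm (secondMoment D) ≤ 1 - η) (hk : n ≤ k ∨ 4 / ε ≤ (1 + η / 8) ^ k)
    {Q : ℕ → Pattern n}
    (hQ : ∀ Φ : Pattern n → ℝ, ∑ j ∈ Finset.range M, Φ (Q j) = ∑ q ∈ lowPatterns n k, Φ q)
    (hM : n < M) {ν : Fin 3 → ℝ} (hνsq : ∑ p, ν p ^ 2 ≤ 1)
    (hν : ∀ p, |ν p - meanBloch D p| ≤ √ε / (16 * M ^ 2)) {g : ℕ → ℝ}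
    (hg : ∀ j < M, |g j - multi (pauliCoeff (channelFunctional E O)) ((Q j).probe ν)| ≤
      √ε / (16 * M ^ 2)) :
    HasTestLoss D E O
      (fun x => ∑ j ∈ Finset.range M, ((Q j).coeff ν fun i => bloch (x i)) * g j) ε := by
  have hl := isContractive_channelFunctional E hO
  set l := channelFunctional E O with hldef
  have hprob : IsProbabilityMeasure (productLaw n D) := by unfold productLaw; infer_instance
  set h : (Fin n → BlochSphere) → ℝ := fun x => multi (pauliCoeff l) fun i => bloch (x i) with hh
  set T : (Fin n → BlochSphere) → ℝ := fun x => ∑ A : Finset (Fin n) with A.card ≤ k,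
    component (pauliCoeff l) (meanBloch D) A fun i => bloch (x i) with hT
  set f : (Fin n → BlochSphere) → ℝ := fun x =>
    ∑ j ∈ Finset.range M, ((Q j).coeff ν fun i => bloch (x i)) * g j with hf
  have hexp : ∀ x, expectation E O (productState x) = h x := fun x =>
    expectation_productOp E hO fun i => bloch (x i)
  have hTc : Continuous T := continuous_finsetSum _ fun A _ => continuous_component _ _ A
  have hfc : Continuous f :=
    continuous_finsetSum _ fun j _ => (continuous_coeff (Q j) ν).mul continuous_const
  have hhc : Continuous h := by
    have : h = fun x => ∑ A : Finset (Fin n),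
        component (pauliCoeff l) (meanBloch D) A fun i => bloch (x i) :=
      funext fun x => multi_eq_sum_component _ _ _
    rw [this]
    exact continuous_finsetSum _ fun A _ => continuous_component _ _ A
  have hint : ∀ {u : (Fin n → BlochSphere) → ℝ}, Continuous u → Integrable u (productLaw n D) :=
    fun hu => hu.integrable_of_hasCompactSupport (HasCompactSupport.of_compactSpace _)
  have hmean : ∑ p, meanBloch D p ^ 2 ≤ 1 := by
    have h1 := integral_sq_sub_meanBloch D
    have h2 : 0 ≤ ∫ x, ∑ p, (bloch x p - meanBloch D p) ^ 2 ∂D :=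
      integral_nonneg fun x => Finset.sum_nonneg fun p _ => sq_nonneg _
    linarith
  have hM1 : (1 : ℝ) ≤ M := by exact_mod_cast (by omega : 1 ≤ M)
  have hTf : ∀ x, (T x - f x) ^ 2 ≤ ε / 4 := by
    intro x
    have h1 := interpolation_error (k := k) (fun v hv => hl.abs_multi_le hv) hQ hνsq hmean
      (x := fun i => bloch (x i)) (fun i => (sum_bloch_sq (x i)).le) hν hg
    have h2 : (M : ℝ) * ((4 * n + 1) * (√ε / (16 * M ^ 2))) ≤ √ε / 2 := by
      have h3 : (4 * n + 1 : ℝ) ≤ 4 * M := by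
        have : (n : ℝ) + 1 ≤ M := by exact_mod_cast hM
        linarith
      calc (M : ℝ) * ((4 * n + 1) * (√ε / (16 * M ^ 2)))
          ≤ M * (4 * M * (√ε / (16 * M ^ 2))) := by gcongr
        _ = √ε / 4 := by field_simp; norm_num
        _ ≤ √ε / 2 := by linarith [Real.sqrt_nonneg ε]
    have h3 := abs_sub_comm (f x) (T x) ▸ h1.trans h2
    have h4 := sq_le_sq' (abs_le.mp h3).1 (abs_le.mp h3).2
    rw [div_pow, Real.sq_sqrt hε.le] at h4
    linarith
  have htrunc : ∫ x, (h x - T x) ^ 2 ∂(productLaw n D) ≤ ε / 4 := by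
    refine truncation_error D hl hη0 hη (by positivity) (hk.imp_right fun h4 => ?_)
    rw [div_le_iff₀ hε] at h4
    linarith
  unfold HasTestLoss
  simp only [hexp]
  refine ⟨hint ((hhc.sub hfc).pow 2), ?_⟩
  calc ∫ x, (h x - f x) ^ 2 ∂(productLaw n D)
      ≤ ∫ x, (2 * (h x - T x) ^ 2 + ε / 2) ∂(productLaw n D) := by
        refine integral_mono (hint ((hhc.sub hfc).pow 2))
          (((hint ((hhc.sub hTc).pow 2)).const_mul 2).add (integrable_const _)) fun x => ?_
        have := hTf x
        simp only
        nlinarith [sq_nonneg ((h x - T x) - (T x - f x))]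
    _ = 2 * ∫ x, (h x - T x) ^ 2 ∂(productLaw n D) + ε / 2 := by
        have hi : Integrable (fun x => (h x - T x) ^ 2) (productLaw n D) :=
          hint ((hhc.sub hTc).pow 2)
        rw [integral_add (hi.const_mul 2) (integrable_const _), integral_const_mul]
        simp
    _ ≤ ε := by linarith

/-- With `512 M⁴ J / ε` repetitions, the failure probability of the estimates is at most `δ`. -/
theorem failure_le {ε δ : ℝ} (hε : 0 < ε) (hδ : 0 < δ) {M J : ℕ} (hM : 3 ≤ M)
    (hJ : 1 ≤ 2 ^ J * (δ / (8 * M))) :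
    (3 + M) * (2 * Real.exp
      (-(⌈512 * (M : ℝ) ^ 4 * J / ε⌉₊ * (√ε / (16 * M ^ 2)) ^ 2 / 2))) ≤ δ := by
  have hM3 : (3 : ℝ) ≤ M := by exact_mod_cast hM
  have hM0 : (0 : ℝ) < M := by linarith
  have h1 : (J : ℝ) ≤ ⌈512 * (M : ℝ) ^ 4 * J / ε⌉₊ * (√ε / (16 * M ^ 2)) ^ 2 / 2 := by
    have h2 := Nat.le_ceil (512 * (M : ℝ) ^ 4 * J / ε)
    have h3 : (√ε / (16 * M ^ 2)) ^ 2 / 2 = ε / (512 * M ^ 4) := by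
      rw [div_pow, Real.sq_sqrt hε.le]
      field_simp
      norm_num
    rw [mul_div_assoc, h3]
    calc (J : ℝ) = 512 * (M : ℝ) ^ 4 * J / ε * (ε / (512 * M ^ 4)) := by field_simp
      _ ≤ _ := mul_le_mul_of_nonneg_right h2 (by positivity)
  have h2 : Real.exp (-(J : ℝ)) ≤ δ / (8 * M) := by
    have h3 : (2 : ℝ) ^ J ≤ Real.exp J := by
      rw [← Real.exp_one_pow]
      exact pow_le_pow_left₀ (by norm_num) (by linarith [Real.add_one_le_exp (1 : ℝ)]) J
    rw [Real.exp_neg, inv_le_iff_one_le_mul₀ (Real.exp_pos _), mul_comm]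
    exact hJ.trans (mul_le_mul_of_nonneg_right h3 (by positivity))
  calc _ ≤ (3 + (M : ℝ)) * (2 * Real.exp (-(J : ℝ))) := by gcongr
    _ ≤ (M + M) * (2 * (δ / (8 * M))) := by gcongr
    _ = δ / 2 := by field_simp; norm_num
    _ ≤ δ := by linarith

end QLearn

theorem theorem1p1 :
    ∃ (learn predict : Prog) (C : ℝ), 0 < C ∧ predict.OracleFree ∧
      ∀ (n : ℕ) (ε δ η : ℝ), 1 ≤ n → ε ∈ Set.Ioo (0 : ℝ) 1 → δ ∈ Set.Ioo (0 : ℝ) 1 →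
        η ∈ Set.Ioo (0 : ℝ) 1 →
      ∀ (D : MeasureTheory.Measure BlochSphere) [MeasureTheory.IsProbabilityMeasure D],
        opNorm (secondMoment D) ≤ 1 - η →
      ∀ (E : Channel n) (O : Op n), IsBoundedObservable O →
      ∃ f : Randomness n → (Fin n → BlochSphere) → ℝ,
        (∀ ω : Randomness n,
          Outputs learn predict ⟨E, O, ω⟩ ε δ η (complexityBound C n ε δ η) (f ω)) ∧
        randomnessLaw n D {ω | ¬ HasTestLoss D E O (f ω) ε} ≤ ENNReal.ofReal δ := by
  refine ⟨learnProg, predictProg, 1230, by norm_num, predictProg_oracleFree, ?_⟩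
  intro n ε δ η hn hε hδ hη D _ hS E O hO
  have hprob : IsProbabilityMeasure (randomnessLaw n D) := by unfold randomnessLaw; infer_instance
  obtain ⟨ω₀⟩ := (randomnessLaw n D).nonempty_of_neZero
  obtain ⟨k, J, M, R, Q, hk, hk1, hk2, hQ, hJ, hJ', hR, hrun⟩ :=
    learnProg_runs hn ⟨E, O, ω₀⟩ (η := η) hε hδ.1
  have hη3 : η ≤ 2 / 3 := by
    have := one_le_three_mul_opNorm D
    linarith
  have hcard := card_of_sum_eq hQ
  have hnM : 6 * n < M := hcard ▸ six_mul_lt_card_lowPatterns hn hk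
  have hbound := complexity_le hn hε hδ hη.1 hη3 hk hk2 (by omega)
    (hcard ▸ card_lowPatterns_le_seven_pow n k) (hcard ▸ card_lowPatterns_le_pow n k) hJ'
  rw [← hR] at hbound
  have hcast : ∀ t : ℕ, t ≤ 2000 * M ^ 2 * (R + 1) → (t : ℝ) ≤ complexityBound 1230 n ε δ η :=
    fun t ht => le_trans (by exact_mod_cast ht) hbound
  refine ⟨fun ω x => ∑ j ∈ Finset.range M,
    ((Q j).coeff (meanEstimate R ω.1 ⟨0, hn⟩) fun i => bloch (x i)) *
      valueEstimate R j ω.2 (multi (pauliCoeff (channelFunctional E O))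
        ((Q j).probe (meanEstimate R ω.1 ⟨0, hn⟩))), fun ω => ?_, ?_⟩
  · obtain ⟨t, s, hexec, ht, hd, hq, hpred⟩ := hrun ⟨E, O, ω⟩ hO
    have hMM : M ≤ M ^ 2 := by nlinarith
    refine ⟨t, s, hexec, hcast t ht, hcast _ ?_, fun x => ?_⟩
    · rw [hd, hq]
      nlinarith [Nat.mul_le_mul_right R hMM, Nat.mul_le_mul_right R (show 1 ≤ M by omega)]
    · obtain ⟨t₁, s₁, hexec₁, ht₁, hs₁⟩ := hpred x
      refine ⟨t₁, s₁, hexec₁, hcast t₁ (ht₁.trans ?_), hs₁⟩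
      nlinarith [Nat.zero_le (M ^ 2 * R)]
  · have hM0 : (1 : ℝ) ≤ M := by exact_mod_cast (by omega : 1 ≤ M)
    have hR1 : 1 ≤ R := by
      rw [hR, Nat.one_le_ceil_iff]
      have hJ0 : J ≠ 0 := by
        rintro rfl
        rw [pow_zero, one_mul, le_div_iff₀ (by linarith)] at hJ
        linarith [hδ.2]
      have := hε.1
      positivity
    have hconc := estimates_concentration D (⟨0, hn⟩ : Fin n) (R := R) hR1
      (τ := √ε / (16 * M ^ 2)) (by positivity) M
      (fun j ν => multi (pauliCoeff (channelFunctional E O)) ((Q j).probe ν))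
      (fun j => measurable_multi_probe _ _)
      fun j y => (isContractive_channelFunctional E hO).abs_multi_le
        ((Q j).probe_sq_le (meanEstimate_sq_le y _))
    refine (measure_mono fun ω hω => ?_).trans (hconc.trans (ENNReal.ofReal_le_ofReal ?_))
    · intro hacc
      exact hω (hasTestLoss_of_accurate E hO hε.1 hη.1.le hS hk1 hQ (by omega)
        (meanEstimate_sq_le _ _) hacc.1 hacc.2)
    · rw [hR]
      exact failure_le hε.1 hδ.1 (by omega) hJ
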